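/- **Theorem.** Let $k,m\ge 1$ and $n=k+m$. Consider on (a part of) the genus-zero Hurwitz space $H_{0,k+m}(k,m)$ the following two sets of Hurwitz data: * the trigonometric polynomials $\lambda(p)=e^{-imp}\prod_{a=1}^{n}(e^{ip}-e^{iz^a})$, $p$ modulo $2\pi$, with primary differential $dp$ and coordinates $z=(z^1,\dots,z^n)$; * the rational functions $\lambda(\hat p)=\prod_{a=1}^{n}(\hat p-\hat z^a)/(\hat p-\hat z^0)^m$, $m\hat z^0=\sum_a\hat z^a$, with primary differential $d\hat p$ and coordinates $\hat z=(\hat z^1,\dots,\hat z^n)$. For Hurwitz data $\{\lambda,dv\}$ put $$\langle\partial',\partial''\rangle=-\sum_{d\lambda=0}\operatorname{res}\frac{\partial'\lambda\,\partial''\lambda}{\lambda'}\,dv,\qquad \langle\partial'\circ\partial'',\partial'''\rangle=-\sum_{d\lambda=0}\operatorname{res}\frac{\partial'\lambda\,\partial''\lambda\,\partial'''\lambda}{\lambda'}\,dv,$$ $$(\partial',\partial'')=-\sum_{d\lambda=0}\operatorname{res}\frac{\partial'\log\lambda\,\partial''\log\lambda}{(\log\lambda)'}\,dv,\qquad (\partial'\star\partial'',\partial''')=-\sum_{d\lambda=0}\operatorname{res}\frac{\partial'\log\lambda\,\partial''\log\lambda\,\partial'''\log\lambda}{(\log\lambda)'}\,dv,$$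 where tangent vectors differentiate $\lambda$ at fixed $v$ and $'=d/dv$. Write $\langle\,,\rangle,\circ,(\,,),\star$ for the structures of $\{\lambda,dp\}$, and $\langle\,,\rangle_\kappa,\circ,(\,,)_\kappa,\star$ for those of $\{\lambda,d\hat p\}$. Let $M$ be the set of all $z\in\mathbb C^n$ such that the $e^{iz^a}$ are pairwise distinct and all zeros of $\lambda'$ are simple. On $M$ the following holds. 1. The map $z\mapsto\hat z$ determined by $e^{iz^a}=\hat z^a-\hat z^0$ is locally biholomorphic, and with $\hat p=e^{ip}+\hat z^0$ the two superpotentials are the same function. The vector field $E=\frac1{ik}\sum_a\partial_{z^a}=\frac1k\sum_a\hat z^a\partial_{\hat z^a}$ is the Euler field, i.e. $E\lambda=\lambda$ at the zeros of $d\lambda$. In both cases all metrics are nondegenerate, $X\star Y=E^{-1}\circ X\circ Y$, $(X,Y)=\langle E^{-1}\circ X,Y\rangle$ and $(X,Y)_\kappa=\langle E^{-1}\circ X,Y\rangle_\kappa$, where $E^{-1}\circ E=e$ is the unit of $\circ$. 2. There is a holomorphic vector field $\partial_\kappa$ on $M$ with $d\hat p=\partial_\kappa(\lambda\,dp)$ at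 the zeros of $d\lambda$. It is flat (covariantly constant) for $\langle\,,\rangle$, and it generates a Legendre transformation: the product $\circ$ of the two sets of data is the same, and $\langle X,Y\rangle_\kappa=\langle\partial_\kappa\circ\partial_\kappa,X\circ Y\rangle$. 3. The $z^a$ are flat coordinates of $(\,,)$ with dual prepotential $$F^\star=A\sum_i(z^i)^3+B\sum_i(z^i)^2\sum_{j\ne i}z^j+C\sum_{i<j<l}z^iz^jz^l+\tfrac12\sum_{i\ne j}\mathrm{Li}_3\big(e^{i(z^i-z^j)}\big),$$ $$A=-\tfrac{i}{12m}\big[(m-2)(m-1)-mk\big],\qquad B=-\tfrac{i}{4m}(2-m),\qquad C=-\tfrac im,$$ and the $\hat z^a$ are flat coordinates of $(\,,)_\kappa$ with dual prepotential $$\hat F^\star=\tfrac14\sum_{0\le i<j\le n}\alpha_i\alpha_j(\hat z^i-\hat z^j)^2\log(\hat z^i-\hat z^j)^2\Big|_{m\hat z^0=\sum_a\hat z^a},\qquad \alpha_0=-m,\quad\alpha_{i>0}=1,$$ for any local branches of the trilogarithms and logarithms. That is, the third derivatives of $F^\star$ (of $\hat F^\star$) are the components of $(X\star Y,Z)$ (of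 $(X\star Y,Z)_\kappa$) in the coordinates $z$ (in the coordinates $\hat z$), and $F^\star$ and $\hat F^\star$ satisfy the WDVV equations with respect to the constant metrics $(\,,)$ and $(\,,)_\kappa$. 4. $F^\star$ and $\hat F^\star$ are connected via the twisted Legendre transformation generated by the holomorphic vector field $\hat\partial_\kappa=E\circ\partial_\kappa$: the product $\star$ of the two sets of data is the same, $$(X,Y)_\kappa=(\hat\partial_\kappa\star\hat\partial_\kappa,\,X\star Y),\qquad \partial_{z^a}=\hat\partial_\kappa\star\partial_{\hat z^a},\qquad d\hat z_a=(\hat\partial_\kappa\star\partial_{z^a},\,\cdot\,),$$ where $\hat z_a=\sum_b(\partial_{\hat z^a},\partial_{\hat z^b})_\kappa\,\hat z^b$; the components of $(\,,)_\kappa$ in the coordinates $\hat z$ equal those of $(\,,)$ in the coordinates $z$; and, up to additive constants (prepotentials being defined up to quadratic polynomials), $$\frac{\partial^2\hat F^\star}{\partial\hat z^a\partial\hat z^b}=\frac{\partial^2F^\star}{\partial z^a\partial z^b}.$$ -/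

import Mathlib

open Filter
open scoped Topology

noncomputable section

namespace HurwitzLegendre

/-! ### Residues and genus-zero Hurwitz data -/

/-- The residue at `c` of the one-form `f(v) dv`, for `f` holomorphic on a punctured
neighbourhood of `c`: the common value of `(2πi)⁻¹ ∮_{|v - c| = r} f(v) dv` for small `r > 0`. -/
def residue (f : ℂ → ℂ) (c : ℂ) : ℂ :=
  limUnder (𝓝[>] (0 : ℝ)) fun r : ℝ =>
    (2 * (Real.pi : ℂ) * Complex.I)⁻¹ * ∮ v in C(c, r), f v

/-- Hurwitz data `{λ, dv}` in local coordinates `z ∈ ℂⁿ` on the parameter space.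
`lam z v` is the superpotential, written in a coordinate `v` of the curve such that `dv` is the
primary differential, and `dom z` is a set of values of `v` that represents each point of the curve
which is not a pole of `λ` exactly once. -/
structure HurwitzData (n : ℕ) where
  lam : (Fin n → ℂ) → ℂ → ℂ
  dom : (Fin n → ℂ) → Set ℂ

/-- The Gram matrix of a bilinear form in the coordinate frame. -/
def gram {n : ℕ} (g : (Fin n → ℂ) → (Fin n → ℂ) → ℂ) : Matrix (Fin n) (Fin n) ℂ :=
  Matrix.of fun a b => g (Pi.single a 1) (Pi.single b 1)

/-- The partial derivative of `F` in the `a`-th coordinate. -/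
def pd {n : ℕ} (a : Fin n) (F : (Fin n → ℂ) → ℂ) : (Fin n → ℂ) → ℂ :=
  fun z => fderiv ℂ F z (Pi.single a 1)

namespace HurwitzData

variable {n : ℕ} (S : HurwitzData n)

/-- The critical points of `λ`, i.e. the zeros of `dλ`. -/
def crit (z : Fin n → ℂ) : Set ℂ := {v | v ∈ S.dom z ∧ deriv (S.lam z) v = 0}

/-- `∂_X λ(v)`, the derivative of `λ` along the tangent vector `X` at fixed `v`. -/
def var (z X : Fin n → ℂ) (v : ℂ) : ℂ := fderiv ℂ (fun y => S.lam y v) z X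

/-- `∂_X log λ(v)`, at fixed `v`. -/
def varLog (z X : Fin n → ℂ) (v : ℂ) : ℂ := S.var z X v / S.lam z v

/-- The metric `<X, Y>`. -/
def eta (z X Y : Fin n → ℂ) : ℂ :=
  - ∑ᶠ v ∈ S.crit z, residue (fun w => S.var z X w * S.var z Y w / deriv (S.lam z) w) v

/-- The cubic tensor `<X ∘ Y, Z>`. -/
def cubic (z X Y Z : Fin n → ℂ) : ℂ :=
  - ∑ᶠ v ∈ S.crit z,
      residue (fun w => S.var z X w * S.var z Y w * S.var z Z w / deriv (S.lam z) w) v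

/-- The intersection form `(X, Y)`. -/
def dualEta (z X Y : Fin n → ℂ) : ℂ :=
  - ∑ᶠ v ∈ S.crit z,
      residue (fun w => S.varLog z X w * S.varLog z Y w / logDeriv (S.lam z) w) v

/-- The cubic tensor `(X ⋆ Y, Z)`. -/
def dualCubic (z X Y Z : Fin n → ℂ) : ℂ :=
  - ∑ᶠ v ∈ S.crit z,
      residue (fun w =>
        S.varLog z X w * S.varLog z Y w * S.varLog z Z w / logDeriv (S.lam z) w) v

/-- The product `X ∘ Y`: the index of the cubic tensor is raised with `<,>`. -/
def circ (z X Y : Fin n → ℂ) : Fin n → ℂ :=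
  Matrix.mulVec (gram (S.eta z))⁻¹ fun s => S.cubic z X Y (Pi.single s 1)

/-- The product `X ⋆ Y`: the index of the dual cubic tensor is raised with `(,)`. -/
def star (z X Y : Fin n → ℂ) : Fin n → ℂ :=
  Matrix.mulVec (gram (S.dualEta z))⁻¹ fun s => S.dualCubic z X Y (Pi.single s 1)

/-- `E` is the Euler field at `z`: the critical values of `λ` (the canonical coordinates)
satisfy `E(uᵢ) = uᵢ`. -/
def IsEulerAt (E : (Fin n → ℂ) → Fin n → ℂ) (z : Fin n → ℂ) : Prop :=
  ∀ v ∈ S.crit z, S.var z (E z) v = S.lam z v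

/-- The structures `(,)` and `⋆` are the dual ones of `<,>`, `∘` with respect to `E`:
`X ⋆ Y = E⁻¹ ∘ X ∘ Y` and `(X, Y) = <E⁻¹ ∘ X, Y>`, where `E⁻¹ ∘ E = e` is the unit of `∘`. -/
structure IsDualAt (E : (Fin n → ℂ) → Fin n → ℂ) (z : Fin n → ℂ) : Prop where
  eta_nondeg : IsUnit (gram (S.eta z)).det
  dualEta_nondeg : IsUnit (gram (S.dualEta z)).det
  inverse : ∃ e Einv : Fin n → ℂ,
    (∀ X, S.circ z e X = X) ∧ S.circ z Einv (E z) = e ∧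
    (∀ X Y, S.star z X Y = S.circ z Einv (S.circ z X Y)) ∧
    (∀ X Y, S.dualEta z X Y = S.eta z (S.circ z Einv X) Y)

/-- The vector field `V` is flat for `<,>` at `z`: its covariant derivative for the Levi-Civita
connection vanishes, `η_{bc} ∂_a V^c + Γ_{b,ac} V^c = 0`. -/
structure IsFlatFieldAt (V : (Fin n → ℂ) → Fin n → ℂ) (z : Fin n → ℂ) : Prop where
  field_diff : DifferentiableAt ℂ V z
  metric_diff : ∀ a b, DifferentiableAt ℂ (fun y => gram (S.eta y) a b) z
  parallel : ∀ a b,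
    ∑ c, (gram (S.eta z) b c * pd a (fun y => V y c) z
      + (1 / 2) * (pd a (fun y => gram (S.eta y) b c) z + pd c (fun y => gram (S.eta y) a b) z
          - pd b (fun y => gram (S.eta y) a c) z) * V z c) = 0

/-- `F` is a dual prepotential at `z`, with `z` flat coordinates of the intersection form:
the components `G` of `(,)` are constant near `z`, the third derivatives of `F` are the components
of `(X ⋆ Y, Z)`, and `F` satisfies the WDVV equations with respect to `G`. -/
structure IsDualPrepotentialAt (F : (Fin n → ℂ) → ℂ) (z : Fin n → ℂ) : Prop where
  analytic : AnalyticAt ℂ F z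
  flat : ∀ᶠ y in 𝓝 z, gram (S.dualEta y) = gram (S.dualEta z)
  third : ∀ a b c, pd a (pd b (pd c F)) z
    = S.dualCubic z (Pi.single a 1) (Pi.single b 1) (Pi.single c 1)
  wdvv : ∀ a b c d,
    ∑ p, ∑ q, pd a (pd b (pd p F)) z * (gram (S.dualEta z))⁻¹ p q * pd q (pd c (pd d F)) z
    = ∑ p, ∑ q, pd d (pd b (pd p F)) z * (gram (S.dualEta z))⁻¹ p q * pd q (pd c (pd a F)) z

end HurwitzData

/-! ### Legendre transformations

`S` and `R` are two sets of Hurwitz data on one parameter space, in coordinates `z` and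
`Φ z` respectively. -/

/-- The Legendre transformation generated by the field `V = ∂_κ`, at `z`: `V` is flat for `<,>`,
the product `∘` is unchanged, and `<X, Y>_κ = <∂_κ ∘ ∂_κ, X ∘ Y>`. -/
structure IsLegendreAt {n : ℕ} (S R : HurwitzData n) (Φ V : (Fin n → ℂ) → Fin n → ℂ)
    (z : Fin n → ℂ) : Prop where
  flat : S.IsFlatFieldAt V z
  mul : ∀ X Y, fderiv ℂ Φ z (S.circ z X Y)
    = R.circ (Φ z) (fderiv ℂ Φ z X) (fderiv ℂ Φ z Y)
  metric : ∀ X Y, R.eta (Φ z) (fderiv ℂ Φ z X) (fderiv ℂ Φ z Y)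
    = S.eta z (S.circ z (V z) (V z)) (S.circ z X Y)

/-- The twisted Legendre transformation generated by `W = E ∘ V`, at `z`, from the dual
prepotential `F` in the coordinates `z` to the dual prepotential `Fhat` in the coordinates
`zhat = Φ z`. -/
structure IsTwistedLegendreAt {n : ℕ} (S R : HurwitzData n) (Φ E V W : (Fin n → ℂ) → Fin n → ℂ)
    (F Fhat : (Fin n → ℂ) → ℂ) (z : Fin n → ℂ) : Prop where
  /-- `W = E ∘ ∂_κ` -/
  generator : W z = S.circ z (E z) (V z)
  /-- the product `⋆` is unchanged -/
  mul : ∀ X Y, fderiv ℂ Φ z (S.star z X Y)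
    = R.star (Φ z) (fderiv ℂ Φ z X) (fderiv ℂ Φ z Y)
  /-- `(X, Y)_κ = (W ⋆ W, X ⋆ Y)` -/
  metric : ∀ X Y, R.dualEta (Φ z) (fderiv ℂ Φ z X) (fderiv ℂ Φ z Y)
    = S.dualEta z (S.star z (W z) (W z)) (S.star z X Y)
  /-- `∂/∂z^a = W ⋆ ∂/∂zhat^a` -/
  frame : ∀ a : Fin n, fderiv ℂ Φ z (Pi.single a 1)
    = R.star (Φ z) (fderiv ℂ Φ z (W z)) (Pi.single a 1)
  /-- `d zhat_a = (W ⋆ ∂/∂z^a, ·)`, the index being lowered with the metric `(,)_κ` -/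
  coord : ∀ (a : Fin n) (X : Fin n → ℂ),
    ∑ b, gram (R.dualEta (Φ z)) a b * fderiv ℂ Φ z X b
      = S.dualEta z (S.star z (W z) (Pi.single a 1)) X
  /-- the components of the two metrics agree -/
  gram_eq : gram (R.dualEta (Φ z)) = gram (S.dualEta z)
  /-- `∂²Fhat/∂zhat^a∂zhat^b = ∂²F/∂z^a∂z^b`; as prepotentials are only defined up to quadratic
  polynomials, this is up to additive constants -/
  hessian : ∃ K : Matrix (Fin n) (Fin n) ℂ, ∀ᶠ y in 𝓝 z, ∀ a b,
    pd a (pd b Fhat) (Φ y) = pd a (pd b F) y + K a b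

/-! ### Branches of multivalued functions -/

/-- `L` is, near `x`, a branch of the trilogarithm: it is obtained from
`Li₃(x) = ∑_{j ≥ 1} x^j / j³` near `0` by analytic continuation along a path from `0` to `x`. -/
def IsTrilogBranchAt (L : ℂ → ℂ) (x : ℂ) : Prop :=
  ∃ (γ : ℝ → ℂ) (g : ℝ → ℂ → ℂ),
    ContinuousOn γ (Set.Icc 0 1) ∧ γ 0 = 0 ∧ γ 1 = x ∧
    (∀ t ∈ Set.Icc (0 : ℝ) 1, AnalyticAt ℂ (g t) (γ t)) ∧
    (∀ t ∈ Set.Icc (0 : ℝ) 1, ∀ᶠ s in 𝓝[Set.Icc 0 1] t, g s =ᶠ[𝓝 (γ s)] g t) ∧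
    (g 0 =ᶠ[𝓝 0] fun w => ∑' j : ℕ, w ^ (j + 1) / ((j : ℂ) + 1) ^ 3) ∧
    g 1 =ᶠ[𝓝 x] L

/-- `ℓ` is a branch of the logarithm near `x`. -/
def IsLogBranchAt (ℓ : ℂ → ℂ) (x : ℂ) : Prop :=
  AnalyticAt ℂ ℓ x ∧ ∀ᶠ w in 𝓝 x, Complex.exp (ℓ w) = w

/-! ### The two families on `H_{0,k+m}(k,m)` -/

/-- Trigonometric polynomials of bidegree `(k,m)` with primary differential `dp`:
`λ(p) = e^{-imp} ∏ (e^{ip} - e^{iz^a})`, where `p` is taken modulo `2π`. -/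
def trigData (k m : ℕ) : HurwitzData (k + m) where
  lam z p := Complex.exp (-(Complex.I * m * p))
    * ∏ a, (Complex.exp (Complex.I * p) - Complex.exp (Complex.I * z a))
  dom _ := {p | 0 ≤ p.re ∧ p.re < 2 * Real.pi}

/-- `zhat⁰`, with `m zhat⁰ = ∑ zhat^a`. -/
def zhatZero (k m : ℕ) (y : Fin (k + m) → ℂ) : ℂ := (∑ a, y a) / m

/-- Rational functions with primary differential `d phat`:
`λ(phat) = ∏ (phat - zhat^a) / (phat - zhat⁰)^m`. -/
def ratData (k m : ℕ) : HurwitzData (k + m) where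
  lam y p := (∏ a, (p - y a)) / (p - zhatZero k m y) ^ m
  dom y := {p | p ≠ zhatZero k m y}

/-- The part of the parameter space on which the structures live: the zeros of `λ` are distinct
(so that `0` is no critical value and one is off the discriminant) and all finite
ramification points are simple. -/
def regularLocus (k m : ℕ) : Set (Fin (k + m) → ℂ) :=
  {z | (∀ a b, a ≠ b → Complex.exp (Complex.I * z a) ≠ Complex.exp (Complex.I * z b)) ∧
    ∀ v ∈ (trigData k m).crit z, deriv (deriv ((trigData k m).lam z)) v ≠ 0}

/-- The change of coordinates `z ↦ zhat` determined by `e^{iz^a} = zhat^a - zhat⁰`. -/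
def coordChange (k m : ℕ) (z : Fin (k + m) → ℂ) : Fin (k + m) → ℂ :=
  fun a => Complex.exp (Complex.I * z a) - (∑ b, Complex.exp (Complex.I * z b)) / k

/-- The Euler field in the coordinates `z`: `E = (ik)⁻¹ ∑ ∂/∂z^a`. -/
def trigEuler (k m : ℕ) : (Fin (k + m) → ℂ) → Fin (k + m) → ℂ :=
  fun _ _ => 1 / (Complex.I * k)

/-- The Euler field in the coordinates `zhat`: `E = k⁻¹ ∑ zhat^a ∂/∂zhat^a`. -/
def ratEuler (k m : ℕ) : (Fin (k + m) → ℂ) → Fin (k + m) → ℂ :=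
  fun y a => y a / k

/-- The trigonometric dual prepotential. `L a b` is the branch of the trilogarithm used
in the term `(a,b)`. -/
def trigPrepotential (k m : ℕ) (L : Fin (k + m) → Fin (k + m) → ℂ → ℂ)
    (z : Fin (k + m) → ℂ) : ℂ :=
  -(Complex.I / (12 * m)) * (((m : ℂ) - 2) * ((m : ℂ) - 1) - m * k) * ∑ a, z a ^ 3
  - Complex.I / (4 * m) * (2 - (m : ℂ)) * ∑ a, z a ^ 2 * ∑ b, (if a ≠ b then z b else 0)
  - Complex.I / m * ∑ a, ∑ b, ∑ c, (if a < b ∧ b < c then z a * z b * z c else 0)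
  + (1 / 2) * ∑ a, ∑ b,
      (if a ≠ b then L a b (Complex.exp (Complex.I * (z a - z b))) else 0)

/-- `(zhat⁰, zhat¹, …, zhat^{k+m})`. -/
def extCoord (k m : ℕ) (y : Fin (k + m) → ℂ) : Fin (k + m + 1) → ℂ :=
  Fin.cons (zhatZero k m y) y

/-- The multiplicities `α₀ = -m` and `α_a = 1` for `a > 0`. -/
def alpha (k m : ℕ) : Fin (k + m + 1) → ℂ := Fin.cons (-(m : ℂ)) fun _ => 1

/-- The rational dual prepotential. `ℓ i j` is the branch of the logarithm used
in the term `(i,j)`. -/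
def ratPrepotential (k m : ℕ) (ℓ : Fin (k + m + 1) → Fin (k + m + 1) → ℂ → ℂ)
    (y : Fin (k + m) → ℂ) : ℂ :=
  (1 / 4) * ∑ i, ∑ j, (if i < j then alpha k m i * alpha k m j
    * (extCoord k m y i - extCoord k m y j) ^ 2
    * ℓ i j ((extCoord k m y i - extCoord k m y j) ^ 2) else 0)

end HurwitzLegendre

end

open HurwitzLegendre

/-!
In the coordinate `u = e^{ip} = phat - zhat⁰`, with `x_a = e^{i z_a}`, both superpotentials are the
function `λ = u^{-m} ∏ (u - x_a)`, and its critical points are the roots of the polynomial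
`P = u Π' - m Π`, where `Π = ∏ (u - x_a)`. The part of the theorem that does not involve flatness
or prepotentials is linear algebra in the canonical frame: at a point with `k + m` simple critical
points and nonzero critical values, a tangent vector `X` is determined by the values of `∂_X λ` at
the critical points, and all residues are simple. Hence the metrics are diagonal, `∘` is the
pointwise product and `⋆` is the pointwise product divided by `λ`
(`HurwitzData.IsCanonicalFrame`, `comp_circ`, `comp_star`). In this frame the Legendre field `∂_κ`
has the components `i u`, and `E ∘ ∂_κ` has the components `i u λ`; all identities between the
metrics and products of the two sets of data are then immediate. In the coordinates `z` the field
`∂_κ` is found by Lagrange interpolation (`legendreField`), and `E ∘ ∂_κ` has the components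
`zhat^a / k` (`twistedField`).

Everything else is expressed by the functions `r_a = x_a / (u - x_a)`, for which
`∂_{z_a} λ = -i r_a λ`. The intersection form is `∑ r_a r_b / (log λ)''`, summed over the critical
points, and the dual cubic tensor is `-i ∑ r_a r_b r_c / (log λ)''`. Partial fractions in `u`
reduce both sums to Lagrange interpolation at the roots of `P`
(`IsRegular.sum_ratio_mul_div_hess`, `IsRegular.sum_ratio_mul_mul_div_hess_of_ne`,
`IsRegular.sum_ratio_cube_div_hess`). In particular the intersection form has the constant
components `δ_ab - 1/m`.

For the flatness of `∂_κ`, the critical points are holomorphic in `z` by the implicit function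
theorem (`exists_root_branches`), so `<,>` can be differentiated. The identity
`∂_κ λ = i u - h λ'`, with a constant `h`, and its first two derivatives in `p` turn each component
of the covariant derivative into the sum over the critical points of the residues of a differential
`u r_a r_b (1 - r_a + r_b) / (log λ)'² dp` (`parallel_term`). Such a sum vanishes, since the
differential has no other poles (`sum_parallel_residue`).

Both prepotentials are sums of a cubic polynomial and of functions of one linear form each, so
their third derivatives are explicit. The only facts about the multivalued functions that enter are
the differential equations `(w d/dw)³ Li₃ = w / (1 - w)`, which analytic continuation preserves
(`IsTrilogBranchAt.trilogEq`), and `log' w = 1 / w`. The third derivatives of the trigonometric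
prepotential are compared with the dual cubic tensor directly (`trigThird_eq`); those of the
rational one are first contracted with the Jacobian of `z ↦ zhat` in one index
(`ratThird_coordChange_single`), and this gives the same functions. WDVV is the associativity of
`⋆`. As the mixed components of the rational cubic tensor are the components of the trigonometric
one, the two Hessians differ by constants (`hessian_eq`).
-/

open HurwitzLegendre

namespace HurwitzLegendre

/-! ### Residues at simple poles -/

theorem residue_div_of_simple_zero {f g : ℂ → ℂ} {c : ℂ} (hf : AnalyticAt ℂ f c)
    (hg : AnalyticAt ℂ g c) (h0 : g c = 0) (h1 : deriv g c ≠ 0) :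
    residue (fun w => f w / g w) c = f c / deriv g c := by
  have hq : AnalyticAt ℂ (dslope g c) c := by
    obtain ⟨p, hp⟩ := hg
    exact ⟨_, hp.has_fpower_series_dslope_fslope⟩
  have hqc : dslope g c c = deriv g c := dslope_same g c
  have hh : AnalyticAt ℂ (fun w => f w / dslope g c w) c := hf.div hq (by rwa [hqc])
  obtain ⟨ε, hε, hball⟩ := Metric.eventually_nhds_iff_ball.1 hh.eventually_analyticAt
  have key : ∀ r : ℝ, r ∈ Set.Ioo 0 ε →
      (2 * (Real.pi : ℂ) * Complex.I)⁻¹ * ∮ v in C(c, r), f v / g v = f c / deriv g c := by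
    rintro r ⟨hr0, hrε⟩
    have hcongr : (∮ v in C(c, r), f v / g v)
        = ∮ v in C(c, r), (v - c)⁻¹ • (f v / dslope g c v) := by
      refine circleIntegral.integral_congr hr0.le fun v _ => ?_
      have hgv : g v = (v - c) * dslope g c v := by
        have := sub_smul_dslope g c v
        simp only [smul_eq_mul, h0, sub_zero] at this
        exact this.symm
      simp only [smul_eq_mul]
      rw [hgv, div_mul_eq_div_div_swap, div_eq_inv_mul _ (v - c)]
    have hd : DiffContOnCl ℂ (fun w => f w / dslope g c w) (Metric.ball c r) := by
      refine DifferentiableOn.diffContOnCl fun w hw => ?_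
      refine (hball w ?_).differentiableAt.differentiableWithinAt
      rw [closure_ball c hr0.ne'] at hw
      exact Metric.closedBall_subset_ball hrε hw
    rw [hcongr, hd.circleIntegral_sub_inv_smul (Metric.mem_ball_self hr0), smul_eq_mul, hqc,
      inv_mul_cancel_left₀]
    exact Complex.two_pi_I_ne_zero
  refine Tendsto.limUnder_eq (tendsto_const_nhds.congr' ?_)
  filter_upwards [Ioo_mem_nhdsGT hε] with r hr using (key r hr).symm

/-! ### Bilinear forms diagonal in a frame -/

section Frame

variable {n : ℕ} {U : Finset ℂ} {t : (Fin n → ℂ) →ₗ[ℂ] ℂ → ℂ}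

theorem frame_surjective (hcard : U.card = n) (hinj : ∀ X, (∀ u ∈ U, t X u = 0) → X = 0)
    (f : ℂ → ℂ) : ∃ X, ∀ u ∈ U, t X u = f u := by
  let T : (Fin n → ℂ) →ₗ[ℂ] (U → ℂ) := (LinearMap.funLeft ℂ ℂ (Subtype.val : U → ℂ)).comp t
  have hT : Function.Injective T := by
    rw [← LinearMap.ker_eq_bot, LinearMap.ker_eq_bot']
    exact fun X hX => hinj X fun u hu => congrFun hX ⟨u, hu⟩
  have hfr : Module.finrank ℂ (Fin n → ℂ) = Module.finrank ℂ (U → ℂ) := by simp [hcard]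
  obtain ⟨X, hX⟩ := (LinearMap.injective_iff_surjective_of_finrank_eq_finrank hfr).1 hT
    (fun u => f u)
  exact ⟨X, fun u hu => congrFun hX ⟨u, hu⟩⟩

theorem map_eq_sum_single {V : Type*} [AddCommGroup V] [Module ℂ V]
    (L : (Fin n → ℂ) →ₗ[ℂ] V) (X : Fin n → ℂ) : L X = ∑ a, X a • L (Pi.single a 1) := by
  conv_lhs => rw [pi_eq_sum_univ' X, map_sum]
  simp [Pi.single]

theorem gram_mulVec_of_frame {d : ℂ → ℂ} {B : (Fin n → ℂ) → (Fin n → ℂ) → ℂ}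
    (hB : ∀ X Y, B X Y = ∑ u ∈ U, d u * t X u * t Y u) (Z : Fin n → ℂ) (a : Fin n) :
    (gram B).mulVec Z a = B (Pi.single a 1) Z := by
  rw [Matrix.mulVec, dotProduct, hB, map_eq_sum_single t Z]
  simp only [gram, Matrix.of_apply, hB, Finset.sum_apply, Pi.smul_apply, smul_eq_mul,
    Finset.mul_sum, Finset.sum_mul]
  rw [Finset.sum_comm]
  exact Finset.sum_congr rfl fun _ _ => Finset.sum_congr rfl fun _ _ => by ring

/-- A bilinear form that is diagonal with nonzero entries in a frame is nondegenerate. -/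
theorem isUnit_det_gram_of_frame (hcard : U.card = n)
    (hinj : ∀ X, (∀ u ∈ U, t X u = 0) → X = 0) {d : ℂ → ℂ} (hd : ∀ u ∈ U, d u ≠ 0)
    {B : (Fin n → ℂ) → (Fin n → ℂ) → ℂ} (hB : ∀ X Y, B X Y = ∑ u ∈ U, d u * t X u * t Y u) :
    IsUnit (gram B).det := by
  rw [isUnit_iff_ne_zero]
  intro hdet
  obtain ⟨Z, hZ, hMZ⟩ := Matrix.exists_mulVec_eq_zero_iff.2 hdet
  have h1 : ∀ a, ∑ u ∈ U, d u * t (Pi.single a 1) u * t Z u = 0 := fun a => by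
    rw [← hB, ← gram_mulVec_of_frame hB, hMZ, Pi.zero_apply]
  have h2 : ∀ X, ∑ u ∈ U, d u * t X u * t Z u = 0 := by
    intro X
    rw [map_eq_sum_single t X]
    simp only [Finset.sum_apply, Pi.smul_apply, smul_eq_mul, Finset.mul_sum, Finset.sum_mul]
    rw [Finset.sum_comm]
    refine Finset.sum_eq_zero fun a _ => ?_
    rw [← mul_zero (X a), ← h1 a, Finset.mul_sum]
    exact Finset.sum_congr rfl fun _ _ => by ring
  refine hZ (hinj Z fun u hu => ?_)
  obtain ⟨X, hX⟩ := frame_surjective hcard hinj (fun v => if v = u then 1 else 0)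
  have h3 := h2 X
  rw [Finset.sum_eq_single_of_mem u hu fun v hv hvu => by rw [hX v hv, if_neg hvu]; ring,
    hX u hu, if_pos rfl, mul_one] at h3
  exact (mul_eq_zero.1 h3).resolve_left (hd u hu)

/-- Raising an index with a form that is diagonal in a frame. -/
theorem gram_inv_mulVec_of_frame (hcard : U.card = n)
    (hinj : ∀ X, (∀ u ∈ U, t X u = 0) → X = 0) {d : ℂ → ℂ} (hd : ∀ u ∈ U, d u ≠ 0)
    {B : (Fin n → ℂ) → (Fin n → ℂ) → ℂ} (hB : ∀ X Y, B X Y = ∑ u ∈ U, d u * t X u * t Y u)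
    {f : ℂ → ℂ} {c : Fin n → ℂ} (hc : ∀ a, c a = ∑ u ∈ U, d u * t (Pi.single a 1) u * f u) :
    ∀ u ∈ U, t ((gram B)⁻¹.mulVec c) u = f u := by
  obtain ⟨Z, hZ⟩ := frame_surjective hcard hinj f
  have h : c = (gram B).mulVec Z := by
    funext a
    rw [gram_mulVec_of_frame hB, hc, hB]
    exact Finset.sum_congr rfl fun u hu => by rw [hZ u hu]
  rw [h, Matrix.mulVec_mulVec, Matrix.nonsing_inv_mul _ (isUnit_det_gram_of_frame hcard hinj hd hB),
    Matrix.one_mulVec]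
  exact hZ

end Frame

/-! ### The canonical frame of Hurwitz data -/

namespace HurwitzData

variable {n : ℕ}

/-- The critical points of `λ` are the `n` points `pt u` with `u ∈ U`, they are simple, `λ` does
not vanish at them, and a tangent vector `X` is determined by its canonical components, the values
of `∂_X λ` at the critical points. -/
structure IsCanonicalFrame (S : HurwitzData n) (z : Fin n → ℂ) (U : Finset ℂ) (pt : ℂ → ℂ) :
    Prop where
  bij : Set.BijOn pt U (S.crit z)
  card : U.card = n
  analytic : ∀ u ∈ U, AnalyticAt ℂ (S.lam z) (pt u)
  analytic_var : ∀ u ∈ U, ∀ X, AnalyticAt ℂ (S.var z X) (pt u)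
  lam_ne : ∀ u ∈ U, S.lam z (pt u) ≠ 0
  hess_ne : ∀ u ∈ U, deriv (deriv (S.lam z)) (pt u) ≠ 0
  inj : ∀ X, (∀ u ∈ U, S.var z X (pt u) = 0) → X = 0

/-- The canonical components `∂_X λ` at the critical points, as a linear map in `X`. -/
noncomputable def comp (S : HurwitzData n) (z : Fin n → ℂ) (pt : ℂ → ℂ) :
    (Fin n → ℂ) →ₗ[ℂ] ℂ → ℂ where
  toFun X u := S.var z X (pt u)
  map_add' X Y := by funext u; simp [var]
  map_smul' c X := by funext u; simp [var]

theorem comp_apply (S : HurwitzData n) (z : Fin n → ℂ) (pt : ℂ → ℂ) (X : Fin n → ℂ) (u : ℂ) :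
    S.comp z pt X u = S.var z X (pt u) := rfl

namespace IsCanonicalFrame

variable {S : HurwitzData n} {z : Fin n → ℂ} {U : Finset ℂ} {pt : ℂ → ℂ}

theorem deriv_lam (h : S.IsCanonicalFrame z U pt) {u : ℂ} (hu : u ∈ U) :
    deriv (S.lam z) (pt u) = 0 := (h.bij.mapsTo hu).2

theorem sum_crit (h : S.IsCanonicalFrame z U pt) (f : ℂ → ℂ) :
    ∑ᶠ v ∈ S.crit z, f v = ∑ u ∈ U, f (pt u) := by
  rw [← finsum_mem_coe_finset]
  exact (finsum_mem_eq_of_bijOn pt h.bij fun _ _ => rfl).symm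

theorem sum_residue_div_deriv (h : S.IsCanonicalFrame z U pt) {f : ℂ → ℂ}
    (hf : ∀ u ∈ U, AnalyticAt ℂ f (pt u)) :
    ∑ᶠ v ∈ S.crit z, residue (fun w => f w / deriv (S.lam z) w) v
      = ∑ u ∈ U, f (pt u) / deriv (deriv (S.lam z)) (pt u) := by
  rw [h.sum_crit]
  exact Finset.sum_congr rfl fun u hu => residue_div_of_simple_zero (hf u hu)
    (h.analytic u hu).deriv (h.deriv_lam hu) (h.hess_ne u hu)

theorem deriv_logDeriv (h : S.IsCanonicalFrame z U pt) {u : ℂ} (hu : u ∈ U) :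
    deriv (logDeriv (S.lam z)) (pt u) = deriv (deriv (S.lam z)) (pt u) / S.lam z (pt u) := by
  have h1 := (h.analytic u hu).deriv.differentiableAt.hasDerivAt.div
    (h.analytic u hu).differentiableAt.hasDerivAt (h.lam_ne u hu)
  have h2 : deriv (logDeriv (S.lam z)) (pt u) = _ := h1.deriv
  rw [h2, h.deriv_lam hu]
  field_simp [h.lam_ne u hu]
  simp

theorem sum_residue_div_logDeriv (h : S.IsCanonicalFrame z U pt) {f : ℂ → ℂ}
    (hf : ∀ u ∈ U, AnalyticAt ℂ f (pt u)) :
    ∑ᶠ v ∈ S.crit z, residue (fun w => f w / logDeriv (S.lam z) w) v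
      = ∑ u ∈ U, f (pt u) * S.lam z (pt u) / deriv (deriv (S.lam z)) (pt u) := by
  rw [h.sum_crit]
  refine Finset.sum_congr rfl fun u hu => ?_
  rw [residue_div_of_simple_zero (g := logDeriv (S.lam z)) (hf u hu)
    ((h.analytic u hu).deriv.div (h.analytic u hu) (h.lam_ne u hu)), h.deriv_logDeriv hu,
    div_div_eq_mul_div]
  · rw [logDeriv_apply, h.deriv_lam hu, zero_div]
  · rw [h.deriv_logDeriv hu]
    exact div_ne_zero (h.hess_ne u hu) (h.lam_ne u hu)

theorem analytic_varLog (h : S.IsCanonicalFrame z U pt) {u : ℂ} (hu : u ∈ U) (X : Fin n → ℂ) :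
    AnalyticAt ℂ (S.varLog z X) (pt u) :=
  (h.analytic_var u hu X).div (h.analytic u hu) (h.lam_ne u hu)

theorem eta_eq (h : S.IsCanonicalFrame z U pt) (X Y : Fin n → ℂ) :
    S.eta z X Y = ∑ u ∈ U, (-1 / deriv (deriv (S.lam z)) (pt u))
      * S.comp z pt X u * S.comp z pt Y u := by
  rw [eta, h.sum_residue_div_deriv (f := fun w => S.var z X w * S.var z Y w) fun u hu =>
    (h.analytic_var u hu X).mul (h.analytic_var u hu Y), ← Finset.sum_neg_distrib]
  exact Finset.sum_congr rfl fun u _ => by simp only [comp_apply]; ring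

theorem cubic_eq (h : S.IsCanonicalFrame z U pt) (X Y Z : Fin n → ℂ) :
    S.cubic z X Y Z = ∑ u ∈ U, (-1 / deriv (deriv (S.lam z)) (pt u))
      * S.comp z pt Z u * (S.comp z pt X u * S.comp z pt Y u) := by
  rw [cubic, h.sum_residue_div_deriv
    (f := fun w => S.var z X w * S.var z Y w * S.var z Z w) fun u hu =>
    ((h.analytic_var u hu X).mul (h.analytic_var u hu Y)).mul (h.analytic_var u hu Z),
    ← Finset.sum_neg_distrib]
  exact Finset.sum_congr rfl fun u _ => by simp only [comp_apply]; ring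

theorem dualEta_eq (h : S.IsCanonicalFrame z U pt) (X Y : Fin n → ℂ) :
    S.dualEta z X Y = ∑ u ∈ U,
      (-1 / (S.lam z (pt u) * deriv (deriv (S.lam z)) (pt u)))
      * S.comp z pt X u * S.comp z pt Y u := by
  rw [dualEta, h.sum_residue_div_logDeriv
    (f := fun w => S.varLog z X w * S.varLog z Y w) fun u hu =>
    (h.analytic_varLog hu X).mul (h.analytic_varLog hu Y), ← Finset.sum_neg_distrib]
  refine Finset.sum_congr rfl fun u hu => ?_
  have h1 := h.lam_ne u hu
  have h2 := h.hess_ne u hu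
  simp only [comp_apply, varLog]
  field_simp

theorem dualCubic_eq (h : S.IsCanonicalFrame z U pt) (X Y Z : Fin n → ℂ) :
    S.dualCubic z X Y Z = ∑ u ∈ U,
      (-1 / (S.lam z (pt u) * deriv (deriv (S.lam z)) (pt u)))
      * S.comp z pt Z u * (S.comp z pt X u * S.comp z pt Y u / S.lam z (pt u)) := by
  rw [dualCubic, h.sum_residue_div_logDeriv
    (f := fun w => S.varLog z X w * S.varLog z Y w * S.varLog z Z w) fun u hu =>
    ((h.analytic_varLog hu X).mul (h.analytic_varLog hu Y)).mul (h.analytic_varLog hu Z),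
    ← Finset.sum_neg_distrib]
  refine Finset.sum_congr rfl fun u hu => ?_
  have h1 := h.lam_ne u hu
  have h2 := h.hess_ne u hu
  simp only [comp_apply, varLog]
  field_simp

theorem isUnit_det_eta (h : S.IsCanonicalFrame z U pt) : IsUnit (gram (S.eta z)).det :=
  isUnit_det_gram_of_frame (t := S.comp z pt) h.card h.inj
    (fun u hu => div_ne_zero (by simp) (h.hess_ne u hu)) h.eta_eq

theorem isUnit_det_dualEta (h : S.IsCanonicalFrame z U pt) : IsUnit (gram (S.dualEta z)).det :=
  isUnit_det_gram_of_frame (t := S.comp z pt) h.card h.inj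
    (fun u hu => div_ne_zero (by simp) (mul_ne_zero (h.lam_ne u hu) (h.hess_ne u hu)))
    h.dualEta_eq

/-- `∘` is multiplication of canonical components. -/
theorem comp_circ (h : S.IsCanonicalFrame z U pt) (X Y : Fin n → ℂ) {u : ℂ} (hu : u ∈ U) :
    S.comp z pt (S.circ z X Y) u = S.comp z pt X u * S.comp z pt Y u :=
  gram_inv_mulVec_of_frame (t := S.comp z pt)
    (f := fun u => S.comp z pt X u * S.comp z pt Y u) h.card h.inj
    (fun u hu => div_ne_zero (by simp) (h.hess_ne u hu)) h.eta_eq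
    (fun a => h.cubic_eq X Y (Pi.single a 1)) u hu

/-- `⋆` is multiplication of canonical components, divided by the critical values. -/
theorem comp_star (h : S.IsCanonicalFrame z U pt) (X Y : Fin n → ℂ) {u : ℂ} (hu : u ∈ U) :
    S.comp z pt (S.star z X Y) u = S.comp z pt X u * S.comp z pt Y u / S.lam z (pt u) :=
  gram_inv_mulVec_of_frame (t := S.comp z pt)
    (f := fun u => S.comp z pt X u * S.comp z pt Y u / S.lam z (pt u)) h.card h.inj
    (fun u hu => div_ne_zero (by simp) (mul_ne_zero (h.lam_ne u hu) (h.hess_ne u hu)))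
    h.dualEta_eq (fun a => h.dualCubic_eq X Y (Pi.single a 1)) u hu

theorem ext_comp (h : S.IsCanonicalFrame z U pt) {X Y : Fin n → ℂ}
    (hXY : ∀ u ∈ U, S.comp z pt X u = S.comp z pt Y u) : X = Y := by
  refine sub_eq_zero.1 (h.inj (X - Y) fun u hu => ?_)
  rw [← comp_apply, map_sub, Pi.sub_apply, hXY u hu, sub_self]

theorem isDualAt (h : S.IsCanonicalFrame z U pt) {E : (Fin n → ℂ) → Fin n → ℂ}
    (hE : S.IsEulerAt E z) : S.IsDualAt E z := by
  have hEc : ∀ u ∈ U, S.comp z pt (E z) u = S.lam z (pt u) := fun u hu =>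
    hE _ (h.bij.mapsTo hu)
  obtain ⟨e, he⟩ := frame_surjective (t := S.comp z pt) h.card h.inj fun _ => 1
  obtain ⟨Einv, hEinv⟩ := frame_surjective (t := S.comp z pt) h.card h.inj
    fun u => (S.lam z (pt u))⁻¹
  refine ⟨h.isUnit_det_eta, h.isUnit_det_dualEta, e, Einv, fun X => ?_, ?_, fun X Y => ?_,
    fun X Y => ?_⟩
  · exact h.ext_comp fun u hu => by rw [h.comp_circ _ _ hu, he u hu, one_mul]
  · exact h.ext_comp fun u hu => by
      rw [h.comp_circ _ _ hu, he u hu, hEinv u hu, hEc u hu, inv_mul_cancel₀ (h.lam_ne u hu)]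
  · exact h.ext_comp fun u hu => by
      rw [h.comp_circ _ _ hu, h.comp_circ _ _ hu, h.comp_star _ _ hu, hEinv u hu]; ring
  · rw [h.dualEta_eq, h.eta_eq]
    refine Finset.sum_congr rfl fun u hu => ?_
    have h1 := h.lam_ne u hu
    have h2 := h.hess_ne u hu
    rw [h.comp_circ _ _ hu, hEinv u hu]
    field_simp

/-- The WDVV equations: `(∂_a ⋆ ∂_b, ∂_c ⋆ ∂_d)` is totally symmetric. -/
theorem wdvv (h : S.IsCanonicalFrame z U pt) (a b c d : Fin n) :
    ∑ p, ∑ q, S.dualCubic z (Pi.single a 1) (Pi.single b 1) (Pi.single p 1)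
        * (gram (S.dualEta z))⁻¹ p q
        * S.dualCubic z (Pi.single q 1) (Pi.single c 1) (Pi.single d 1)
      = ∑ u ∈ U, (-1 / (S.lam z (pt u) * deriv (deriv (S.lam z)) (pt u)))
        * S.comp z pt (Pi.single a 1) u * S.comp z pt (Pi.single b 1) u
        * S.comp z pt (Pi.single c 1) u * S.comp z pt (Pi.single d 1) u
        / S.lam z (pt u) ^ 2 := by
  have hsymm : ∀ q, S.dualCubic z (Pi.single q 1) (Pi.single c 1) (Pi.single d 1)
      = S.dualCubic z (Pi.single c 1) (Pi.single d 1) (Pi.single q 1) := fun q => by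
    rw [h.dualCubic_eq, h.dualCubic_eq]
    exact Finset.sum_congr rfl fun u _ => by ring
  have hsum : ∀ p, ∑ q, S.dualCubic z (Pi.single a 1) (Pi.single b 1) (Pi.single p 1)
        * (gram (S.dualEta z))⁻¹ p q
        * S.dualCubic z (Pi.single q 1) (Pi.single c 1) (Pi.single d 1)
      = S.dualCubic z (Pi.single a 1) (Pi.single b 1) (Pi.single p 1)
        * S.star z (Pi.single c 1) (Pi.single d 1) p := fun p => by
    rw [star, Matrix.mulVec, dotProduct, Finset.mul_sum]
    exact Finset.sum_congr rfl fun q _ => by rw [hsymm]; ring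
  have hZ : ∀ u, S.comp z pt (S.star z (Pi.single c 1) (Pi.single d 1)) u
      = ∑ p, S.star z (Pi.single c 1) (Pi.single d 1) p * S.comp z pt (Pi.single p 1) u := by
    intro u
    conv_lhs => rw [map_eq_sum_single (S.comp z pt)]
    simp
  rw [Finset.sum_congr rfl fun p _ => hsum p]
  simp only [h.dualCubic_eq, Finset.sum_mul]
  rw [Finset.sum_comm]
  refine Finset.sum_congr rfl fun u hu => ?_
  have h1 := h.comp_star (Pi.single c 1) (Pi.single d 1) hu
  rw [hZ] at h1
  calc _ = (-1 / (S.lam z (pt u) * deriv (deriv (S.lam z)) (pt u)))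
        * (S.comp z pt (Pi.single a 1) u * S.comp z pt (Pi.single b 1) u / S.lam z (pt u))
        * ∑ p, S.star z (Pi.single c 1) (Pi.single d 1) p * S.comp z pt (Pi.single p 1) u := by
        rw [Finset.mul_sum]
        exact Finset.sum_congr rfl fun p _ => by ring
    _ = _ := by rw [h1]; ring

end IsCanonicalFrame

end HurwitzData

end HurwitzLegendre

namespace HurwitzLegendre

/-! ### Sums of residues over the roots of a polynomial -/

section Residues

open Polynomial

variable {s : Finset ℂ}

theorem eval_derivative_nodal_ne_zero {u : ℂ} (hu : u ∈ s) :
    (derivative (Lagrange.nodal s id)).eval u ≠ 0 := by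
  have h := Lagrange.eval_nodal_derivative_eval_node_eq (v := id) hu
  simp only [id] at h
  rw [h, Lagrange.eval_nodal, Finset.prod_ne_zero_iff]
  exact fun v hv => sub_ne_zero.2 (Finset.ne_of_mem_erase hv).symm

/-- The residues of `R / Q` add up to `0`, for `Q` with simple roots and `deg R ≤ deg Q - 2`. -/
theorem sum_eval_div_derivative_nodal {R : ℂ[X]} (hR : R.degree < ((s.card - 1 : ℕ) : WithBot ℕ)) :
    ∑ u ∈ s, R.eval u / (derivative (Lagrange.nodal s id)).eval u = 0 := by
  have h := Lagrange.coeff_eq_sum (s := s) (v := id) (Set.injOn_id _)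
    (hR.trans_le (by exact_mod_cast Nat.sub_le _ _))
  rw [coeff_eq_zero_of_degree_lt hR] at h
  rw [h]
  refine Finset.sum_congr rfl fun u hu => ?_
  have h := Lagrange.eval_nodal_derivative_eval_node_eq (v := id) hu
  simp only [id] at h
  rw [h, Lagrange.eval_nodal]
  rfl

/-- The residues of `R / (u Q)` add up to `0`, for `Q` with simple roots different from `0` and
`deg R < deg Q`. -/
theorem sum_eval_div_mul_derivative_nodal {R : ℂ[X]} (hR : R.degree < s.card)
    (h0 : (0 : ℂ) ∉ s) :
    ∑ u ∈ s, R.eval u / (u * (derivative (Lagrange.nodal s id)).eval u)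
      = - (R.eval 0 / (Lagrange.nodal s id).eval 0) := by
  have h1 := Lagrange.eq_interpolate (s := s) (v := id) (Set.injOn_id _) hR
  have hx : ∀ u ∈ s, (0 : ℂ) ≠ id u := fun u hu h => h0 (h ▸ hu)
  have h2 := Lagrange.eval_interpolate_not_at_node (s := s) (v := id)
    (fun i => R.eval (id i)) hx
  rw [← h1] at h2
  have h3 : (Lagrange.nodal s id).eval 0 ≠ 0 := Lagrange.eval_nodal_not_at_node hx
  rw [h2, mul_div_cancel_left₀ _ h3, ← Finset.sum_neg_distrib]
  refine Finset.sum_congr rfl fun u hu => ?_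
  rw [Lagrange.nodalWeight_eq_eval_derivative_nodal hu]
  simp only [id, zero_sub, inv_neg]
  rw [div_eq_mul_inv, mul_inv]
  ring

/-- The residues of `Q_i / Q²` add up to `0`, where `Q = (X - u_i) Q_i`. -/
theorem sum_residue_nodal_erase_div_sq {i : ℂ} (hi : i ∈ s) :
    ∑ u ∈ s, ((derivative (Lagrange.nodal (s.erase i) id)).eval u
          * (derivative (Lagrange.nodal s id)).eval u
        - (Lagrange.nodal (s.erase i) id).eval u
          * (derivative (derivative (Lagrange.nodal s id))).eval u)
      / (derivative (Lagrange.nodal s id)).eval u ^ 3 = 0 := by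
  set Q := Lagrange.nodal s (id : ℂ → ℂ) with hQ
  set T := Lagrange.nodal (s.erase i) (id : ℂ → ℂ) with hT
  have hQT : Q = (X - C i) * T := Lagrange.nodal_eq_mul_nodal_erase (v := id) hi
  have hQ' : derivative Q = T + (X - C i) * derivative T := by
    rw [hQT, derivative_mul]; simp
  have hQ'' : derivative (derivative Q) = 2 * derivative T
      + (X - C i) * derivative (derivative T) := by
    rw [hQ', derivative_add, derivative_mul]; simp; ring
  have hTi : (derivative Q).eval i = T.eval i := by rw [hQ']; simp
  have hT0 : T.eval i ≠ 0 := hTi ▸ eval_derivative_nodal_ne_zero hi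
  have hcard : 1 ≤ s.card := Finset.card_pos.2 ⟨i, hi⟩
  -- the difference quotient `R` of `T` at `i` has `R(u) = - T(i) / (u - i)` at the other roots
  obtain ⟨R, hR⟩ := X_sub_C_dvd_sub_C_eval (a := i) (p := T)
  have hRdeg : R.degree < ((s.card - 1 : ℕ) : WithBot ℕ) := by
    by_cases hR0 : R = 0
    · rw [hR0, degree_zero]; exact WithBot.bot_lt_coe _
    have h1 : (T - C (T.eval i)).natDegree = 1 + R.natDegree := by
      rw [hR, natDegree_mul (X_sub_C_ne_zero i) hR0, natDegree_X_sub_C]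
    have h2 : (T - C (T.eval i)).natDegree ≤ s.card - 1 := by
      rw [natDegree_sub_C, hT, Lagrange.natDegree_nodal, Finset.card_erase_of_mem hi]
    rw [degree_eq_natDegree hR0]
    exact_mod_cast (by omega : R.natDegree < s.card - 1)
  have hRi : R.eval i = (derivative T).eval i := by
    have h := congrArg (fun p => (derivative p).eval i) hR
    simp only [derivative_sub, derivative_C, derivative_mul, derivative_X, sub_zero, one_mul,
      eval_add, eval_mul, eval_sub, eval_X, eval_C, sub_self, zero_mul, add_zero] at h
    exact h.symm
  have hsum := sum_eval_div_derivative_nodal hRdeg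
  rw [← hQ] at hsum
  have key : ∀ u ∈ s, ((derivative T).eval u * (derivative Q).eval u
      - T.eval u * (derivative (derivative Q)).eval u) / (derivative Q).eval u ^ 3
      = -(1 / T.eval i) * (R.eval u / (derivative Q).eval u) := by
    intro u hu
    have hQu : (derivative Q).eval u ≠ 0 := eval_derivative_nodal_ne_zero hu
    by_cases hui : u = i
    · subst hui
      rw [hRi, hTi, hQ'']
      simp only [eval_add, eval_mul, eval_sub, eval_X, eval_C, sub_self, zero_mul, add_zero,
        eval_ofNat]
      field_simp
      ring
    · have hTu : T.eval u = 0 :=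
        Lagrange.eval_nodal_at_node (v := id) (Finset.mem_erase.2 ⟨hui, hu⟩)
      have h1 : (derivative Q).eval u = (u - i) * (derivative T).eval u := by
        rw [hQ']; simp [hTu]
      have h2 : -T.eval i = (u - i) * R.eval u := by
        have h := congrArg (fun p => p.eval u) hR
        simpa [hTu] using h
      have h3 : u - i ≠ 0 := sub_ne_zero.2 hui
      have h4 : (derivative T).eval u ≠ 0 := fun h => hQu (by rw [h1, h, mul_zero])
      have h5 : T.eval i = -((u - i) * R.eval u) := by rw [← h2, neg_neg]
      have h6 : R.eval u ≠ 0 := fun h => hT0 (by rw [h5, h]; simp)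
      rw [hTu, h1, h5]
      field_simp
      ring
  rw [Finset.sum_congr rfl key, ← Finset.mul_sum, hsum, mul_zero]

/-- The residues of `A / Q²` add up to `0`, for `Q` with simple roots and `deg A ≤ 2 deg Q - 2`. -/
theorem sum_residue_div_nodal_sq {A : ℂ[X]} (hA : A.natDegree + 2 ≤ 2 * s.card) :
    ∑ u ∈ s, ((derivative A).eval u * (derivative (Lagrange.nodal s id)).eval u
        - A.eval u * (derivative (derivative (Lagrange.nodal s id))).eval u)
      / (derivative (Lagrange.nodal s id)).eval u ^ 3 = 0 := by
  set Q := Lagrange.nodal s (id : ℂ → ℂ) with hQ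
  have hmon : Q.Monic := Lagrange.nodal_monic
  set B := A /ₘ Q
  set D := A %ₘ Q
  have hABD : A = D + Q * B := (modByMonic_add_div A Q).symm
  have hD : D.degree < s.card := by
    rw [← Lagrange.degree_nodal (v := (id : ℂ → ℂ)) (s := s)]
    exact degree_modByMonic_lt A hmon
  have hB : B.degree < ((s.card - 1 : ℕ) : WithBot ℕ) := by
    by_cases hB0 : B = 0
    · rw [hB0, degree_zero]; exact WithBot.bot_lt_coe _
    have h1 : Q.degree ≤ A.degree := by
      by_contra h
      exact hB0 ((divByMonic_eq_zero_iff hmon).2 (not_le.1 h))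
    have h2 := natDegree_le_natDegree h1
    have h3 : B.natDegree = A.natDegree - Q.natDegree := natDegree_divByMonic A hmon
    rw [hQ, Lagrange.natDegree_nodal] at h2 h3
    rw [degree_eq_natDegree hB0]
    exact_mod_cast (by omega : B.natDegree < s.card - 1)
  have hsplit : ∀ u ∈ s, ((derivative A).eval u * (derivative Q).eval u
      - A.eval u * (derivative (derivative Q)).eval u) / (derivative Q).eval u ^ 3
      = B.eval u / (derivative Q).eval u
        + ((derivative D).eval u * (derivative Q).eval u
          - D.eval u * (derivative (derivative Q)).eval u) / (derivative Q).eval u ^ 3 := by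
    intro u hu
    have hQu : (derivative Q).eval u ≠ 0 := eval_derivative_nodal_ne_zero hu
    have hQ0 : Q.eval u = 0 := Lagrange.eval_nodal_at_node (v := id) hu
    rw [hABD]
    simp only [derivative_add, derivative_mul, eval_add, eval_mul, hQ0]
    field_simp
    ring
  rw [Finset.sum_congr rfl hsplit, Finset.sum_add_distrib, sum_eval_div_derivative_nodal hB,
    zero_add]
  have hDsum : D = ∑ i ∈ s, C (D.eval i * Lagrange.nodalWeight s id i)
      * Lagrange.nodal (s.erase i) id := by
    conv_lhs => rw [Lagrange.eq_interpolate (s := s) (v := id) (Set.injOn_id _) hD,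
      Lagrange.interpolate_eq_nodalWeight_mul_nodal_div_X_sub_C]
    refine Finset.sum_congr rfl fun i hi => ?_
    rw [Lagrange.nodal_erase_eq_nodal_div hi, C_mul]
    simp only [id]
    ring
  rw [hDsum]
  simp only [derivative_sum, derivative_C_mul, eval_finsetSum, eval_mul, eval_C, Finset.sum_mul,
    ← Finset.sum_sub_distrib, Finset.sum_div]
  rw [Finset.sum_comm]
  refine Finset.sum_eq_zero fun i hi => ?_
  rw [← mul_zero (D.eval i * Lagrange.nodalWeight s id i), ← sum_residue_nodal_erase_div_sq hi,
    Finset.mul_sum]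
  exact Finset.sum_congr rfl fun u _ => by ring

end Residues

end HurwitzLegendre

namespace HurwitzLegendre

/-! ### The critical points in the exponential coordinate -/

section Algebra

open Polynomial

variable {k m : ℕ}

/-- The polynomial with roots `x_a`. -/
noncomputable def nodePoly (x : Fin (k + m) → ℂ) : ℂ[X] := Lagrange.nodal Finset.univ x

/-- The polynomial `u Π' - m Π`, where `Π = ∏ (u - x_a)`. In the coordinate `u = e^{ip}` its roots
are the critical points of `λ = u^{-m} Π`. -/
noncomputable def critPoly (x : Fin (k + m) → ℂ) : ℂ[X] :=
  X * derivative (nodePoly x) - C (m : ℂ) * nodePoly x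

/-- The roots of `critPoly`. -/
noncomputable def critRoots (x : Fin (k + m) → ℂ) : Finset ℂ := (critPoly x).roots.toFinset

/-- The numbers `x_a` are nonzero and distinct, and the critical points are simple. -/
structure IsRegular (x : Fin (k + m) → ℂ) : Prop where
  ne_zero : ∀ a, x a ≠ 0
  inj : Function.Injective x
  simple : ∀ u, (critPoly x).eval u = 0 → (derivative (critPoly x)).eval u ≠ 0

/-- The function `r_a(u) = x_a / (u - x_a)`. In the coordinates `z_a` and `p` with
`x_a = e^{i z_a}`, `u = e^{ip}` one has `∂_{z_a} log λ = -i r_a`. -/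
noncomputable def ratio (x : Fin (k + m) → ℂ) (u : ℂ) (a : Fin (k + m)) : ℂ := x a / (u - x a)

/-- `∂_{z_a} r_a = i r_a (1 + r_a)` and `∂_p r_a = -i r_a (1 + r_a)`; this is `r_a (1 + r_a)`. -/
noncomputable def ratioD (x : Fin (k + m) → ℂ) (u : ℂ) (a : Fin (k + m)) : ℂ :=
  ratio x u a * (1 + ratio x u a)

/-- The logarithmic Hessian: `(log λ)'' = ∑ r_a (1 + r_a)` at the critical points. -/
noncomputable def hess (x : Fin (k + m) → ℂ) (u : ℂ) : ℂ := ∑ a, ratioD x u a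

/-- The third derivative: `(log λ)''' = -i ∑ (1 + 2 r_a) r_a (1 + r_a)`. -/
noncomputable def third (x : Fin (k + m) → ℂ) (u : ℂ) : ℂ :=
  ∑ a, (1 + 2 * ratio x u a) * ratioD x u a

theorem eval_nodePoly (x : Fin (k + m) → ℂ) (u : ℂ) : (nodePoly x).eval u = ∏ a, (u - x a) :=
  Lagrange.eval_nodal

theorem hasDerivAt_ratio (x : Fin (k + m) → ℂ) {u : ℂ} (hu0 : u ≠ 0) {a : Fin (k + m)}
    (hu : u ≠ x a) : HasDerivAt (fun v => ratio x v a) (-(ratioD x u a / u)) u := by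
  have h : u - x a ≠ 0 := sub_ne_zero.2 hu
  have h1 := (hasDerivAt_const u (x a)).div ((hasDerivAt_id u).sub_const (x a)) h
  refine h1.congr_deriv ?_
  simp only [ratioD, ratio, id]
  field_simp
  ring

theorem critPoly_eval_node (x : Fin (k + m) → ℂ) (a : Fin (k + m)) :
    (critPoly x).eval (x a) = x a * (Lagrange.nodal (Finset.univ.erase a) x).eval (x a) := by
  have h1 : (nodePoly x).eval (x a) = 0 := Lagrange.eval_nodal_at_node (Finset.mem_univ a)
  rw [critPoly, eval_sub, eval_mul, eval_mul, h1, eval_X, nodePoly,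
    Lagrange.eval_nodal_derivative_eval_node_eq (Finset.mem_univ a)]
  ring

theorem nodePoly_eq (x : Fin (k + m) → ℂ) (a : Fin (k + m)) :
    nodePoly x = (X - C (x a)) * Lagrange.nodal (Finset.univ.erase a) x :=
  Lagrange.nodal_eq_mul_nodal_erase (Finset.mem_univ a)

/-- `u Π' / Π = ∑ u / (u - x_a)`. -/
theorem mul_eval_derivative_nodePoly (x : Fin (k + m) → ℂ) {u : ℂ} (hu : ∀ a, u ≠ x a) :
    u * (derivative (nodePoly x)).eval u
      = (k + m + ∑ a, ratio x u a) * (nodePoly x).eval u := by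
  rw [nodePoly, Lagrange.derivative_nodal, eval_finsetSum, Finset.mul_sum, ← nodePoly]
  have h : ∀ a, u * (Lagrange.nodal (Finset.univ.erase a) x).eval u
      = (1 + ratio x u a) * (nodePoly x).eval u := by
    intro a
    have h1 : u - x a ≠ 0 := sub_ne_zero.2 (hu a)
    rw [nodePoly_eq x a, eval_mul, eval_sub, eval_X, eval_C, ratio]
    field_simp
    ring
  rw [Finset.sum_congr rfl fun a _ => h a, ← Finset.sum_mul, Finset.sum_add_distrib]
  simp

theorem eval_critPoly (x : Fin (k + m) → ℂ) {u : ℂ} (hu : ∀ a, u ≠ x a) :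
    (critPoly x).eval u = (k + ∑ a, ratio x u a) * (nodePoly x).eval u := by
  rw [critPoly, eval_sub, eval_mul, eval_X, mul_eval_derivative_nodePoly x hu, eval_mul, eval_C]
  ring

theorem natDegree_nodePoly (x : Fin (k + m) → ℂ) : (nodePoly x).natDegree = k + m := by
  rw [nodePoly, Lagrange.natDegree_nodal, Finset.card_univ, Fintype.card_fin]

theorem coeff_critPoly (hm : 0 < m) (x : Fin (k + m) → ℂ) : (critPoly x).coeff (k + m) = k := by
  have h1 : (nodePoly x).coeff (k + m) = 1 := by
    have h : (nodePoly x).Monic := Lagrange.nodal_monic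
    rw [← natDegree_nodePoly x]
    exact h
  obtain ⟨j, hj⟩ : ∃ j, k + m = j + 1 := ⟨k + m - 1, by omega⟩
  rw [critPoly, coeff_sub, coeff_C_mul, h1, hj, coeff_X_mul, coeff_derivative, ← hj, h1]
  have : (j : ℂ) + 1 = k + m := by exact_mod_cast hj.symm
  rw [this]
  ring

theorem natDegree_critPoly (hk : 0 < k) (hm : 0 < m) (x : Fin (k + m) → ℂ) :
    (critPoly x).natDegree = k + m := by
  refine natDegree_eq_of_le_of_coeff_ne_zero ?_ ?_
  · have h1 := natDegree_nodePoly x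
    refine (natDegree_sub_le _ _).trans (max_le ?_ ?_)
    · refine natDegree_mul_le.trans ?_
      have := natDegree_derivative_le (nodePoly x)
      rw [natDegree_X]
      omega
    · exact (natDegree_C_mul_le _ _).trans h1.le
  · rw [coeff_critPoly hm]
    exact_mod_cast hk.ne'

theorem critPoly_ne_zero (hk : 0 < k) (hm : 0 < m) (x : Fin (k + m) → ℂ) : critPoly x ≠ 0 := by
  intro h
  have := natDegree_critPoly hk hm x
  rw [h, natDegree_zero] at this
  omega

theorem mem_critRoots (hk : 0 < k) (hm : 0 < m) {x : Fin (k + m) → ℂ} {u : ℂ} :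
    u ∈ critRoots x ↔ (critPoly x).eval u = 0 := by
  rw [critRoots, Multiset.mem_toFinset, mem_roots (critPoly_ne_zero hk hm x), IsRoot.def]

namespace IsRegular

variable {x : Fin (k + m) → ℂ}

theorem sub_ne (hx : IsRegular x) {a b : Fin (k + m)} (hab : a ≠ b) : x a - x b ≠ 0 :=
  sub_ne_zero.2 fun h => hab (hx.inj h)

theorem eval_erase_ne (hx : IsRegular x) (a : Fin (k + m)) :
    (Lagrange.nodal (Finset.univ.erase a) x).eval (x a) ≠ 0 := by
  rw [Lagrange.eval_nodal, Finset.prod_ne_zero_iff]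
  exact fun b hb => hx.sub_ne (Finset.ne_of_mem_erase hb).symm

theorem nodup_roots (hk : 0 < k) (hm : 0 < m) (hx : IsRegular x) : (critPoly x).roots.Nodup := by
  refine Multiset.nodup_iff_count_le_one.2 fun u => ?_
  rw [count_roots]
  by_contra h
  obtain ⟨h1, h2⟩ := (one_lt_rootMultiplicity_iff_isRoot (critPoly_ne_zero hk hm x)).1 (not_le.1 h)
  exact hx.simple u h1 h2

theorem card_critRoots (hk : 0 < k) (hm : 0 < m) (hx : IsRegular x) :
    (critRoots x).card = k + m := by
  rw [critRoots, Multiset.toFinset_card_of_nodup (hx.nodup_roots hk hm),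
    ← natDegree_critPoly hk hm x]
  exact (splits_iff_card_roots.1 (IsAlgClosed.splits _))

theorem critPoly_eq (hk : 0 < k) (hm : 0 < m) (hx : IsRegular x) :
    critPoly x = C (k : ℂ) * Lagrange.nodal (critRoots x) id := by
  have h := (IsAlgClosed.splits (critPoly x)).eq_prod_roots
  have hl : (critPoly x).leadingCoeff = k := by
    rw [leadingCoeff, natDegree_critPoly hk hm, coeff_critPoly hm]
  rw [hl] at h
  rw [h]
  congr 1
  rw [Lagrange.nodal, Finset.prod_eq_multiset_prod, critRoots, Multiset.toFinset_val,
    (hx.nodup_roots hk hm).dedup]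
  rfl

section Root

variable {u : ℂ}

theorem root_ne_node (hx : IsRegular x) (hu : (critPoly x).eval u = 0) (a : Fin (k + m)) :
    u ≠ x a := by
  rintro rfl
  rw [critPoly_eval_node] at hu
  exact mul_ne_zero (hx.ne_zero a) (hx.eval_erase_ne a) hu

theorem eval_nodePoly_zero_ne (hx : IsRegular x) : (nodePoly x).eval 0 ≠ 0 := by
  rw [eval_nodePoly, Finset.prod_ne_zero_iff]
  exact fun a _ => by simpa using hx.ne_zero a

theorem root_ne_zero (hm : 0 < m) (hx : IsRegular x) (hu : (critPoly x).eval u = 0) : u ≠ 0 := by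
  rintro rfl
  rw [critPoly] at hu
  simp only [eval_sub, eval_mul, eval_X, eval_C, zero_mul, zero_sub, neg_eq_zero] at hu
  exact mul_ne_zero (by exact_mod_cast hm.ne') hx.eval_nodePoly_zero_ne hu

theorem nodePoly_root_ne (hx : IsRegular x) (hu : (critPoly x).eval u = 0) :
    (nodePoly x).eval u ≠ 0 := by
  rw [eval_nodePoly, Finset.prod_ne_zero_iff]
  exact fun a _ => sub_ne_zero.2 (hx.root_ne_node hu a)

theorem sum_ratio (hx : IsRegular x) (hu : (critPoly x).eval u = 0) :
    ∑ a, ratio x u a = -k := by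
  have h := eval_critPoly x (hx.root_ne_node hu)
  rw [hu] at h
  have := (mul_eq_zero.1 h.symm).resolve_right (hx.nodePoly_root_ne hu)
  linear_combination this

/-- At a critical point, `Π' / Π = m / u`. -/
theorem eval_derivative_nodePoly_root (hm : 0 < m) (hx : IsRegular x)
    (hu : (critPoly x).eval u = 0) :
    (derivative (nodePoly x)).eval u = m * (nodePoly x).eval u / u := by
  have h := mul_eval_derivative_nodePoly x (hx.root_ne_node hu)
  rw [hx.sum_ratio hu] at h
  rw [eq_div_iff (hx.root_ne_zero hm hu)]
  linear_combination h

theorem hasDerivAt_sum_ratio (hu0 : u ≠ 0) (hu : ∀ a, u ≠ x a) :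
    HasDerivAt (fun v => (k : ℂ) + ∑ a, ratio x v a) (-(hess x u / u)) u := by
  have h := HasDerivAt.fun_sum (u := Finset.univ) fun a _ => hasDerivAt_ratio x hu0 (hu a)
  refine (h.const_add (k : ℂ)).congr_deriv ?_
  rw [Finset.sum_neg_distrib, hess, Finset.sum_div]

theorem hasDerivAt_hess (hu0 : u ≠ 0) (hu : ∀ a, u ≠ x a) :
    HasDerivAt (fun v => hess x v) (-(third x u / u)) u := by
  have h : ∀ a, HasDerivAt (fun v => ratioD x v a)
      (-((1 + 2 * ratio x u a) * ratioD x u a / u)) u := fun a => by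
    have h1 := hasDerivAt_ratio x hu0 (hu a)
    exact (h1.mul (h1.const_add 1)).congr_deriv (by ring)
  refine (HasDerivAt.fun_sum (u := Finset.univ) fun a _ => h a).congr_deriv ?_
  rw [Finset.sum_neg_distrib, third, Finset.sum_div]

theorem eventually_ne (hu0 : u ≠ 0) (hu : ∀ a, u ≠ x a) :
    ∀ᶠ v in 𝓝 u, v ≠ 0 ∧ ∀ a, v ≠ x a :=
  (eventually_ne_nhds hu0).and (eventually_all.2 fun a => eventually_ne_nhds (hu a))

theorem eval_derivative_critPoly (hu0 : u ≠ 0) (hu : ∀ a, u ≠ x a) :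
    (derivative (critPoly x)).eval u = -(hess x u / u) * (nodePoly x).eval u
      + (k + ∑ a, ratio x u a) * (derivative (nodePoly x)).eval u := by
  refine ((critPoly x).hasDerivAt u).unique ?_
  refine ((hasDerivAt_sum_ratio hu0 hu).mul ((nodePoly x).hasDerivAt u)).congr_of_eventuallyEq ?_
  filter_upwards [eventually_ne hu0 hu] with v hv using eval_critPoly x hv.2

theorem eval_derivative_critPoly_root (hm : 0 < m) (hx : IsRegular x)
    (hu : (critPoly x).eval u = 0) :
    (derivative (critPoly x)).eval u = -(hess x u / u) * (nodePoly x).eval u := by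
  rw [eval_derivative_critPoly (hx.root_ne_zero hm hu) (hx.root_ne_node hu), hx.sum_ratio hu]
  ring

theorem hess_root_ne_zero (hm : 0 < m) (hx : IsRegular x) (hu : (critPoly x).eval u = 0) :
    hess x u ≠ 0 := by
  intro h
  have := hx.simple u hu
  rw [hx.eval_derivative_critPoly_root hm hu, h] at this
  simp at this

theorem eval_derivative2_critPoly_root (hm : 0 < m) (hx : IsRegular x)
    (hu : (critPoly x).eval u = 0) :
    (derivative (derivative (critPoly x))).eval u
      = (hess x u + third x u - 2 * m * hess x u) / u ^ 2 * (nodePoly x).eval u := by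
  have hu0 := hx.root_ne_zero hm hu
  have hux := hx.root_ne_node hu
  have h1 := ((((hasDerivAt_hess hu0 hux).div (hasDerivAt_id u) hu0).neg).mul
    ((nodePoly x).hasDerivAt u)).add
    ((hasDerivAt_sum_ratio hu0 hux).mul ((derivative (nodePoly x)).hasDerivAt u))
  have h2 := ((derivative (critPoly x)).hasDerivAt u).unique (h1.congr_of_eventuallyEq (by
    filter_upwards [eventually_ne hu0 hux] with v hv
    simpa using eval_derivative_critPoly hv.1 hv.2))
  rw [h2, hx.sum_ratio hu, hx.eval_derivative_nodePoly_root hm hu]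
  simp only [id, Pi.neg_apply, Pi.div_apply]
  field_simp
  ring

/-- The polynomial `r_a Π` at a critical point. -/
theorem eval_erase_root (hx : IsRegular x) (hu : (critPoly x).eval u = 0) (a : Fin (k + m)) :
    x a * (Lagrange.nodal (Finset.univ.erase a) x).eval u = ratio x u a * (nodePoly x).eval u := by
  have h := sub_ne_zero.2 (hx.root_ne_node hu a)
  rw [nodePoly_eq x a, eval_mul, eval_sub, eval_X, eval_C, ratio]
  field_simp

theorem eval_derivative_erase_root (hm : 0 < m) (hx : IsRegular x)
    (hu : (critPoly x).eval u = 0) (a : Fin (k + m)) :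
    x a * (derivative (Lagrange.nodal (Finset.univ.erase a) x)).eval u
      = (m * ratio x u a - ratioD x u a) * (nodePoly x).eval u / u := by
  have h := sub_ne_zero.2 (hx.root_ne_node hu a)
  have hu0 := hx.root_ne_zero hm hu
  have h1 := congrArg (fun p => (derivative p).eval u) (nodePoly_eq x a)
  simp only [derivative_mul, derivative_sub, derivative_X, derivative_C, sub_zero, one_mul,
    eval_add, eval_mul, eval_sub, eval_X, eval_C, hx.eval_derivative_nodePoly_root hm hu] at h1
  have h2 : (derivative (Lagrange.nodal (Finset.univ.erase a) x)).eval u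
      = (m * (nodePoly x).eval u / u - (Lagrange.nodal (Finset.univ.erase a) x).eval u)
        / (u - x a) := by
    rw [h1]
    field_simp
    ring
  have h3 : (Lagrange.nodal (Finset.univ.erase a) x).eval u
      = (nodePoly x).eval u / (u - x a) := by
    rw [nodePoly_eq x a, eval_mul, eval_sub, eval_X, eval_C]
    field_simp
  rw [h2, h3, ratioD, ratio]
  field_simp
  ring

end Root

/-! ### Sums over the critical points -/

variable {a b c : Fin (k + m)}

/-- The partial fraction decomposition of `r_a r_b`. -/
theorem ratio_mul_ratio (hx : IsRegular x) {u : ℂ} (hu : ∀ a, u ≠ x a) (hab : a ≠ b) :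
    ratio x u a * ratio x u b = (x b * ratio x u a - x a * ratio x u b) / (x a - x b) := by
  have h1 := sub_ne_zero.2 (hu a)
  have h2 := sub_ne_zero.2 (hu b)
  have h3 := hx.sub_ne hab
  rw [ratio, ratio]
  field_simp
  ring

theorem sum_ratio_div_hess (hk : 0 < k) (hm : 0 < m) (hx : IsRegular x) (a : Fin (k + m)) :
    ∑ u ∈ critRoots x, ratio x u a / hess x u = 1 / m := by
  have hk' : (k : ℂ) ≠ 0 := by exact_mod_cast hk.ne'
  have hm' : (m : ℂ) ≠ 0 := by exact_mod_cast hm.ne'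
  set T := Lagrange.nodal (Finset.univ.erase a) x with hT
  have hdeg : T.degree < ((critRoots x).card : WithBot ℕ) := by
    rw [hx.card_critRoots hk hm, hT, Lagrange.degree_nodal, Finset.card_erase_of_mem
      (Finset.mem_univ a), Finset.card_univ, Fintype.card_fin]
    exact_mod_cast (by omega : k + m - 1 < k + m)
  have h0 : (0 : ℂ) ∉ critRoots x := fun h =>
    hx.root_ne_zero hm ((mem_critRoots hk hm).1 h) rfl
  have hsum := sum_eval_div_mul_derivative_nodal hdeg h0
  have hP := hx.critPoly_eq hk hm
  have hN0 : (nodePoly x).eval 0 = -x a * T.eval 0 := by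
    rw [nodePoly_eq x a, ← hT]; simp
  have hP0 : (Lagrange.nodal (critRoots x) id).eval 0 = m * x a * T.eval 0 / k := by
    have h := congrArg (fun p => p.eval 0) hP
    simp only [critPoly, eval_sub, eval_mul, eval_X, zero_mul, eval_C, hN0] at h
    rw [eq_div_iff hk']
    linear_combination -h
  have hT0 : T.eval 0 ≠ 0 := fun h => hx.eval_nodePoly_zero_ne (by rw [hN0, h, mul_zero])
  have hxa := hx.ne_zero a
  have hterm : ∀ u ∈ critRoots x, ratio x u a / hess x u
      = -(x a / k) * (T.eval u / (u * (derivative (Lagrange.nodal (critRoots x) id)).eval u)) := by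
    intro u hu
    have hu := (mem_critRoots hk hm).1 hu
    have hu0 := hx.root_ne_zero hm hu
    have h1 := hx.eval_erase_root hu a
    have h2 := hx.eval_derivative_critPoly_root hm hu
    rw [hP, derivative_C_mul, eval_mul, eval_C] at h2
    have h3 := hx.nodePoly_root_ne hu
    have h4 := hx.hess_root_ne_zero hm hu
    have h5 : (derivative (Lagrange.nodal (critRoots x) id)).eval u
        = -(hess x u / u) * (nodePoly x).eval u / k := by
      rw [eq_div_iff hk', ← h2]; ring
    have h6 : T.eval u = ratio x u a * (nodePoly x).eval u / x a := by
      rw [eq_div_iff hxa, ← h1]; ring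
    rw [h5, h6]
    field_simp
  rw [Finset.sum_congr rfl hterm, ← Finset.mul_sum, hsum, hP0]
  field_simp

theorem sum_ratio_mul_div_hess_of_ne (hk : 0 < k) (hm : 0 < m) (hx : IsRegular x) (hab : a ≠ b) :
    ∑ u ∈ critRoots x, ratio x u a * ratio x u b / hess x u = -(1 / m) := by
  have h3 := hx.sub_ne hab
  have hterm : ∀ u ∈ critRoots x, ratio x u a * ratio x u b / hess x u
      = x b / (x a - x b) * (ratio x u a / hess x u)
        - x a / (x a - x b) * (ratio x u b / hess x u) := by
    intro u hu
    rw [hx.ratio_mul_ratio (hx.root_ne_node ((mem_critRoots hk hm).1 hu)) hab]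
    ring
  rw [Finset.sum_congr rfl hterm, Finset.sum_sub_distrib, ← Finset.mul_sum, ← Finset.mul_sum,
    hx.sum_ratio_div_hess hk hm, hx.sum_ratio_div_hess hk hm]
  field_simp
  ring

/-- The intersection form: `∑ r_a r_b / (log λ)'' = δ_ab - 1 / m`. -/
theorem sum_ratio_mul_div_hess (hk : 0 < k) (hm : 0 < m) (hx : IsRegular x)
    (a b : Fin (k + m)) :
    ∑ u ∈ critRoots x, ratio x u a * ratio x u b / hess x u
      = (if a = b then 1 else 0) - 1 / m := by
  have hm' : (m : ℂ) ≠ 0 := by exact_mod_cast hm.ne'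
  by_cases hab : a = b
  · subst hab
    -- the diagonal entry follows from `∑_b r_b = -k`
    have h : ∑ c, ∑ u ∈ critRoots x, ratio x u a * ratio x u c / hess x u = -k / m := by
      rw [Finset.sum_comm]
      have hterm : ∀ u ∈ critRoots x, ∑ c, ratio x u a * ratio x u c / hess x u
          = -k * (ratio x u a / hess x u) := by
        intro u hu
        rw [← Finset.sum_div, ← Finset.mul_sum, hx.sum_ratio ((mem_critRoots hk hm).1 hu)]
        ring
      rw [Finset.sum_congr rfl hterm, ← Finset.mul_sum, hx.sum_ratio_div_hess hk hm]
      ring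
    rw [← Finset.add_sum_erase _ _ (Finset.mem_univ a), Finset.sum_congr rfl fun c hc =>
      hx.sum_ratio_mul_div_hess_of_ne hk hm (Finset.ne_of_mem_erase hc).symm,
      Finset.sum_const, Finset.card_erase_of_mem (Finset.mem_univ a), Finset.card_univ,
      Fintype.card_fin, nsmul_eq_mul, Nat.cast_sub (by omega)] at h
    rw [if_pos rfl]
    push_cast at h
    rw [eq_sub_of_add_eq h]
    field_simp
    ring
  · rw [if_neg hab, hx.sum_ratio_mul_div_hess_of_ne hk hm hab]
    ring

theorem sum_ratio_mul_mul_div_hess_of_ne (hk : 0 < k) (hm : 0 < m) (hx : IsRegular x)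
    (hab : a ≠ b) (c : Fin (k + m)) :
    ∑ u ∈ critRoots x, ratio x u a * ratio x u b * ratio x u c / hess x u
      = (x b * (if a = c then 1 else 0) - x a * (if b = c then 1 else 0)) / (x a - x b)
        + 1 / m := by
  have h3 := hx.sub_ne hab
  have hterm : ∀ u ∈ critRoots x, ratio x u a * ratio x u b * ratio x u c / hess x u
      = x b / (x a - x b) * (ratio x u a * ratio x u c / hess x u)
        - x a / (x a - x b) * (ratio x u b * ratio x u c / hess x u) := by
    intro u hu
    rw [hx.ratio_mul_ratio (hx.root_ne_node ((mem_critRoots hk hm).1 hu)) hab]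
    ring
  rw [Finset.sum_congr rfl hterm, Finset.sum_sub_distrib, ← Finset.mul_sum, ← Finset.mul_sum,
    hx.sum_ratio_mul_div_hess hk hm, hx.sum_ratio_mul_div_hess hk hm]
  field_simp
  ring

theorem sum_ratio_cube_div_hess (hk : 0 < k) (hm : 0 < m) (hx : IsRegular x)
    (a : Fin (k + m)) :
    ∑ u ∈ critRoots x, ratio x u a * ratio x u a * ratio x u a / hess x u
      = -k * (1 - 1 / m) - ∑ b ∈ Finset.univ.erase a, (x b / (x a - x b) + 1 / m) := by
  have h : ∑ c, ∑ u ∈ critRoots x, ratio x u a * ratio x u c * ratio x u a / hess x u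
      = -k * (1 - 1 / m) := by
    rw [Finset.sum_comm]
    have hterm : ∀ u ∈ critRoots x, ∑ c, ratio x u a * ratio x u c * ratio x u a / hess x u
        = -k * (ratio x u a * ratio x u a / hess x u) := by
      intro u hu
      rw [← Finset.sum_div, ← Finset.sum_mul, ← Finset.mul_sum,
        hx.sum_ratio ((mem_critRoots hk hm).1 hu)]
      ring
    rw [Finset.sum_congr rfl hterm, ← Finset.mul_sum, hx.sum_ratio_mul_div_hess hk hm, if_pos rfl]
  rw [← Finset.add_sum_erase _ _ (Finset.mem_univ a)] at h
  rw [eq_sub_of_add_eq h]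
  congr 1
  refine Finset.sum_congr rfl fun b hb => ?_
  have hab := (Finset.ne_of_mem_erase hb).symm
  rw [hx.sum_ratio_mul_mul_div_hess_of_ne hk hm hab, if_pos rfl, if_neg (Ne.symm hab)]
  ring

/-- The sum of the residues of `r_a r_b / (log λ)'²` in the coordinate `u` vanishes, as this
differential has no poles at `0`, at the `x_a` and at infinity. -/
theorem sum_double_residue (hk : 0 < k) (hm : 0 < m) (hx : IsRegular x) (a b : Fin (k + m)) :
    ∑ u ∈ critRoots x, u * ((ratioD x u a * ratio x u b + ratio x u a * ratioD x u b)
        / hess x u ^ 2 - ratio x u a * ratio x u b * (hess x u + third x u) / hess x u ^ 3)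
      = 0 := by
  have hk' : (k : ℂ) ≠ 0 := by exact_mod_cast hk.ne'
  set A : ℂ[X] := (C (x a) * Lagrange.nodal (Finset.univ.erase a) x)
    * (C (x b) * Lagrange.nodal (Finset.univ.erase b) x) with hA
  have hdeg : A.natDegree + 2 ≤ 2 * (critRoots x).card := by
    have h1 : ∀ c : Fin (k + m), (C (x c) * Lagrange.nodal (Finset.univ.erase c) x).natDegree
        ≤ k + m - 1 := fun c => by
      refine (natDegree_C_mul_le _ _).trans_eq ?_
      rw [Lagrange.natDegree_nodal, Finset.card_erase_of_mem (Finset.mem_univ c),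
        Finset.card_univ, Fintype.card_fin]
    have h2 := natDegree_mul_le (p := C (x a) * Lagrange.nodal (Finset.univ.erase a) x)
      (q := C (x b) * Lagrange.nodal (Finset.univ.erase b) x)
    have h3 := h1 a
    have h4 := h1 b
    rw [← hA] at h2
    rw [hx.card_critRoots hk hm]
    omega
  have hsum := sum_residue_div_nodal_sq hdeg
  have hP := hx.critPoly_eq hk hm
  rw [← mul_zero (-(1 / (k : ℂ) ^ 2)), ← hsum, Finset.mul_sum]
  refine Finset.sum_congr rfl fun u hu => ?_
  have hu := (mem_critRoots hk hm).1 hu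
  have hu0 := hx.root_ne_zero hm hu
  have h1 := hx.eval_erase_root hu
  have h1' := hx.eval_derivative_erase_root hm hu
  have h2 := hx.eval_derivative_critPoly_root hm hu
  have h2' := hx.eval_derivative2_critPoly_root hm hu
  rw [hP, derivative_C_mul, eval_mul, eval_C] at h2
  rw [hP, derivative_C_mul, derivative_C_mul, eval_mul, eval_C] at h2'
  have h3 := hx.nodePoly_root_ne hu
  have h4 := hx.hess_root_ne_zero hm hu
  have h5 : (derivative (Lagrange.nodal (critRoots x) id)).eval u
      = -(hess x u / u) * (nodePoly x).eval u / k := by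
    rw [eq_div_iff hk', ← h2]; ring
  have h6 : (derivative (derivative (Lagrange.nodal (critRoots x) id))).eval u
      = (hess x u + third x u - 2 * m * hess x u) / u ^ 2 * (nodePoly x).eval u / k := by
    rw [eq_div_iff hk', ← h2']; ring
  rw [h5, h6, hA]
  simp only [derivative_mul, derivative_C, zero_mul, zero_add, eval_add, eval_mul, eval_C, h1, h1']
  field_simp
  ring

end IsRegular

end Algebra

end HurwitzLegendre

namespace HurwitzLegendre

/-! ### The trigonometric data -/

section Trig

open Polynomial HurwitzData

variable {k m : ℕ}

/-- The numbers `e^{i z_a}`. -/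
noncomputable def expCoord (z : Fin (k + m) → ℂ) : Fin (k + m) → ℂ :=
  fun a => Complex.exp (Complex.I * z a)

theorem expCoord_ne_zero (z : Fin (k + m) → ℂ) (a : Fin (k + m)) : expCoord z a ≠ 0 :=
  Complex.exp_ne_zero _

/-- The superpotential `λ = u^{-m} Π` in the exponential coordinate. -/
noncomputable def expLam (x : Fin (k + m) → ℂ) (u : ℂ) : ℂ := (nodePoly x).eval u / u ^ m

theorem trig_lam (z : Fin (k + m) → ℂ) (p : ℂ) :
    (trigData k m).lam z p = expLam (expCoord z) (Complex.exp (Complex.I * p)) := by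
  rw [expLam, eval_nodePoly, ← Complex.exp_nat_mul, div_eq_mul_inv, ← Complex.exp_neg, mul_comm]
  simp only [trigData, expCoord]
  congr 2
  ring

theorem hasDerivAt_exp_I (p : ℂ) :
    HasDerivAt (fun p => Complex.exp (Complex.I * p))
      (Complex.I * Complex.exp (Complex.I * p)) p := by
  have h := ((hasDerivAt_id p).const_mul Complex.I).cexp
  exact h.congr_deriv (by simp only [id]; ring)

theorem hasDerivAt_eval_div_pow (q : ℂ[X]) (p : ℂ) :
    HasDerivAt (fun p => q.eval (Complex.exp (Complex.I * p)) / Complex.exp (Complex.I * p) ^ m)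
      (Complex.I * (X * derivative q - C (m : ℂ) * q).eval (Complex.exp (Complex.I * p))
        / Complex.exp (Complex.I * p) ^ m) p := by
  have hu : Complex.exp (Complex.I * p) ≠ 0 := Complex.exp_ne_zero _
  have h1 := (q.hasDerivAt (Complex.exp (Complex.I * p))).comp p (hasDerivAt_exp_I p)
  have h2 := h1.div ((hasDerivAt_exp_I p).pow m) (pow_ne_zero m hu)
  refine h2.congr_deriv ?_
  simp only [eval_sub, eval_mul, eval_X, eval_C, Function.comp]
  rcases m with _ | j
  · simp; ring
  · simp only [Nat.add_sub_cancel, Nat.cast_add, Nat.cast_one, Pi.pow_apply]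
    field_simp
    ring

theorem deriv_trig_lam (z : Fin (k + m) → ℂ) :
    deriv ((trigData k m).lam z) = fun p =>
      Complex.I * ((critPoly (expCoord z)).eval (Complex.exp (Complex.I * p))
        / Complex.exp (Complex.I * p) ^ m) := by
  funext p
  rw [funext (trig_lam z)]
  refine (hasDerivAt_eval_div_pow (nodePoly (expCoord z)) p).deriv.trans ?_
  rw [critPoly]
  ring

theorem deriv2_trig_lam (z : Fin (k + m) → ℂ) (p : ℂ) :
    deriv (deriv ((trigData k m).lam z)) p = Complex.I * (Complex.I *
      (X * derivative (critPoly (expCoord z)) - C (m : ℂ) * critPoly (expCoord z)).eval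
        (Complex.exp (Complex.I * p)) / Complex.exp (Complex.I * p) ^ m) := by
  rw [deriv_trig_lam]
  exact ((hasDerivAt_eval_div_pow (critPoly (expCoord z)) p).const_mul Complex.I).deriv

theorem deriv_trig_lam_eq_zero {z : Fin (k + m) → ℂ} {p : ℂ} :
    deriv ((trigData k m).lam z) p = 0
      ↔ (critPoly (expCoord z)).eval (Complex.exp (Complex.I * p)) = 0 := by
  rw [deriv_trig_lam]
  simp [Complex.I_ne_zero, Complex.exp_ne_zero]

theorem deriv2_trig_lam_root {z : Fin (k + m) → ℂ} {p : ℂ}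
    (hp : (critPoly (expCoord z)).eval (Complex.exp (Complex.I * p)) = 0) :
    deriv (deriv ((trigData k m).lam z)) p = - (Complex.exp (Complex.I * p)
      * (derivative (critPoly (expCoord z))).eval (Complex.exp (Complex.I * p))
      / Complex.exp (Complex.I * p) ^ m) := by
  rw [deriv2_trig_lam, ← mul_div_assoc, ← mul_assoc, Complex.I_mul_I]
  simp only [eval_sub, eval_mul, eval_X, eval_C, hp]
  ring

/-- The derivative of `λ` in the parameters. -/
theorem hasFDerivAt_trig_lam (z : Fin (k + m) → ℂ) (p : ℂ) :
    HasFDerivAt (fun y => (trigData k m).lam y p)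
      (∑ a, (-(Complex.I * (expCoord z a * (Lagrange.nodal (Finset.univ.erase a)
        (expCoord z)).eval (Complex.exp (Complex.I * p))
        / Complex.exp (Complex.I * p) ^ m))) •
          ContinuousLinearMap.proj (R := ℂ) (φ := fun _ : Fin (k + m) => ℂ) a) z := by
  have h1 : ∀ a : Fin (k + m), HasFDerivAt
      (fun y : Fin (k + m) → ℂ => Complex.exp (Complex.I * p) - Complex.exp (Complex.I * y a))
      (-((Complex.I * expCoord z a) •
        ContinuousLinearMap.proj (R := ℂ) (φ := fun _ : Fin (k + m) => ℂ) a)) z := by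
    intro a
    have h2 : HasFDerivAt (fun y : Fin (k + m) → ℂ => y a)
        (ContinuousLinearMap.proj (R := ℂ) (φ := fun _ : Fin (k + m) => ℂ) a) z :=
      hasFDerivAt_apply a z
    exact ((hasDerivAt_exp_I (z a)).comp_hasFDerivAt z h2).const_sub _
  have h3 := (HasFDerivAt.finsetProd (u := Finset.univ) fun a _ => h1 a).const_mul
    (Complex.exp (-(Complex.I * m * p)))
  refine h3.congr_fderiv ?_
  rw [Finset.smul_sum]
  refine Finset.sum_congr rfl fun a _ => ?_
  refine ContinuousLinearMap.ext fun X => ?_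
  rw [Lagrange.eval_nodal, ← Complex.exp_nat_mul, div_eq_mul_inv, ← Complex.exp_neg]
  simp only [expCoord, _root_.smul_apply, _root_.neg_apply, ContinuousLinearMap.proj_apply,
    smul_eq_mul]
  rw [show -((m : ℂ) * (Complex.I * p)) = -(Complex.I * m * p) by ring]
  ring

theorem trig_var (z X : Fin (k + m) → ℂ) (p : ℂ) :
    (trigData k m).var z X p = -(Complex.I * ∑ a, X a * (expCoord z a *
      (Lagrange.nodal (Finset.univ.erase a) (expCoord z)).eval (Complex.exp (Complex.I * p))
        / Complex.exp (Complex.I * p) ^ m)) := by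
  rw [var, (hasFDerivAt_trig_lam z p).fderiv, Finset.mul_sum, ← Finset.sum_neg_distrib]
  simp only [_root_.sum_apply, _root_.smul_apply,
    ContinuousLinearMap.proj_apply, smul_eq_mul]
  exact Finset.sum_congr rfl fun a _ => by ring

theorem trig_var_eq (z X : Fin (k + m) → ℂ) {p : ℂ}
    (hp : ∀ a, Complex.exp (Complex.I * p) ≠ expCoord z a) :
    (trigData k m).var z X p = -(Complex.I * (trigData k m).lam z p
      * ∑ a, X a * ratio (expCoord z) (Complex.exp (Complex.I * p)) a) := by
  rw [trig_var, trig_lam, expLam, mul_assoc]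
  congr 2
  rw [Finset.mul_sum]
  refine Finset.sum_congr rfl fun a _ => ?_
  have h := sub_ne_zero.2 (hp a)
  rw [nodePoly_eq _ a, eval_mul, eval_sub, eval_X, eval_C, ratio]
  field_simp

theorem differentiable_trig_lam (z : Fin (k + m) → ℂ) :
    Differentiable ℂ ((trigData k m).lam z) := by
  rw [funext (trig_lam z)]
  exact fun p => (hasDerivAt_eval_div_pow (nodePoly (expCoord z)) p).differentiableAt

theorem differentiable_trig_var (z X : Fin (k + m) → ℂ) :
    Differentiable ℂ ((trigData k m).var z X) := by
  rw [funext (trig_var z X)]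
  have h : ∀ a : Fin (k + m), Differentiable ℂ fun p =>
      (Lagrange.nodal (Finset.univ.erase a) (expCoord z)).eval (Complex.exp (Complex.I * p))
        / Complex.exp (Complex.I * p) ^ m := fun a p =>
    (hasDerivAt_eval_div_pow _ p).differentiableAt
  refine Differentiable.neg (Differentiable.const_mul (Differentiable.fun_sum fun a _ => ?_) _)
  simp only [mul_div_assoc]
  exact ((h a).const_mul _).const_mul _

/-- The point of the period strip with `e^{ip} = u`. -/
noncomputable def trigPt : ℂ → ℂ :=
  Function.invFunOn (fun p => Complex.exp (Complex.I * p)) {p | 0 ≤ p.re ∧ p.re < 2 * Real.pi}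

theorem exists_mem_strip {u : ℂ} (hu : u ≠ 0) :
    ∃ p ∈ {p : ℂ | 0 ≤ p.re ∧ p.re < 2 * Real.pi}, Complex.exp (Complex.I * p) = u := by
  have harg := Complex.exp_log hu
  have hre : (-(Complex.I * Complex.log u)).re = u.arg := by simp [Complex.log_im]
  have hexp : Complex.exp (Complex.I * -(Complex.I * Complex.log u)) = u := by
    rw [mul_neg, ← mul_assoc, Complex.I_mul_I, neg_one_mul, neg_neg, harg]
  have h1 := Complex.neg_pi_lt_arg u
  have h2 := Complex.arg_le_pi u
  by_cases h : 0 ≤ u.arg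
  · exact ⟨_, ⟨by rwa [hre], by rw [hre]; linarith [Real.pi_pos]⟩, hexp⟩
  · refine ⟨-(Complex.I * Complex.log u) + (2 * Real.pi : ℝ), ⟨?_, ?_⟩, ?_⟩
    · rw [Complex.add_re, hre, Complex.ofReal_re]; linarith [Real.pi_pos]
    · rw [Complex.add_re, hre, Complex.ofReal_re]; linarith [not_le.1 h]
    · rw [mul_add, Complex.exp_add, hexp]
      push_cast
      rw [mul_comm Complex.I, Complex.exp_two_pi_mul_I, mul_one]

theorem trigPt_mem {u : ℂ} (hu : u ≠ 0) : 0 ≤ (trigPt u).re ∧ (trigPt u).re < 2 * Real.pi :=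
  Function.invFunOn_mem (exists_mem_strip hu)

theorem exp_trigPt {u : ℂ} (hu : u ≠ 0) : Complex.exp (Complex.I * trigPt u) = u :=
  Function.invFunOn_eq (exists_mem_strip hu)

theorem exp_injOn_strip : Set.InjOn (fun p => Complex.exp (Complex.I * p))
    {p : ℂ | 0 ≤ p.re ∧ p.re < 2 * Real.pi} := by
  rintro p ⟨hp0, hp1⟩ q ⟨hq0, hq1⟩ h
  obtain ⟨n, hn⟩ := Complex.exp_eq_exp_iff_exists_int.1 h
  have h1 : p = q + n * (2 * Real.pi) := by
    have : Complex.I * p = Complex.I * (q + n * (2 * Real.pi)) := by rw [hn]; ring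
    exact mul_left_cancel₀ Complex.I_ne_zero this
  have h2 : p.re = q.re + n * (2 * Real.pi) := by
    have := congrArg Complex.re h1
    simpa using this
  have hpi := Real.pi_pos
  have h3 : (n : ℝ) < 1 := by
    by_contra hc
    nlinarith [not_lt.1 hc]
  have h4 : (-1 : ℝ) < n := by
    by_contra hc
    nlinarith [not_lt.1 hc]
  have h5 : n = 0 := by
    have h3' : n < 1 := by exact_mod_cast h3
    have h4' : -1 < n := by exact_mod_cast h4
    omega
  rw [h1, h5]
  simp

theorem mem_regularLocus_iff (hm : 0 < m) {z : Fin (k + m) → ℂ} :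
    z ∈ regularLocus k m ↔ IsRegular (expCoord z) := by
  constructor
  · rintro ⟨h1, h2⟩
    have hinj : Function.Injective (expCoord z) := fun a b h => by
      by_contra hab
      exact h1 a b hab h
    refine ⟨expCoord_ne_zero z, hinj, fun u hu h => ?_⟩
    have hu0 : u ≠ 0 := by
      rintro rfl
      rw [critPoly] at hu
      simp only [eval_sub, eval_mul, eval_X, eval_C, zero_mul, zero_sub, neg_eq_zero,
        mul_eq_zero, Nat.cast_eq_zero, hm.ne', false_or, eval_nodePoly] at hu
      obtain ⟨a, _, ha⟩ := Finset.prod_eq_zero_iff.1 hu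
      exact expCoord_ne_zero z a (neg_eq_zero.1 ha)
    have he := exp_trigPt hu0
    refine h2 (trigPt u) ⟨trigPt_mem hu0, ?_⟩ ?_
    · rw [deriv_trig_lam_eq_zero, he, hu]
    · rw [deriv2_trig_lam_root (by rw [he, hu]), he, h]
      simp
  · intro h
    refine ⟨fun a b hab he => hab (h.inj he), fun v hv => ?_⟩
    have hc := deriv_trig_lam_eq_zero.1 hv.2
    rw [deriv2_trig_lam_root hc, neg_ne_zero]
    exact div_ne_zero (mul_ne_zero (Complex.exp_ne_zero _) (h.simple _ hc))
      (pow_ne_zero _ (Complex.exp_ne_zero _))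

/-- A tangent vector is determined by its canonical components, as a polynomial of degree less
than `n` is determined by its values at `n` points. -/
theorem IsRegular.eq_zero_of_sum_ratio {x : Fin (k + m) → ℂ} (hk : 0 < k) (hm : 0 < m)
    (hx : IsRegular x) {X : Fin (k + m) → ℂ}
    (hX : ∀ u ∈ critRoots x, ∑ a, X a * ratio x u a = 0) : X = 0 := by
  set q : ℂ[X] := ∑ a, C (X a * x a) * Lagrange.nodal (Finset.univ.erase a) x with hq
  have hdeg : q.degree < (critRoots x).card := by
    rw [hx.card_critRoots hk hm]
    refine (degree_sum_le _ _).trans_lt ((Finset.sup_lt_iff (WithBot.bot_lt_coe _)).2 fun a _ => ?_)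
    refine ((degree_mul_le_of_le degree_C_le le_rfl).trans_eq (zero_add _)).trans_lt ?_
    rw [Lagrange.degree_nodal, Finset.card_erase_of_mem (Finset.mem_univ a), Finset.card_univ,
      Fintype.card_fin]
    exact_mod_cast (by omega : k + m - 1 < k + m)
  have hq0 : q = 0 := Polynomial.eq_zero_of_degree_lt_of_eval_finset_eq_zero _ hdeg fun u hu => by
    have hu' := (mem_critRoots hk hm).1 hu
    rw [hq, eval_finsetSum]
    simp only [eval_mul, eval_C, mul_assoc, hx.eval_erase_root hu']
    simp only [← mul_assoc, ← Finset.sum_mul]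
    rw [hX u hu, zero_mul]
  funext a
  have h := congrArg (fun p => p.eval (x a)) hq0
  simp only [hq, eval_finsetSum, eval_mul, eval_C, eval_zero] at h
  rw [Finset.sum_eq_single a (fun b _ hba => by
    rw [Lagrange.eval_nodal_at_node (Finset.mem_erase.2 ⟨hba.symm, Finset.mem_univ a⟩), mul_zero])
    (fun h => absurd (Finset.mem_univ a) h)] at h
  exact (mul_eq_zero.1 ((mul_eq_zero.1 h).resolve_right (hx.eval_erase_ne a))).resolve_right
    (hx.ne_zero a)

section Regular

variable {z : Fin (k + m) → ℂ}

theorem IsRegular.exp_trigPt {x : Fin (k + m) → ℂ} (hk : 0 < k) (hm : 0 < m) (hx : IsRegular x)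
    {u : ℂ} (hu : u ∈ critRoots x) : Complex.exp (Complex.I * trigPt u) = u :=
  HurwitzLegendre.exp_trigPt (hx.root_ne_zero hm ((mem_critRoots hk hm).1 hu))

theorem IsRegular.expLam_ne_zero {x : Fin (k + m) → ℂ} (hm : 0 < m) (hx : IsRegular x)
    {u : ℂ} (hu : (critPoly x).eval u = 0) : expLam x u ≠ 0 :=
  div_ne_zero (hx.nodePoly_root_ne hu) (pow_ne_zero _ (hx.root_ne_zero hm hu))

theorem trig_lam_pt (hk : 0 < k) (hm : 0 < m) (hx : IsRegular (expCoord z)) {u : ℂ}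
    (hu : u ∈ critRoots (expCoord z)) :
    (trigData k m).lam z (trigPt u) = expLam (expCoord z) u := by
  rw [trig_lam, hx.exp_trigPt hk hm hu]

theorem trig_hess_pt (hk : 0 < k) (hm : 0 < m) (hx : IsRegular (expCoord z)) {u : ℂ}
    (hu : u ∈ critRoots (expCoord z)) :
    deriv (deriv ((trigData k m).lam z)) (trigPt u)
      = expLam (expCoord z) u * hess (expCoord z) u := by
  have hu' := (mem_critRoots hk hm).1 hu
  have hu0 := hx.root_ne_zero hm hu'
  rw [deriv2_trig_lam_root (by rw [hx.exp_trigPt hk hm hu, hu']), hx.exp_trigPt hk hm hu,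
    hx.eval_derivative_critPoly_root hm hu', expLam]
  field_simp

theorem trig_comp (hk : 0 < k) (hm : 0 < m) (hx : IsRegular (expCoord z)) (X : Fin (k + m) → ℂ)
    {u : ℂ} (hu : u ∈ critRoots (expCoord z)) :
    (trigData k m).comp z trigPt X u = -(Complex.I * expLam (expCoord z) u
      * ∑ a, X a * ratio (expCoord z) u a) := by
  have hu' := (mem_critRoots hk hm).1 hu
  rw [comp_apply, trig_var_eq, trig_lam_pt hk hm hx hu, hx.exp_trigPt hk hm hu]
  rw [hx.exp_trigPt hk hm hu]
  exact hx.root_ne_node hu'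

theorem trig_comp_single (hk : 0 < k) (hm : 0 < m) (hx : IsRegular (expCoord z))
    (a : Fin (k + m)) {u : ℂ} (hu : u ∈ critRoots (expCoord z)) :
    (trigData k m).comp z trigPt (Pi.single a 1) u = -(Complex.I * expLam (expCoord z) u
      * ratio (expCoord z) u a) := by
  rw [trig_comp hk hm hx _ hu]
  simp [Pi.single_apply]

theorem trig_frame (hk : 0 < k) (hm : 0 < m) (hx : IsRegular (expCoord z)) :
    (trigData k m).IsCanonicalFrame z (critRoots (expCoord z)) trigPt where
  bij := by
    refine ⟨fun u hu => ?_, fun u hu v hv huv => ?_, fun p hp => ?_⟩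
    · have hu' := (mem_critRoots hk hm).1 hu
      refine ⟨trigPt_mem (hx.root_ne_zero hm hu'), ?_⟩
      rw [deriv_trig_lam_eq_zero, hx.exp_trigPt hk hm hu, hu']
    · rw [← hx.exp_trigPt hk hm hu, huv, hx.exp_trigPt hk hm hv]
    · have h0 : Complex.exp (Complex.I * p) ≠ 0 := Complex.exp_ne_zero _
      exact ⟨Complex.exp (Complex.I * p), (mem_critRoots hk hm).2 (deriv_trig_lam_eq_zero.1 hp.2),
        exp_injOn_strip (trigPt_mem h0) hp.1 (exp_trigPt h0)⟩
  card := hx.card_critRoots hk hm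
  analytic u _ := (differentiable_trig_lam z).analyticAt _
  analytic_var u _ X := (differentiable_trig_var z X).analyticAt _
  lam_ne u hu := by
    rw [trig_lam_pt hk hm hx hu]
    exact hx.expLam_ne_zero hm ((mem_critRoots hk hm).1 hu)
  hess_ne u hu := by
    have hu' := (mem_critRoots hk hm).1 hu
    rw [trig_hess_pt hk hm hx hu]
    exact mul_ne_zero (hx.expLam_ne_zero hm hu') (hx.hess_root_ne_zero hm hu')
  inj X hX := by
    refine hx.eq_zero_of_sum_ratio hk hm fun u hu => ?_
    have h := hX u hu
    rw [← comp_apply, trig_comp hk hm hx X hu, neg_eq_zero] at h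
    exact (mul_eq_zero.1 h).resolve_left
      (mul_ne_zero Complex.I_ne_zero (hx.expLam_ne_zero hm ((mem_critRoots hk hm).1 hu)))

theorem trig_isEulerAt (hk : 0 < k) (hm : 0 < m) (hx : IsRegular (expCoord z)) :
    (trigData k m).IsEulerAt (trigEuler k m) z := by
  intro v hv
  obtain ⟨u, hu, rfl⟩ := (trig_frame hk hm hx).bij.surjOn hv
  have hk' : (k : ℂ) ≠ 0 := by exact_mod_cast hk.ne'
  have hI := Complex.I_ne_zero
  rw [← comp_apply, trig_comp hk hm hx _ hu, trig_lam_pt hk hm hx hu]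
  simp only [trigEuler]
  rw [← Finset.mul_sum, hx.sum_ratio ((mem_critRoots hk hm).1 hu)]
  field_simp

/-- The intersection form is constant in the coordinates `z`. -/
theorem trig_dualEta (hk : 0 < k) (hm : 0 < m) (hx : IsRegular (expCoord z)) :
    gram ((trigData k m).dualEta z)
      = Matrix.of fun a b => (if a = b then (1 : ℂ) else 0) - 1 / m := by
  ext a b
  rw [Matrix.of_apply, ← hx.sum_ratio_mul_div_hess hk hm a b, gram, Matrix.of_apply,
    (trig_frame hk hm hx).dualEta_eq]
  refine Finset.sum_congr rfl fun u hu => ?_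
  have hu' := (mem_critRoots hk hm).1 hu
  have h1 := hx.expLam_ne_zero hm hu'
  have h2 := hx.hess_root_ne_zero hm hu'
  rw [trig_comp_single hk hm hx a hu, trig_comp_single hk hm hx b hu, trig_lam_pt hk hm hx hu,
    trig_hess_pt hk hm hx hu]
  field_simp
  linear_combination (-ratio (expCoord z) u a * ratio (expCoord z) u b) * Complex.I_sq

theorem trig_dualCubic (hk : 0 < k) (hm : 0 < m) (hx : IsRegular (expCoord z))
    (a b c : Fin (k + m)) :
    (trigData k m).dualCubic z (Pi.single a 1) (Pi.single b 1) (Pi.single c 1)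
      = -Complex.I * ∑ u ∈ critRoots (expCoord z), ratio (expCoord z) u a * ratio (expCoord z) u b
        * ratio (expCoord z) u c / hess (expCoord z) u := by
  rw [(trig_frame hk hm hx).dualCubic_eq, Finset.mul_sum]
  refine Finset.sum_congr rfl fun u hu => ?_
  have hu' := (mem_critRoots hk hm).1 hu
  have h1 := hx.expLam_ne_zero hm hu'
  have h2 := hx.hess_root_ne_zero hm hu'
  rw [trig_comp_single hk hm hx a hu, trig_comp_single hk hm hx b hu,
    trig_comp_single hk hm hx c hu, trig_lam_pt hk hm hx hu, trig_hess_pt hk hm hx hu]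
  field_simp
  linear_combination (ratio (expCoord z) u a * ratio (expCoord z) u b
    * ratio (expCoord z) u c) * Complex.I_sq

end Regular

end Trig

end HurwitzLegendre

namespace HurwitzLegendre

/-! ### The rational data and the Legendre transformation -/

section Rat

open Polynomial HurwitzData

variable {k m : ℕ}

theorem zhatZero_coordChange (hk : 0 < k) (hm : 0 < m) (z : Fin (k + m) → ℂ) :
    zhatZero k m (coordChange k m z) = -(∑ b, expCoord z b) / k := by
  have hk' : (k : ℂ) ≠ 0 := by exact_mod_cast hk.ne'
  have hm' : (m : ℂ) ≠ 0 := by exact_mod_cast hm.ne'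
  simp only [zhatZero, coordChange, Finset.sum_sub_distrib, Finset.sum_const, Finset.card_univ,
    Fintype.card_fin, nsmul_eq_mul, expCoord]
  push_cast
  field_simp
  ring

theorem coordChange_sub_zhatZero (hk : 0 < k) (hm : 0 < m) (z : Fin (k + m) → ℂ)
    (a : Fin (k + m)) :
    coordChange k m z a - zhatZero k m (coordChange k m z) = expCoord z a := by
  rw [zhatZero_coordChange hk hm, coordChange]
  simp only [expCoord]
  ring

theorem rat_lam (y : Fin (k + m) → ℂ) (q : ℂ) :
    (ratData k m).lam y q = expLam (fun a => y a - zhatZero k m y) (q - zhatZero k m y) := by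
  rw [expLam, eval_nodePoly]
  simp [ratData]

/-- Both families describe the same function of the point `u` of the curve. -/
theorem rat_lam_coordChange (hk : 0 < k) (hm : 0 < m) (z : Fin (k + m) → ℂ) (u : ℂ) :
    (ratData k m).lam (coordChange k m z) (u + zhatZero k m (coordChange k m z))
      = expLam (expCoord z) u := by
  rw [rat_lam, funext (coordChange_sub_zhatZero hk hm z), add_sub_cancel_right]

theorem hasDerivAt_expLam (x : Fin (k + m) → ℂ) {u : ℂ} (hu : u ≠ 0) :
    HasDerivAt (expLam x) ((critPoly x).eval u / u ^ (m + 1)) u := by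
  have h := ((nodePoly x).hasDerivAt u).div (hasDerivAt_pow m u) (pow_ne_zero m hu)
  refine h.congr_deriv ?_
  simp only [critPoly, eval_sub, eval_mul, eval_X, eval_C]
  rcases m with _ | j
  · simp only [pow_zero, Nat.cast_zero, zero_mul, mul_zero, sub_zero, mul_one, div_one, zero_add,
      pow_one, one_pow]
    field_simp
  · simp only [Nat.add_sub_cancel]
    field_simp
    ring

theorem deriv_rat_lam (y : Fin (k + m) → ℂ) {q : ℂ} (hq : q ≠ zhatZero k m y) :
    deriv ((ratData k m).lam y) q = (critPoly fun a => y a - zhatZero k m y).eval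
      (q - zhatZero k m y) / (q - zhatZero k m y) ^ (m + 1) := by
  rw [funext (rat_lam y)]
  exact ((hasDerivAt_expLam _ (sub_ne_zero.2 hq)).comp_sub_const q (zhatZero k m y)).deriv

theorem analyticAt_rat_lam (y : Fin (k + m) → ℂ) {q : ℂ} (hq : q ≠ zhatZero k m y) :
    AnalyticAt ℂ ((ratData k m).lam y) q := by
  rw [Complex.analyticAt_iff_eventually_differentiableAt]
  filter_upwards [eventually_ne_nhds hq] with v hv
  rw [funext (rat_lam y)]
  exact ((hasDerivAt_expLam _ (sub_ne_zero.2 hv)).comp_sub_const v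
    (zhatZero k m y)).differentiableAt

theorem deriv2_rat_lam_root (y : Fin (k + m) → ℂ) {q : ℂ} (hq : q ≠ zhatZero k m y)
    (h0 : (critPoly fun a => y a - zhatZero k m y).eval (q - zhatZero k m y) = 0) :
    deriv (deriv ((ratData k m).lam y)) q
      = (derivative (critPoly fun a => y a - zhatZero k m y)).eval
        (q - zhatZero k m y) / (q - zhatZero k m y) ^ (m + 1) := by
  have h1 : deriv ((ratData k m).lam y) =ᶠ[𝓝 q] fun v => (fun w =>
      (critPoly fun a => y a - zhatZero k m y).eval w / w ^ (m + 1)) (v - zhatZero k m y) := by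
    filter_upwards [eventually_ne_nhds hq] with v hv using deriv_rat_lam y hv
  have hu := sub_ne_zero.2 hq
  rw [h1.deriv_eq]
  have h2 := ((critPoly fun a => y a - zhatZero k m y).hasDerivAt (q - zhatZero k m y)).div
    (hasDerivAt_pow (m + 1) (q - zhatZero k m y)) (pow_ne_zero _ hu)
  refine (h2.comp_sub_const q (zhatZero k m y)).deriv.trans ?_
  rw [h0]
  field_simp
  ring

theorem hasFDerivAt_rat_lam (hm : 0 < m) (y : Fin (k + m) → ℂ) {q : ℂ}
    (hq : q ≠ zhatZero k m y) :
    HasFDerivAt (fun y => (ratData k m).lam y q)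
      (∑ a, (-((y a - zhatZero k m y) * (Lagrange.nodal (Finset.univ.erase a)
        (fun a => y a - zhatZero k m y)).eval (q - zhatZero k m y)
        / (q - zhatZero k m y) ^ (m + 1))) •
          ContinuousLinearMap.proj (R := ℂ) (φ := fun _ : Fin (k + m) => ℂ) a) y := by
  have hm' : (m : ℂ) ≠ 0 := by exact_mod_cast hm.ne'
  have h0 : ∀ a : Fin (k + m), HasFDerivAt (fun y : Fin (k + m) → ℂ => y a)
      (ContinuousLinearMap.proj (R := ℂ) (φ := fun _ : Fin (k + m) => ℂ) a) y :=
    fun a => hasFDerivAt_apply a y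
  have h1 := HasFDerivAt.finsetProd (u := Finset.univ) fun a _ => (h0 a).const_sub q
  have h2 : HasFDerivAt (fun y => q - zhatZero k m y) (-((m : ℂ)⁻¹ • ∑ a,
      ContinuousLinearMap.proj (R := ℂ) (φ := fun _ : Fin (k + m) => ℂ) a)) y := by
    simp only [zhatZero, div_eq_mul_inv]
    exact ((HasFDerivAt.fun_sum (u := Finset.univ) fun a _ => h0 a).mul_const
      ((m : ℂ)⁻¹)).const_sub q
  have hu := sub_ne_zero.2 hq
  have h3 : HasFDerivAt (fun y => ((q - zhatZero k m y) ^ m)⁻¹)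
      ((-(m * (q - zhatZero k m y) ^ (m - 1)) / ((q - zhatZero k m y) ^ m) ^ 2) •
        -((m : ℂ)⁻¹ • ∑ a, ContinuousLinearMap.proj (R := ℂ)
          (φ := fun _ : Fin (k + m) => ℂ) a)) y :=
    HasDerivAt.comp_hasFDerivAt (h₂ := fun w => (w ^ m)⁻¹) y
      ((hasDerivAt_pow m (q - zhatZero k m y)).fun_inv (pow_ne_zero m hu)) h2
  have h4 := h1.fun_mul h3
  have hprod : ∀ a, ∏ b, (q - y b) = (q - zhatZero k m y - (y a - zhatZero k m y))
      * ∏ b ∈ Finset.univ.erase a, (q - y b) := fun a => by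
    rw [← Finset.mul_prod_erase _ _ (Finset.mem_univ a)]
    ring
  have hpow : (q - zhatZero k m y) ^ m
      = (q - zhatZero k m y) ^ (m - 1) * (q - zhatZero k m y) := by
    rw [← pow_succ, Nat.sub_add_cancel hm]
  refine (h4.congr_fderiv (ContinuousLinearMap.ext fun X => ?_)).congr_of_eventuallyEq
    (Eventually.of_forall fun w => ?_)
  · simp only [_root_.smul_apply, _root_.neg_apply, _root_.sum_apply,
      _root_.add_apply, ContinuousLinearMap.proj_apply, smul_eq_mul, Finset.smul_sum,
      Lagrange.eval_nodal, sub_sub_sub_cancel_right]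
    rw [← Finset.sum_neg_distrib]
    simp only [Finset.mul_sum]
    rw [← Finset.sum_add_distrib]
    refine Finset.sum_congr rfl fun a _ => ?_
    have hpow' := pow_ne_zero (m - 1) hu
    rw [hprod a, pow_succ _ m, hpow]
    generalize (q - zhatZero k m y) ^ (m - 1) = P at hpow' ⊢
    field_simp
    ring
  · simp only [ratData, div_eq_mul_inv]

theorem rat_var (hm : 0 < m) (y Y : Fin (k + m) → ℂ) {q : ℂ} (hq : q ≠ zhatZero k m y) :
    (ratData k m).var y Y q = -∑ a, Y a * ((y a - zhatZero k m y) *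
      (Lagrange.nodal (Finset.univ.erase a) (fun a => y a - zhatZero k m y)).eval
        (q - zhatZero k m y) / (q - zhatZero k m y) ^ (m + 1)) := by
  rw [var, (hasFDerivAt_rat_lam hm y hq).fderiv, ← Finset.sum_neg_distrib]
  simp only [_root_.sum_apply, _root_.smul_apply, ContinuousLinearMap.proj_apply, smul_eq_mul]
  exact Finset.sum_congr rfl fun a _ => by ring

theorem analyticAt_rat_var (hm : 0 < m) (y Y : Fin (k + m) → ℂ) {q : ℂ}
    (hq : q ≠ zhatZero k m y) : AnalyticAt ℂ ((ratData k m).var y Y) q := by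
  rw [Complex.analyticAt_iff_eventually_differentiableAt]
  filter_upwards [eventually_ne_nhds hq] with v hv
  have h1 : (ratData k m).var y Y =ᶠ[𝓝 v] fun q => -∑ a, Y a * ((y a - zhatZero k m y) *
      (Lagrange.nodal (Finset.univ.erase a) (fun a => y a - zhatZero k m y)).eval
        (q - zhatZero k m y) / (q - zhatZero k m y) ^ (m + 1)) := by
    filter_upwards [eventually_ne_nhds hv] with w hw using rat_var hm y Y hw
  refine h1.differentiableAt_iff.2 (DifferentiableAt.neg (DifferentiableAt.fun_sum fun a _ => ?_))
  have h2 : DifferentiableAt ℂ (fun w => w - zhatZero k m y) v := by fun_prop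
  exact ((((Polynomial.differentiable _ _).comp v h2).const_mul _).div (h2.pow _)
    (pow_ne_zero _ (sub_ne_zero.2 hv))).const_mul _

/-- The point of the rational curve with `u = q - zhat⁰`. -/
noncomputable def ratPt (k m : ℕ) (z : Fin (k + m) → ℂ) (u : ℂ) : ℂ :=
  u + zhatZero k m (coordChange k m z)

theorem ratPt_ne {z : Fin (k + m) → ℂ} {u : ℂ} (hu : u ≠ 0) :
    ratPt k m z u ≠ zhatZero k m (coordChange k m z) := by
  rwa [ratPt, Ne, add_eq_right]

theorem ratPt_sub {z : Fin (k + m) → ℂ} {u : ℂ} :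
    ratPt k m z u - zhatZero k m (coordChange k m z) = u := add_sub_cancel_right _ _

theorem hasStrictFDerivAt_coordChange (z : Fin (k + m) → ℂ) :
    HasStrictFDerivAt (coordChange k m) (ContinuousLinearMap.pi fun a =>
      (Complex.I * expCoord z a) • ContinuousLinearMap.proj (R := ℂ)
          (φ := fun _ : Fin (k + m) => ℂ) a
      - (k : ℂ)⁻¹ • ∑ b, (Complex.I * expCoord z b) • ContinuousLinearMap.proj (R := ℂ)
          (φ := fun _ : Fin (k + m) => ℂ) b) z := by
  rw [hasStrictFDerivAt_pi]
  intro a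
  have h : ∀ a : Fin (k + m), HasStrictFDerivAt
      (fun y : Fin (k + m) → ℂ => Complex.exp (Complex.I * y a))
      ((Complex.I * expCoord z a) • ContinuousLinearMap.proj (R := ℂ)
          (φ := fun _ : Fin (k + m) => ℂ) a) z := fun a => by
    have h2 : HasStrictFDerivAt (fun y : Fin (k + m) → ℂ => y a) (ContinuousLinearMap.proj (R := ℂ)
          (φ := fun _ : Fin (k + m) => ℂ) a) z := hasStrictFDerivAt_apply a z
    have h3 : HasStrictDerivAt (fun p => Complex.exp (Complex.I * p))
        (Complex.I * expCoord z a) (z a) := by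
      have h := ((hasStrictDerivAt_id (z a)).const_mul Complex.I).cexp
      exact h.congr_deriv (by simp only [id, expCoord]; ring)
    exact HasStrictDerivAt.comp_hasStrictFDerivAt (h₂ := fun p => Complex.exp (Complex.I * p)) z
      h3 h2
  exact (h a).sub ((HasStrictFDerivAt.fun_sum (u := Finset.univ) fun b _ => h b).mul_const _)

theorem fderiv_coordChange (z X : Fin (k + m) → ℂ) (a : Fin (k + m)) :
    fderiv ℂ (coordChange k m) z X a = Complex.I * expCoord z a * X a
      - (∑ b, Complex.I * expCoord z b * X b) / k := by
  rw [(hasStrictFDerivAt_coordChange z).hasFDerivAt.fderiv]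
  simp only [ContinuousLinearMap.pi_apply, _root_.sub_apply, _root_.smul_apply, _root_.sum_apply,
    ContinuousLinearMap.proj_apply, smul_eq_mul]
  ring

theorem bijective_fderiv_coordChange (hk : 0 < k) (hm : 0 < m) (z : Fin (k + m) → ℂ) :
    Function.Bijective (fderiv ℂ (coordChange k m) z) := by
  have hk' : (k : ℂ) ≠ 0 := by exact_mod_cast hk.ne'
  have hm' : (m : ℂ) ≠ 0 := by exact_mod_cast hm.ne'
  have hinj : Function.Injective (fderiv ℂ (coordChange k m) z).toLinearMap := by
    rw [← LinearMap.ker_eq_bot, LinearMap.ker_eq_bot']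
    intro X hX
    have h1 : ∀ a, Complex.I * expCoord z a * X a
        = (∑ b, Complex.I * expCoord z b * X b) / k := fun a => by
      rw [← sub_eq_zero, ← fderiv_coordChange]
      exact congrFun hX a
    -- all `x_a X_a` agree, and their sum is `k` times their common value
    have h2 : (∑ b, Complex.I * expCoord z b * X b) = 0 := by
      have h := Finset.sum_congr (rfl : Finset.univ = Finset.univ) fun a _ => h1 a
      rw [Finset.sum_const, Finset.card_univ, Fintype.card_fin, nsmul_eq_mul] at h
      push_cast at h
      field_simp at h
      have h3 : (m : ℂ) * ∑ b, Complex.I * expCoord z b * X b = 0 := by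
        linear_combination -h
      exact (mul_eq_zero.1 h3).resolve_left hm'
    funext a
    have h3 := h1 a
    rw [h2, zero_div] at h3
    exact (mul_eq_zero.1 h3).resolve_left (mul_ne_zero Complex.I_ne_zero (expCoord_ne_zero z a))
  exact ⟨hinj, LinearMap.injective_iff_surjective.1 hinj⟩

section Regular

variable {z : Fin (k + m) → ℂ}

theorem rat_lam_pt (hk : 0 < k) (hm : 0 < m) (z : Fin (k + m) → ℂ) (u : ℂ) :
    (ratData k m).lam (coordChange k m z) (ratPt k m z u) = expLam (expCoord z) u :=
  rat_lam_coordChange hk hm z u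

theorem deriv_rat_lam_pt (hk : 0 < k) (hm : 0 < m) (z : Fin (k + m) → ℂ) {u : ℂ} (hu : u ≠ 0) :
    deriv ((ratData k m).lam (coordChange k m z)) (ratPt k m z u)
      = (critPoly (expCoord z)).eval u / u ^ (m + 1) := by
  rw [deriv_rat_lam _ (ratPt_ne hu), ratPt_sub, funext (coordChange_sub_zhatZero hk hm z)]

theorem rat_hess_pt (hk : 0 < k) (hm : 0 < m) (hx : IsRegular (expCoord z)) {u : ℂ}
    (hu : u ∈ critRoots (expCoord z)) :
    deriv (deriv ((ratData k m).lam (coordChange k m z))) (ratPt k m z u)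
      = -(expLam (expCoord z) u * hess (expCoord z) u / u ^ 2) := by
  have hu' := (mem_critRoots hk hm).1 hu
  have hu0 := hx.root_ne_zero hm hu'
  have hf := funext (coordChange_sub_zhatZero hk hm z)
  rw [deriv2_rat_lam_root _ (ratPt_ne hu0) (by rw [ratPt_sub, hf, hu']), ratPt_sub, hf,
    hx.eval_derivative_critPoly_root hm hu', expLam]
  field_simp
  ring

theorem rat_comp (hk : 0 < k) (hm : 0 < m) (hx : IsRegular (expCoord z)) (Y : Fin (k + m) → ℂ)
    {u : ℂ} (hu : u ∈ critRoots (expCoord z)) :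
    (ratData k m).comp (coordChange k m z) (ratPt k m z) Y u
      = -(expLam (expCoord z) u / u * ∑ a, Y a * ratio (expCoord z) u a) := by
  have hu' := (mem_critRoots hk hm).1 hu
  have hu0 := hx.root_ne_zero hm hu'
  rw [comp_apply, rat_var hm _ _ (ratPt_ne hu0), ratPt_sub,
    funext (coordChange_sub_zhatZero hk hm z), Finset.mul_sum]
  congr 1
  refine Finset.sum_congr rfl fun a _ => ?_
  rw [coordChange_sub_zhatZero hk hm z, hx.eval_erase_root hu', expLam]
  field_simp
  ring

theorem rat_comp_single (hk : 0 < k) (hm : 0 < m) (hx : IsRegular (expCoord z))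
    (a : Fin (k + m)) {u : ℂ} (hu : u ∈ critRoots (expCoord z)) :
    (ratData k m).comp (coordChange k m z) (ratPt k m z) (Pi.single a 1) u
      = -(expLam (expCoord z) u / u * ratio (expCoord z) u a) := by
  rw [rat_comp hk hm hx _ hu]
  simp [Pi.single_apply]

/-- A tangent vector has the same canonical components in both families, as both describe the same
function on the curve and the canonical components are derivatives of critical values. -/
theorem rat_comp_fderiv (hk : 0 < k) (hm : 0 < m) (hx : IsRegular (expCoord z))
    (X : Fin (k + m) → ℂ) {u : ℂ} (hu : u ∈ critRoots (expCoord z)) :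
    (ratData k m).comp (coordChange k m z) (ratPt k m z) (fderiv ℂ (coordChange k m) z X) u
      = (trigData k m).comp z trigPt X u := by
  have hu' := (mem_critRoots hk hm).1 hu
  have hu0 := hx.root_ne_zero hm hu'
  have hk' : (k : ℂ) ≠ 0 := by exact_mod_cast hk.ne'
  rw [rat_comp hk hm hx _ hu, trig_comp hk hm hx _ hu]
  have h : ∑ a, fderiv ℂ (coordChange k m) z X a * ratio (expCoord z) u a
      = Complex.I * u * ∑ a, X a * ratio (expCoord z) u a := by
    simp only [fderiv_coordChange, sub_mul, Finset.sum_sub_distrib]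
    rw [← Finset.mul_sum, hx.sum_ratio hu', div_mul_eq_mul_div, mul_neg, neg_div,
      mul_div_cancel_right₀ _ hk', sub_neg_eq_add, ← Finset.sum_add_distrib, Finset.mul_sum]
    refine Finset.sum_congr rfl fun a _ => ?_
    have := sub_ne_zero.2 (hx.root_ne_node hu' a)
    rw [ratio]
    field_simp
    ring
  rw [h]
  field_simp

theorem rat_frame (hk : 0 < k) (hm : 0 < m) (hx : IsRegular (expCoord z)) :
    (ratData k m).IsCanonicalFrame (coordChange k m z) (critRoots (expCoord z)) (ratPt k m z) where
  bij := by
    refine ⟨fun u hu => ?_, fun u _ v _ huv => ?_, fun q hq => ?_⟩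
    · have hu' := (mem_critRoots hk hm).1 hu
      have hu0 := hx.root_ne_zero hm hu'
      refine ⟨ratPt_ne hu0, ?_⟩
      rw [deriv_rat_lam_pt hk hm z hu0, hu', zero_div]
    · exact add_right_cancel huv
    · obtain ⟨u, rfl⟩ : ∃ u, ratPt k m z u = q := ⟨_, sub_add_cancel q _⟩
      have hu0 : u ≠ 0 := by
        rintro rfl
        exact hq.1 (zero_add _)
      refine ⟨u, (mem_critRoots hk hm).2 ?_, rfl⟩
      have h := hq.2
      rw [deriv_rat_lam_pt hk hm z hu0] at h
      exact (div_eq_zero_iff.1 h).resolve_right (pow_ne_zero _ hu0)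
  card := hx.card_critRoots hk hm
  analytic u hu := analyticAt_rat_lam _
    (ratPt_ne (hx.root_ne_zero hm ((mem_critRoots hk hm).1 hu)))
  analytic_var u hu X := analyticAt_rat_var hm _ _
    (ratPt_ne (hx.root_ne_zero hm ((mem_critRoots hk hm).1 hu)))
  lam_ne u hu := by
    rw [rat_lam_pt hk hm]
    exact hx.expLam_ne_zero hm ((mem_critRoots hk hm).1 hu)
  hess_ne u hu := by
    have hu' := (mem_critRoots hk hm).1 hu
    rw [rat_hess_pt hk hm hx hu, neg_ne_zero]
    exact div_ne_zero (mul_ne_zero (hx.expLam_ne_zero hm hu') (hx.hess_root_ne_zero hm hu'))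
      (pow_ne_zero _ (hx.root_ne_zero hm hu'))
  inj X hX := by
    refine hx.eq_zero_of_sum_ratio hk hm fun u hu => ?_
    have hu' := (mem_critRoots hk hm).1 hu
    have h := hX u hu
    rw [← comp_apply, rat_comp hk hm hx X hu, neg_eq_zero] at h
    exact (mul_eq_zero.1 h).resolve_left
      (div_ne_zero (hx.expLam_ne_zero hm hu') (hx.root_ne_zero hm hu'))

theorem fderiv_coordChange_trigEuler (hk : 0 < k) (z : Fin (k + m) → ℂ) :
    fderiv ℂ (coordChange k m) z (trigEuler k m z) = ratEuler k m (coordChange k m z) := by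
  have hk' : (k : ℂ) ≠ 0 := by exact_mod_cast hk.ne'
  funext a
  rw [fderiv_coordChange]
  simp only [trigEuler, ratEuler, coordChange, ← Finset.sum_mul, ← Finset.mul_sum]
  have hI := Complex.I_ne_zero
  simp only [expCoord]
  field_simp

theorem rat_isEulerAt (hk : 0 < k) (hm : 0 < m) (hx : IsRegular (expCoord z)) :
    (ratData k m).IsEulerAt (ratEuler k m) (coordChange k m z) := by
  intro v hv
  obtain ⟨u, hu, rfl⟩ := (rat_frame hk hm hx).bij.surjOn hv
  rw [← comp_apply, ← fderiv_coordChange_trigEuler hk, rat_comp_fderiv hk hm hx _ hu,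
    rat_lam_pt hk hm, ← trig_lam_pt hk hm hx hu]
  exact trig_isEulerAt hk hm hx _ ((trig_frame hk hm hx).bij.mapsTo hu)

/-- The components of the two intersection forms agree. -/
theorem rat_dualEta (hk : 0 < k) (hm : 0 < m) (hx : IsRegular (expCoord z)) :
    gram ((ratData k m).dualEta (coordChange k m z)) = gram ((trigData k m).dualEta z) := by
  ext a b
  rw [gram, gram, Matrix.of_apply, Matrix.of_apply, (rat_frame hk hm hx).dualEta_eq,
    (trig_frame hk hm hx).dualEta_eq]
  refine Finset.sum_congr rfl fun u hu => ?_
  have hu' := (mem_critRoots hk hm).1 hu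
  have hu0 := hx.root_ne_zero hm hu'
  have h1 := hx.expLam_ne_zero hm hu'
  have h2 := hx.hess_root_ne_zero hm hu'
  rw [trig_comp_single hk hm hx a hu, trig_comp_single hk hm hx b hu, trig_lam_pt hk hm hx hu,
    trig_hess_pt hk hm hx hu, rat_comp_single hk hm hx a hu, rat_comp_single hk hm hx b hu,
    rat_lam_pt hk hm, rat_hess_pt hk hm hx hu]
  field_simp
  linear_combination (ratio (expCoord z) u a * ratio (expCoord z) u b) * Complex.I_sq

/-- The mixed components of the rational dual cubic tensor are the components of the trigonometric
one. -/
theorem rat_dualCubic_mixed (hk : 0 < k) (hm : 0 < m) (hx : IsRegular (expCoord z))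
    (X : Fin (k + m) → ℂ) (a b : Fin (k + m)) :
    (ratData k m).dualCubic (coordChange k m z) (fderiv ℂ (coordChange k m) z X)
        (Pi.single a 1) (Pi.single b 1)
      = (trigData k m).dualCubic z X (Pi.single a 1) (Pi.single b 1) := by
  rw [(rat_frame hk hm hx).dualCubic_eq, (trig_frame hk hm hx).dualCubic_eq]
  refine Finset.sum_congr rfl fun u hu => ?_
  have hu' := (mem_critRoots hk hm).1 hu
  have hu0 := hx.root_ne_zero hm hu'
  have h1 := hx.expLam_ne_zero hm hu'
  have h2 := hx.hess_root_ne_zero hm hu'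
  rw [rat_comp_fderiv hk hm hx X hu, trig_comp_single hk hm hx a hu,
    trig_comp_single hk hm hx b hu, trig_lam_pt hk hm hx hu,
    trig_hess_pt hk hm hx hu, rat_comp_single hk hm hx a hu, rat_comp_single hk hm hx b hu,
    rat_lam_pt hk hm, rat_hess_pt hk hm hx hu]
  field_simp
  linear_combination ((trigData k m).comp z trigPt X u * ratio (expCoord z) u a
    * ratio (expCoord z) u b) * Complex.I_sq

end Regular

end Rat

end HurwitzLegendre

namespace HurwitzLegendre

/-! ### The generators of the Legendre transformations -/

section Generators

open Polynomial HurwitzData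

variable {k m : ℕ}

/-- The field `∂_κ`: its canonical components are the values of `i e^{ip}`. It is obtained by
Lagrange interpolation at the `x_a`; the function `u^{m+1}` has to be reduced modulo `critPoly`
when `k = 1`, which gives the last term. -/
noncomputable def legendreField (k m : ℕ) (z : Fin (k + m) → ℂ) : Fin (k + m) → ℂ := fun a =>
  -(expCoord z a ^ m / ∏ b ∈ Finset.univ.erase a, (expCoord z a - expCoord z b))
    + if k = 1 then 1 else 0

/-- The field `E ∘ ∂_κ`: in the coordinates `z` it has the components `zhat^a / k`. -/
noncomputable def twistedField (k m : ℕ) (z : Fin (k + m) → ℂ) : Fin (k + m) → ℂ := fun a =>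
  coordChange k m z a / k

theorem analyticAt_expCoord (z : Fin (k + m) → ℂ) (a : Fin (k + m)) :
    AnalyticAt ℂ (fun z : Fin (k + m) → ℂ => expCoord z a) z := by
  have h : AnalyticAt ℂ (fun z : Fin (k + m) → ℂ => z a) z :=
    (ContinuousLinearMap.proj (R := ℂ) (φ := fun _ : Fin (k + m) => ℂ) a).analyticAt z
  exact (analyticAt_const.mul h).cexp

theorem analyticAt_legendreField {z : Fin (k + m) → ℂ} (hx : IsRegular (expCoord z)) :
    AnalyticAt ℂ (legendreField k m) z := by
  refine analyticAt_pi_iff.2 fun a => ?_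
  refine AnalyticAt.add (AnalyticAt.neg (AnalyticAt.div ((analyticAt_expCoord z a).pow m) ?_ ?_))
    analyticAt_const
  · exact Finset.analyticAt_fun_prod _ fun b _ =>
      (analyticAt_expCoord z a).sub (analyticAt_expCoord z b)
  · exact Finset.prod_ne_zero_iff.2 fun b hb => hx.sub_ne (Finset.ne_of_mem_erase hb).symm

theorem analyticAt_twistedField (z : Fin (k + m) → ℂ) : AnalyticAt ℂ (twistedField k m) z := by
  refine analyticAt_pi_iff.2 fun a => ?_
  have h : AnalyticAt ℂ (fun z : Fin (k + m) → ℂ => ∑ b, expCoord z b) z :=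
    Finset.analyticAt_fun_sum _ fun b _ => analyticAt_expCoord z b
  exact (((analyticAt_expCoord z a).sub (h.div_const (c := (k : ℂ)))).div_const (c := (k : ℂ)))

/-- The polynomial identity that underlies `∂_κ`. -/
theorem sum_legendreField_nodal (hk : 0 < k) (hm : 0 < m) {z : Fin (k + m) → ℂ}
    (hx : IsRegular (expCoord z)) :
    ∑ a, C (legendreField k m z a * expCoord z a)
        * Lagrange.nodal (Finset.univ.erase a) (expCoord z)
      = -X ^ (m + 1) + C (if k = 1 then (1 : ℂ) else 0) * critPoly (expCoord z) := by
  have hcard : (Finset.univ : Finset (Fin (k + m))).card = k + m := by simp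
  refine Polynomial.eq_of_degrees_lt_of_eval_index_eq (v := expCoord z) Finset.univ
    hx.inj.injOn ?_ ?_ fun c _ => ?_
  · rw [hcard]
    refine (degree_sum_le _ _).trans_lt ((Finset.sup_lt_iff (WithBot.bot_lt_coe _)).2 fun a _ => ?_)
    refine ((degree_mul_le_of_le degree_C_le le_rfl).trans_eq (zero_add _)).trans_lt ?_
    rw [Lagrange.degree_nodal, Finset.card_erase_of_mem (Finset.mem_univ a), hcard]
    exact_mod_cast (by omega : k + m - 1 < k + m)
  · rw [hcard, degree_lt_iff_coeff_zero]
    intro j hj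
    rw [coeff_add, coeff_neg, coeff_X_pow, coeff_C_mul]
    by_cases hk1 : k = 1
    · rw [if_pos hk1]
      rcases hj.eq_or_lt with h | h
      · rw [← h, coeff_critPoly hm, if_pos (by omega), hk1]
        simp
      · rw [if_neg (by omega), coeff_eq_zero_of_natDegree_lt
          (by rw [natDegree_critPoly hk hm]; exact h)]
        simp
    · rw [if_neg hk1, if_neg (by omega)]
      simp
  · rw [eval_finsetSum, Finset.sum_eq_single c (fun b _ hbc => by
      rw [eval_mul, Lagrange.eval_nodal_at_node (Finset.mem_erase.2 ⟨hbc.symm, Finset.mem_univ c⟩),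
        mul_zero]) (fun h => absurd (Finset.mem_univ c) h)]
    have h := hx.eval_erase_ne c
    simp only [eval_add, eval_neg, eval_mul, eval_C, eval_pow, eval_X, critPoly_eval_node,
      legendreField, Lagrange.eval_nodal] at h ⊢
    field_simp
    ring

/-- `∂_κ λ = i u - h λ'`, with `h = 1` for `k = 1` and `h = 0` otherwise. -/
theorem sum_legendreField_ratio (hk : 0 < k) (hm : 0 < m) {z : Fin (k + m) → ℂ}
    (hx : IsRegular (expCoord z)) {u : ℂ} (hu0 : u ≠ 0) (hu : ∀ a, u ≠ expCoord z a) :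
    expLam (expCoord z) u * ∑ a, legendreField k m z a * ratio (expCoord z) u a
      = -u + (if k = 1 then 1 else 0) * expLam (expCoord z) u
        * (k + ∑ a, ratio (expCoord z) u a) := by
  have h := congrArg (fun p => p.eval u) (sum_legendreField_nodal hk hm hx)
  simp only [eval_finsetSum, eval_add, eval_neg, eval_mul, eval_C, eval_pow, eval_X,
    eval_critPoly _ hu] at h
  have h2 : ∑ a, legendreField k m z a * expCoord z a *
      (Lagrange.nodal (Finset.univ.erase a) (expCoord z)).eval u
      = (nodePoly (expCoord z)).eval u * ∑ a, legendreField k m z a * ratio (expCoord z) u a := by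
    rw [Finset.mul_sum]
    refine Finset.sum_congr rfl fun a _ => ?_
    have := sub_ne_zero.2 (hu a)
    rw [nodePoly_eq _ a, eval_mul, eval_sub, eval_X, eval_C, ratio]
    field_simp
  rw [h2] at h
  rw [expLam, div_mul_eq_mul_div, h]
  field_simp
  ring

section Regular

variable {z : Fin (k + m) → ℂ}

theorem comp_legendreField (hk : 0 < k) (hm : 0 < m) (hx : IsRegular (expCoord z)) {u : ℂ}
    (hu : u ∈ critRoots (expCoord z)) :
    (trigData k m).comp z trigPt (legendreField k m z) u = Complex.I * u := by
  have hu' := (mem_critRoots hk hm).1 hu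
  rw [trig_comp hk hm hx _ hu, mul_assoc, sum_legendreField_ratio hk hm hx
    (hx.root_ne_zero hm hu') (hx.root_ne_node hu'), hx.sum_ratio hu']
  ring

theorem comp_twistedField (hk : 0 < k) (hm : 0 < m) (hx : IsRegular (expCoord z)) {u : ℂ}
    (hu : u ∈ critRoots (expCoord z)) :
    (trigData k m).comp z trigPt (twistedField k m z) u
      = Complex.I * u * expLam (expCoord z) u := by
  have hu' := (mem_critRoots hk hm).1 hu
  have hk' : (k : ℂ) ≠ 0 := by exact_mod_cast hk.ne'
  -- `x_a r_a = u r_a - x_a`, so the sum reduces to `∑ r_a = -k`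
  have h : ∑ a, twistedField k m z a * ratio (expCoord z) u a = -u := by
    have h1 : ∀ a, twistedField k m z a * ratio (expCoord z) u a
        = (u - (∑ b, expCoord z b) / k) / k * ratio (expCoord z) u a - expCoord z a / k := by
      intro a
      have := sub_ne_zero.2 (hx.root_ne_node hu' a)
      change (expCoord z a - (∑ b, expCoord z b) / k) / k * ratio (expCoord z) u a = _
      rw [ratio]
      field_simp
      ring
    rw [Finset.sum_congr rfl fun a _ => h1 a, Finset.sum_sub_distrib, ← Finset.mul_sum,
      hx.sum_ratio hu', ← Finset.sum_div]
    field_simp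
    ring
  rw [trig_comp hk hm hx _ hu, h]
  ring

theorem var_legendreField (hk : 0 < k) (hm : 0 < m) (hx : IsRegular (expCoord z)) {v : ℂ}
    (hv : v ∈ (trigData k m).crit z) :
    (trigData k m).var z (legendreField k m z) v
      = Complex.I * Complex.exp (Complex.I * v) := by
  obtain ⟨u, hu, rfl⟩ := (trig_frame hk hm hx).bij.surjOn hv
  rw [hx.exp_trigPt hk hm hu, ← comp_apply, comp_legendreField hk hm hx hu]

theorem comp_trigEuler (hk : 0 < k) (hm : 0 < m) (hx : IsRegular (expCoord z)) {u : ℂ}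
    (hu : u ∈ critRoots (expCoord z)) :
    (trigData k m).comp z trigPt (trigEuler k m z) u = expLam (expCoord z) u := by
  rw [comp_apply, trig_isEulerAt hk hm hx _ ((trig_frame hk hm hx).bij.mapsTo hu),
    trig_lam_pt hk hm hx hu]

theorem legendre_mul (hk : 0 < k) (hm : 0 < m) (hx : IsRegular (expCoord z))
    (X Y : Fin (k + m) → ℂ) :
    fderiv ℂ (coordChange k m) z ((trigData k m).circ z X Y)
      = (ratData k m).circ (coordChange k m z) (fderiv ℂ (coordChange k m) z X)
        (fderiv ℂ (coordChange k m) z Y) :=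
  (rat_frame hk hm hx).ext_comp fun u hu => by
    rw [rat_comp_fderiv hk hm hx _ hu, (trig_frame hk hm hx).comp_circ _ _ hu,
      (rat_frame hk hm hx).comp_circ _ _ hu, rat_comp_fderiv hk hm hx _ hu,
      rat_comp_fderiv hk hm hx _ hu]

theorem legendre_metric (hk : 0 < k) (hm : 0 < m) (hx : IsRegular (expCoord z))
    (X Y : Fin (k + m) → ℂ) :
    (ratData k m).eta (coordChange k m z) (fderiv ℂ (coordChange k m) z X)
        (fderiv ℂ (coordChange k m) z Y)
      = (trigData k m).eta z ((trigData k m).circ z (legendreField k m z) (legendreField k m z))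
        ((trigData k m).circ z X Y) := by
  rw [(rat_frame hk hm hx).eta_eq, (trig_frame hk hm hx).eta_eq]
  refine Finset.sum_congr rfl fun u hu => ?_
  have hu' := (mem_critRoots hk hm).1 hu
  have hu0 := hx.root_ne_zero hm hu'
  have h1 := hx.expLam_ne_zero hm hu'
  have h2 := hx.hess_root_ne_zero hm hu'
  rw [rat_comp_fderiv hk hm hx _ hu, rat_comp_fderiv hk hm hx _ hu,
    (trig_frame hk hm hx).comp_circ _ _ hu, (trig_frame hk hm hx).comp_circ _ _ hu,
    comp_legendreField hk hm hx hu, rat_hess_pt hk hm hx hu, trig_hess_pt hk hm hx hu,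
    show Complex.I * u * (Complex.I * u) = -u ^ 2 by linear_combination u ^ 2 * Complex.I_sq]
  field_simp

theorem twisted_generator (hk : 0 < k) (hm : 0 < m) (hx : IsRegular (expCoord z)) :
    twistedField k m z = (trigData k m).circ z (trigEuler k m z) (legendreField k m z) :=
  (trig_frame hk hm hx).ext_comp fun u hu => by
    rw [(trig_frame hk hm hx).comp_circ _ _ hu, comp_twistedField hk hm hx hu,
      comp_trigEuler hk hm hx hu, comp_legendreField hk hm hx hu]
    ring

theorem twisted_mul (hk : 0 < k) (hm : 0 < m) (hx : IsRegular (expCoord z))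
    (X Y : Fin (k + m) → ℂ) :
    fderiv ℂ (coordChange k m) z ((trigData k m).star z X Y)
      = (ratData k m).star (coordChange k m z) (fderiv ℂ (coordChange k m) z X)
        (fderiv ℂ (coordChange k m) z Y) :=
  (rat_frame hk hm hx).ext_comp fun u hu => by
    rw [rat_comp_fderiv hk hm hx _ hu, (trig_frame hk hm hx).comp_star _ _ hu,
      (rat_frame hk hm hx).comp_star _ _ hu, rat_comp_fderiv hk hm hx _ hu,
      rat_comp_fderiv hk hm hx _ hu, trig_lam_pt hk hm hx hu, rat_lam_pt hk hm]

theorem twisted_metric (hk : 0 < k) (hm : 0 < m) (hx : IsRegular (expCoord z))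
    (X Y : Fin (k + m) → ℂ) :
    (ratData k m).dualEta (coordChange k m z) (fderiv ℂ (coordChange k m) z X)
        (fderiv ℂ (coordChange k m) z Y)
      = (trigData k m).dualEta z
        ((trigData k m).star z (twistedField k m z) (twistedField k m z))
        ((trigData k m).star z X Y) := by
  rw [(rat_frame hk hm hx).dualEta_eq, (trig_frame hk hm hx).dualEta_eq]
  refine Finset.sum_congr rfl fun u hu => ?_
  have hu' := (mem_critRoots hk hm).1 hu
  have hu0 := hx.root_ne_zero hm hu'
  have h1 := hx.expLam_ne_zero hm hu'
  have h2 := hx.hess_root_ne_zero hm hu'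
  rw [rat_comp_fderiv hk hm hx _ hu, rat_comp_fderiv hk hm hx _ hu,
    (trig_frame hk hm hx).comp_star _ _ hu, (trig_frame hk hm hx).comp_star _ _ hu,
    comp_twistedField hk hm hx hu, rat_hess_pt hk hm hx hu, trig_hess_pt hk hm hx hu,
    trig_lam_pt hk hm hx hu, rat_lam_pt hk hm,
    show Complex.I * u * expLam (expCoord z) u * (Complex.I * u * expLam (expCoord z) u)
      = -(u ^ 2 * expLam (expCoord z) u ^ 2) by
        linear_combination u ^ 2 * expLam (expCoord z) u ^ 2 * Complex.I_sq]
  field_simp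

theorem twisted_frame (hk : 0 < k) (hm : 0 < m) (hx : IsRegular (expCoord z))
    (a : Fin (k + m)) :
    fderiv ℂ (coordChange k m) z (Pi.single a 1)
      = (ratData k m).star (coordChange k m z)
        (fderiv ℂ (coordChange k m) z (twistedField k m z)) (Pi.single a 1) :=
  (rat_frame hk hm hx).ext_comp fun u hu => by
    have hu' := (mem_critRoots hk hm).1 hu
    have hu0 := hx.root_ne_zero hm hu'
    have h1 := hx.expLam_ne_zero hm hu'
    rw [rat_comp_fderiv hk hm hx _ hu, (rat_frame hk hm hx).comp_star _ _ hu,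
      rat_comp_fderiv hk hm hx _ hu, comp_twistedField hk hm hx hu, rat_lam_pt hk hm,
      trig_comp_single hk hm hx a hu, rat_comp_single hk hm hx a hu]
    field_simp

theorem twisted_coord (hk : 0 < k) (hm : 0 < m) (hx : IsRegular (expCoord z))
    (a : Fin (k + m)) (X : Fin (k + m) → ℂ) :
    ∑ b, gram ((ratData k m).dualEta (coordChange k m z)) a b
        * fderiv ℂ (coordChange k m) z X b
      = (trigData k m).dualEta z
        ((trigData k m).star z (twistedField k m z) (Pi.single a 1)) X := by
  have h := gram_mulVec_of_frame (rat_frame hk hm hx).dualEta_eq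
    (fderiv ℂ (coordChange k m) z X) a
  rw [Matrix.mulVec, dotProduct] at h
  rw [h, (rat_frame hk hm hx).dualEta_eq, (trig_frame hk hm hx).dualEta_eq]
  refine Finset.sum_congr rfl fun u hu => ?_
  have hu' := (mem_critRoots hk hm).1 hu
  have hu0 := hx.root_ne_zero hm hu'
  have h1 := hx.expLam_ne_zero hm hu'
  have h2 := hx.hess_root_ne_zero hm hu'
  rw [rat_comp_fderiv hk hm hx _ hu, rat_comp_single hk hm hx a hu,
    (trig_frame hk hm hx).comp_star _ _ hu, trig_comp_single hk hm hx a hu,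
    comp_twistedField hk hm hx hu, rat_hess_pt hk hm hx hu, trig_hess_pt hk hm hx hu,
    trig_lam_pt hk hm hx hu, rat_lam_pt hk hm]
  field_simp
  linear_combination -(ratio (expCoord z) u a * (trigData k m).comp z trigPt X u) * Complex.I_sq

end Regular

end Generators

end HurwitzLegendre

namespace HurwitzLegendre

/-! ### Variation of the critical points -/

section Variation

open Polynomial

variable {k m : ℕ}

section Curve

variable {x : ℂ → Fin (k + m) → ℂ} {w : ℂ → ℂ} {e : Fin (k + m) → ℂ}

/-- Derivative of `r_a` along a curve of parameters and points, in terms of `w' / w`. -/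
theorem hasDerivAt_ratio_curve {w' : ℂ} (hx : ∀ a, HasDerivAt (fun t => x t a)
    (Complex.I * x 0 a * e a) 0) (hw : HasDerivAt w w' 0) (h0 : w 0 ≠ 0) {a : Fin (k + m)}
    (ha : w 0 ≠ x 0 a) :
    HasDerivAt (fun t => ratio (x t) (w t) a)
      (ratioD (x 0) (w 0) a * (Complex.I * e a - w' / w 0)) 0 := by
  have h := sub_ne_zero.2 ha
  refine ((hx a).fun_div (hw.fun_sub (hx a)) h).congr_deriv ?_
  rw [ratioD, ratio]
  field_simp
  ring

/-- The critical points move with velocity `w' / w = i ∑ ρ_a e_a / ∑ ρ_a`. -/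
theorem hasDerivAt_root_curve (hm : 0 < m) (hx : ∀ a, HasDerivAt (fun t => x t a)
    (Complex.I * x 0 a * e a) 0) (hw : DifferentiableAt ℂ w 0)
    (hreg : IsRegular (x 0)) (hcrit : ∀ᶠ t in 𝓝 0, (critPoly (x t)).eval (w t) = 0) :
    HasDerivAt w (w 0 * (Complex.I * (∑ a, ratioD (x 0) (w 0) a * e a) / hess (x 0) (w 0))) 0 := by
  have hu := hcrit.self_of_nhds
  have h0 := hreg.root_ne_zero hm hu
  have hN := hreg.hess_root_ne_zero hm hu
  have hne : ∀ᶠ t in 𝓝 (0 : ℂ), ∀ a, w t ≠ x t a := eventually_all.2 fun a => by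
    have hc : ContinuousAt (fun t => w t - x t a) 0 :=
      hw.continuousAt.sub (hx a).continuousAt
    filter_upwards [hc.eventually_ne (sub_ne_zero.2 (hreg.root_ne_node hu a))] with t ht
      using sub_ne_zero.1 ht
  have hsum : ∀ᶠ t in 𝓝 (0 : ℂ), ∑ a, ratio (x t) (w t) a = -k := by
    filter_upwards [hcrit, hne] with t ht hnt
    have h := eval_critPoly (x t) hnt
    rw [ht] at h
    have h1 : (nodePoly (x t)).eval (w t) ≠ 0 := by
      rw [eval_nodePoly, Finset.prod_ne_zero_iff]
      exact fun a _ => sub_ne_zero.2 (hnt a)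
    linear_combination (mul_eq_zero.1 h.symm).resolve_right h1
  have h1 := HasDerivAt.fun_sum (u := Finset.univ) fun a _ =>
    hasDerivAt_ratio_curve hx hw.hasDerivAt h0 (hreg.root_ne_node hu a)
  have h2 := h1.unique ((hasDerivAt_const (0 : ℂ) (-k : ℂ)).congr_of_eventuallyEq hsum)
  simp only [mul_sub, Finset.sum_sub_distrib] at h2
  rw [← Finset.sum_mul, ← hess] at h2
  have h3 : Complex.I * ∑ a, ratioD (x 0) (w 0) a * e a = hess (x 0) (w 0) * (deriv w 0 / w 0) := by
    rw [Finset.mul_sum, Finset.sum_congr rfl fun a _ => mul_left_comm Complex.I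
      (ratioD (x 0) (w 0) a) (e a)]
    linear_combination h2
  refine hw.hasDerivAt.congr_deriv ?_
  rw [h3]
  field_simp

theorem hasDerivAt_ratio_root (hm : 0 < m) (hx : ∀ a, HasDerivAt (fun t => x t a)
    (Complex.I * x 0 a * e a) 0) (hw : DifferentiableAt ℂ w 0)
    (hreg : IsRegular (x 0)) (hcrit : ∀ᶠ t in 𝓝 0, (critPoly (x t)).eval (w t) = 0)
    (a : Fin (k + m)) :
    HasDerivAt (fun t => ratio (x t) (w t) a) (Complex.I * ratioD (x 0) (w 0) a
      * (e a - (∑ b, ratioD (x 0) (w 0) b * e b) / hess (x 0) (w 0))) 0 := by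
  have hu := hcrit.self_of_nhds
  have h0 := hreg.root_ne_zero hm hu
  refine (hasDerivAt_ratio_curve hx (hasDerivAt_root_curve hm hx hw hreg hcrit) h0
    (hreg.root_ne_node hu a)).congr_deriv ?_
  field_simp

theorem hasDerivAt_hess_root (hm : 0 < m) (hx : ∀ a, HasDerivAt (fun t => x t a)
    (Complex.I * x 0 a * e a) 0) (hw : DifferentiableAt ℂ w 0)
    (hreg : IsRegular (x 0)) (hcrit : ∀ᶠ t in 𝓝 0, (critPoly (x t)).eval (w t) = 0) :
    HasDerivAt (fun t => hess (x t) (w t))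
      (Complex.I * ((∑ b, (1 + 2 * ratio (x 0) (w 0) b) * ratioD (x 0) (w 0) b * e b)
        - third (x 0) (w 0) * (∑ b, ratioD (x 0) (w 0) b * e b) / hess (x 0) (w 0))) 0 := by
  have h1 := fun a => hasDerivAt_ratio_root hm hx hw hreg hcrit a
  have h2 := HasDerivAt.fun_sum (u := Finset.univ) fun a _ => (h1 a).fun_mul ((h1 a).const_add 1)
  refine h2.congr_deriv ?_
  rw [mul_div_assoc]
  generalize (∑ b, ratioD (x 0) (w 0) b * e b) / hess (x 0) (w 0) = K
  rw [third, Finset.sum_mul, ← Finset.sum_sub_distrib, Finset.mul_sum]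
  exact Finset.sum_congr rfl fun a _ => by ring

/-- The critical values: as `λ' = 0`, only the explicit dependence on the parameters counts. -/
theorem hasDerivAt_expLam_root (hm : 0 < m) (hx : ∀ a, HasDerivAt (fun t => x t a)
    (Complex.I * x 0 a * e a) 0) (hw : DifferentiableAt ℂ w 0)
    (hreg : IsRegular (x 0)) (hcrit : ∀ᶠ t in 𝓝 0, (critPoly (x t)).eval (w t) = 0) :
    HasDerivAt (fun t => expLam (x t) (w t))
      (-(Complex.I * expLam (x 0) (w 0) * ∑ b, ratio (x 0) (w 0) b * e b)) 0 := by
  have hu := hcrit.self_of_nhds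
  have h0 := hreg.root_ne_zero hm hu
  have hw' := hw.hasDerivAt
  have h1 := HasDerivAt.fun_finsetProd (u := Finset.univ) fun a _ => hw'.fun_sub (hx a)
  have h2 := h1.fun_div (hw'.fun_pow m) (pow_ne_zero m h0)
  have h3 : (fun t => expLam (x t) (w t)) = fun t => (∏ a, (w t - x t a)) / w t ^ m := by
    funext t
    rw [expLam, eval_nodePoly]
  rw [h3]
  refine h2.congr_deriv ?_
  have h4 : ∀ a, (∏ b ∈ Finset.univ.erase a, (w 0 - x 0 b)) • (deriv w 0 - Complex.I * x 0 a * e a)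
      = (∏ b, (w 0 - x 0 b)) * (deriv w 0 / w 0 * (1 + ratio (x 0) (w 0) a)
        - Complex.I * (ratio (x 0) (w 0) a * e a)) := by
    intro a
    have := sub_ne_zero.2 (hreg.root_ne_node hu a)
    rw [← Finset.mul_prod_erase _ _ (Finset.mem_univ a), ratio, smul_eq_mul]
    field_simp
    ring
  have h5 : w 0 ^ (m - 1) * w 0 = w 0 ^ m := by rw [← pow_succ, Nat.sub_add_cancel hm]
  have h6 : w 0 ^ (m - 1) = w 0 ^ m / w 0 := by rw [eq_div_iff h0, h5]
  rw [Finset.sum_congr rfl fun a _ => h4 a, ← Finset.mul_sum, Finset.sum_sub_distrib,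
    ← Finset.mul_sum, ← Finset.mul_sum, Finset.sum_add_distrib, hreg.sum_ratio hu, expLam,
    eval_nodePoly, h6]
  simp only [Finset.sum_const, Finset.card_univ, Fintype.card_fin, nsmul_eq_mul]
  push_cast
  field_simp
  ring

end Curve

/-- The derivative of `r_a r_b λ / (log λ)''` at a critical point, in the direction `e`. -/
noncomputable def etaTermD (x : Fin (k + m) → ℂ) (u : ℂ) (e : Fin (k + m) → ℂ)
    (a b : Fin (k + m)) : ℂ :=
  Complex.I * expLam x u / hess x u *
    (ratioD x u a * (e a - (∑ c, ratioD x u c * e c) / hess x u) * ratio x u b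
    + ratioD x u b * (e b - (∑ c, ratioD x u c * e c) / hess x u) * ratio x u a
    - ratio x u a * ratio x u b * ∑ c, ratio x u c * e c
    - ratio x u a * ratio x u b / hess x u * ((∑ c, (1 + 2 * ratio x u c) * ratioD x u c * e c)
        - third x u * (∑ c, ratioD x u c * e c) / hess x u))

/-- The derivative of `-u r_b / (log λ)''` at a critical point, in the direction `e`. -/
noncomputable def omegaTermD (x : Fin (k + m) → ℂ) (u : ℂ) (e : Fin (k + m) → ℂ)
    (b : Fin (k + m)) : ℂ :=
  -(Complex.I * u / hess x u *
    ((∑ c, ratioD x u c * e c) / hess x u * ratio x u b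
    + ratioD x u b * (e b - (∑ c, ratioD x u c * e c) / hess x u)
    - ratio x u b / hess x u * ((∑ c, (1 + 2 * ratio x u c) * ratioD x u c * e c)
        - third x u * (∑ c, ratioD x u c * e c) / hess x u)))

theorem hasDerivAt_etaTerm {x : ℂ → Fin (k + m) → ℂ} {w : ℂ → ℂ} {e : Fin (k + m) → ℂ}
    (hm : 0 < m) (hx : ∀ a, HasDerivAt (fun t => x t a)
    (Complex.I * x 0 a * e a) 0) (hw : DifferentiableAt ℂ w 0)
    (hreg : IsRegular (x 0)) (hcrit : ∀ᶠ t in 𝓝 0, (critPoly (x t)).eval (w t) = 0)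
    (a b : Fin (k + m)) :
    HasDerivAt (fun t => ratio (x t) (w t) a * ratio (x t) (w t) b * expLam (x t) (w t)
      / hess (x t) (w t)) (etaTermD (x 0) (w 0) e a b) 0 := by
  have hN := hreg.hess_root_ne_zero hm hcrit.self_of_nhds
  have h1 := fun a => hasDerivAt_ratio_root hm hx hw hreg hcrit a
  have h2 := ((((h1 a).fun_mul (h1 b)).fun_mul
    (hasDerivAt_expLam_root hm hx hw hreg hcrit))).fun_div
    (hasDerivAt_hess_root hm hx hw hreg hcrit) hN
  refine h2.congr_deriv ?_
  rw [etaTermD]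
  field_simp
  ring

theorem hasDerivAt_omegaTerm {x : ℂ → Fin (k + m) → ℂ} {w : ℂ → ℂ} {e : Fin (k + m) → ℂ}
    (hm : 0 < m) (hx : ∀ a, HasDerivAt (fun t => x t a)
    (Complex.I * x 0 a * e a) 0) (hw : DifferentiableAt ℂ w 0)
    (hreg : IsRegular (x 0)) (hcrit : ∀ᶠ t in 𝓝 0, (critPoly (x t)).eval (w t) = 0)
    (b : Fin (k + m)) :
    HasDerivAt (fun t => -(w t * ratio (x t) (w t) b / hess (x t) (w t)))
      (omegaTermD (x 0) (w 0) e b) 0 := by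
  have hN := hreg.hess_root_ne_zero hm hcrit.self_of_nhds
  have h2 := (((hasDerivAt_root_curve hm hx hw hreg hcrit).fun_mul
    (hasDerivAt_ratio_root hm hx hw hreg hcrit b)).fun_div
    (hasDerivAt_hess_root hm hx hw hreg hcrit) hN).fun_neg
  refine h2.congr_deriv ?_
  rw [omegaTermD]
  field_simp

/-- Contraction of the last index of `∂_b η_ac` with a vector. -/
theorem sum_mul_etaTermD (x : Fin (k + m) → ℂ) (u : ℂ) (V : Fin (k + m) → ℂ)
    (a b : Fin (k + m)) :
    ∑ c, V c * etaTermD x u (Pi.single b 1) a c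
      = Complex.I * expLam x u / hess x u *
        (ratioD x u a * ((if a = b then 1 else 0) - ratioD x u b / hess x u)
            * ∑ c, ratio x u c * V c
        + (V b * ratioD x u b - ratioD x u b / hess x u * ∑ c, ratioD x u c * V c) * ratio x u a
        - ratio x u a * ratio x u b * ∑ c, ratio x u c * V c
        - ratio x u a / hess x u * ((1 + 2 * ratio x u b) * ratioD x u b
          - third x u * ratioD x u b / hess x u) * ∑ c, ratio x u c * V c) := by
  have hs : ∀ f : Fin (k + m) → ℂ, ∑ c, f c * (Pi.single b 1 : Fin (k + m) → ℂ) c = f b := by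
    intro f
    simp [Pi.single_apply]
  have hV : V b * ratioD x u b = ∑ c, V c * (ratioD x u c * (if c = b then 1 else 0)) := by simp
  rw [hV]
  simp only [etaTermD, hs]
  simp only [Pi.single_apply, Finset.mul_sum, Finset.sum_mul,
    ← Finset.sum_sub_distrib, ← Finset.sum_add_distrib]
  exact Finset.sum_congr rfl fun c _ => by ring

/-- At each critical point the covariant derivative of `∂_κ` is a residue of
`u r_a r_b (1 - r_a + r_b) / (log λ)'²`. The three hypotheses are the identity
`∂_κ λ = i u - h λ'` and its first two derivatives in `p`, at the critical point. -/
theorem parallel_term (x : Fin (k + m) → ℂ) (u h : ℂ) (V : Fin (k + m) → ℂ)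
    (a b : Fin (k + m)) (hN : hess x u ≠ 0) (hL : expLam x u ≠ 0)
    (h0 : expLam x u * ∑ c, ratio x u c * V c = -u)
    (h1 : expLam x u * ∑ c, ratioD x u c * V c = u + h * expLam x u * hess x u)
    (h2 : expLam x u * ∑ c, (1 + 2 * ratio x u c) * ratioD x u c * V c
      = -(u * (1 + hess x u)) + h * expLam x u * third x u) :
    omegaTermD x u (Pi.single a 1) b + (1 / 2) * (etaTermD x u V a b
        - ∑ c, V c * etaTermD x u (Pi.single b 1) a c
        - ∑ c, V c * etaTermD x u (Pi.single a 1) b c)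
      = -(Complex.I / 2) * (u * ((ratioD x u a * ratio x u b * (1 - ratio x u a + ratio x u b)
        + ratio x u a * ratioD x u b * (1 - ratio x u a + ratio x u b)
        + ratio x u a * ratio x u b * (ratioD x u b - ratioD x u a)) / hess x u ^ 2
        - ratio x u a * ratio x u b * (1 - ratio x u a + ratio x u b)
          * (hess x u + third x u) / hess x u ^ 3)) := by
  have hs : ∀ f : Fin (k + m) → ℂ, ∑ c, f c * (Pi.single a 1 : Fin (k + m) → ℂ) c = f a := by
    intro f
    simp [Pi.single_apply]
  rw [sum_mul_etaTermD, sum_mul_etaTermD, omegaTermD, etaTermD]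
  simp only [hs]
  simp only [Pi.single_apply]
  generalize ∑ c, ratio x u c * V c = s0 at *
  generalize ∑ c, ratioD x u c * V c = s1 at *
  generalize ∑ c, (1 + 2 * ratio x u c) * ratioD x u c * V c = s2 at *
  obtain rfl : s0 = -u / expLam x u := by rw [eq_div_iff hL, ← h0, mul_comm]
  obtain rfl : s1 = (u + h * expLam x u * hess x u) / expLam x u := by
    rw [eq_div_iff hL, ← h1, mul_comm]
  obtain rfl : s2 = (-(u * (1 + hess x u)) + h * expLam x u * third x u) / expLam x u := by
    rw [eq_div_iff hL, ← h2, mul_comm]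
  by_cases hab : a = b
  · subst hab
    simp only [if_true, ratioD]
    field_simp
    ring
  · rw [if_neg hab, if_neg (Ne.symm hab)]
    simp only [ratioD]
    field_simp
    ring

/-- The residues of `u r_a r_b (1 - r_a + r_b) / (log λ)'²` add up to zero. -/
theorem sum_parallel_residue (hk : 0 < k) (hm : 0 < m) {x : Fin (k + m) → ℂ} (hx : IsRegular x)
    (a b : Fin (k + m)) :
    ∑ u ∈ critRoots x, u * ((ratioD x u a * ratio x u b * (1 - ratio x u a + ratio x u b)
        + ratio x u a * ratioD x u b * (1 - ratio x u a + ratio x u b)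
        + ratio x u a * ratio x u b * (ratioD x u b - ratioD x u a)) / hess x u ^ 2
        - ratio x u a * ratio x u b * (1 - ratio x u a + ratio x u b)
          * (hess x u + third x u) / hess x u ^ 3) = 0 := by
  by_cases hab : a = b
  · subst hab
    rw [← hx.sum_double_residue hk hm a a]
    exact Finset.sum_congr rfl fun u _ => by ring
  -- by partial fractions, `r_a r_b (1 - r_a + r_b)` is a combination of products of two `r`
  have h3 := hx.sub_ne hab
  have hcomb : ∀ u ∈ critRoots x,
      u * ((ratioD x u a * ratio x u b * (1 - ratio x u a + ratio x u b)
        + ratio x u a * ratioD x u b * (1 - ratio x u a + ratio x u b)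
        + ratio x u a * ratio x u b * (ratioD x u b - ratioD x u a)) / hess x u ^ 2
        - ratio x u a * ratio x u b * (1 - ratio x u a + ratio x u b)
          * (hess x u + third x u) / hess x u ^ 3)
      = 2 * x a / (x a - x b) * (u * ((ratioD x u a * ratio x u b + ratio x u a * ratioD x u b)
          / hess x u ^ 2 - ratio x u a * ratio x u b * (hess x u + third x u) / hess x u ^ 3))
        - x b / (x a - x b) * (u * ((ratioD x u a * ratio x u a + ratio x u a * ratioD x u a)
          / hess x u ^ 2 - ratio x u a * ratio x u a * (hess x u + third x u) / hess x u ^ 3))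
        - x a / (x a - x b) * (u * ((ratioD x u b * ratio x u b + ratio x u b * ratioD x u b)
          / hess x u ^ 2 - ratio x u b * ratio x u b * (hess x u + third x u)
          / hess x u ^ 3)) := by
    intro u hu
    have hu' := hx.root_ne_node ((mem_critRoots hk hm).1 hu)
    have ha := sub_ne_zero.2 (hu' a)
    have hb := sub_ne_zero.2 (hu' b)
    have h1 : ratio x u a * ratio x u b * (1 - ratio x u a + ratio x u b)
        = (2 * x a * (ratio x u a * ratio x u b) - x b * (ratio x u a * ratio x u a)
          - x a * (ratio x u b * ratio x u b)) / (x a - x b) := by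
      simp only [ratio]
      field_simp
      ring
    have h2 : ratioD x u a * ratio x u b * (1 - ratio x u a + ratio x u b)
        + ratio x u a * ratioD x u b * (1 - ratio x u a + ratio x u b)
        + ratio x u a * ratio x u b * (ratioD x u b - ratioD x u a)
        = (2 * x a * (ratioD x u a * ratio x u b + ratio x u a * ratioD x u b)
          - x b * (ratioD x u a * ratio x u a + ratio x u a * ratioD x u a)
          - x a * (ratioD x u b * ratio x u b + ratio x u b * ratioD x u b)) / (x a - x b) := by
      simp only [ratioD, ratio]
      field_simp
      ring
    rw [h1, h2]
    ring
  rw [Finset.sum_congr rfl hcomb, Finset.sum_sub_distrib, Finset.sum_sub_distrib,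
    ← Finset.mul_sum, ← Finset.mul_sum, ← Finset.mul_sum, hx.sum_double_residue hk hm a b,
    hx.sum_double_residue hk hm a a, hx.sum_double_residue hk hm b b]
  ring

end Variation

end HurwitzLegendre

namespace HurwitzLegendre

/-! ### Branches of the critical points -/

section Branches

open Polynomial HurwitzData

variable {k m : ℕ}

theorem contDiff_eval_critPoly :
    ContDiff ℂ 1 fun y : (Fin (k + m) → ℂ) × ℂ => (critPoly (expCoord y.1)).eval y.2 := by
  have h1 : ∀ a : Fin (k + m), ContDiff ℂ 1
      fun y : (Fin (k + m) → ℂ) × ℂ => y.2 - expCoord y.1 a := fun a => by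
    unfold expCoord
    fun_prop
  have h2 : (fun y : (Fin (k + m) → ℂ) × ℂ => (critPoly (expCoord y.1)).eval y.2) = fun y =>
      y.2 * ∑ a, ∏ b ∈ Finset.univ.erase a, (y.2 - expCoord y.1 b)
        - m * ∏ a, (y.2 - expCoord y.1 a) := by
    funext y
    rw [critPoly, eval_sub, eval_mul, eval_mul, eval_X, eval_C, eval_nodePoly, nodePoly,
      Lagrange.derivative_nodal, eval_finsetSum]
    simp only [Lagrange.eval_nodal]
  rw [h2]
  exact (contDiff_snd.mul (ContDiff.sum fun a _ => contDiff_prod fun b _ => h1 b)).sub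
    (contDiff_const.mul (contDiff_prod fun a _ => h1 a))

theorem fderiv_eval_critPoly (z : Fin (k + m) → ℂ) (u : ℂ) :
    fderiv ℂ (fun y : (Fin (k + m) → ℂ) × ℂ => (critPoly (expCoord y.1)).eval y.2) (z, u) (0, 1)
      = (derivative (critPoly (expCoord z))).eval u := by
  have h1 := (contDiff_eval_critPoly (k := k) (m := m)).differentiable one_ne_zero (z, u)
  have h2 : HasDerivAt (fun v : ℂ => (z, v)) ((0 : Fin (k + m) → ℂ), (1 : ℂ)) u :=
    (hasDerivAt_const u z).prodMk (hasDerivAt_id u)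
  exact (h1.hasFDerivAt.comp_hasDerivAt u h2).unique ((critPoly (expCoord z)).hasDerivAt u)

/-- A simple critical point extends to a branch of critical points. -/
theorem exists_root_branch {z : Fin (k + m) → ℂ} {u : ℂ}
    (hu : (critPoly (expCoord z)).eval u = 0)
    (hd : (derivative (critPoly (expCoord z))).eval u ≠ 0) :
    ∃ ψ : (Fin (k + m) → ℂ) → ℂ, ψ z = u ∧ DifferentiableAt ℂ ψ z ∧
      ∀ᶠ y in 𝓝 z, (critPoly (expCoord y)).eval (ψ y) = 0 := by
  have hf := (contDiff_eval_critPoly (k := k) (m := m)).contDiffAt (x := (z, u))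
    |>.hasStrictFDerivAt one_ne_zero
  set f' := fderiv ℂ (fun y : (Fin (k + m) → ℂ) × ℂ => (critPoly (expCoord y.1)).eval y.2) (z, u)
    with hf'
  have hinv : (f' ∘L .inr ℂ (Fin (k + m) → ℂ) ℂ).IsInvertible := by
    refine ⟨ContinuousLinearEquiv.smulLeft (Units.mk0 _ hd), ContinuousLinearMap.ext_ring ?_⟩
    have h := fderiv_eval_critPoly z u
    rw [← hf'] at h
    simpa using h.symm
  refine ⟨hf.implicitFunctionOfProdDomain hinv, ?_,
    (hf.hasStrictFDerivAt_implicitFunctionOfProdDomain hinv).hasFDerivAt.differentiableAt, ?_⟩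
  · exact (hf.eventually_apply_eq_iff_implicitFunctionOfProdDomain hinv).self_of_nhds.1 rfl
  · filter_upwards [hf.eventually_apply_implicitFunctionOfProdDomain hinv] with y hy
    exact hy.trans hu

/-- Near a regular point all critical points are given by branches, and all points are regular. -/
theorem exists_root_branches (hk : 0 < k) (hm : 0 < m) {z : Fin (k + m) → ℂ}
    (hx : IsRegular (expCoord z)) :
    ∃ ψ : ℂ → (Fin (k + m) → ℂ) → ℂ,
      (∀ u ∈ critRoots (expCoord z), ψ u z = u ∧ DifferentiableAt ℂ (ψ u) z ∧
        ∀ᶠ y in 𝓝 z, (critPoly (expCoord y)).eval (ψ u y) = 0) ∧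
      ∀ᶠ y in 𝓝 z, IsRegular (expCoord y) ∧ ∀ f : ℂ → ℂ,
        ∑ v ∈ critRoots (expCoord y), f v = ∑ u ∈ critRoots (expCoord z), f (ψ u y) := by
  have hex : ∀ u, ∃ ψ : (Fin (k + m) → ℂ) → ℂ, u ∈ critRoots (expCoord z) →
      ψ z = u ∧ DifferentiableAt ℂ ψ z ∧
        ∀ᶠ y in 𝓝 z, (critPoly (expCoord y)).eval (ψ y) = 0 := by
    intro u
    by_cases hu : u ∈ critRoots (expCoord z)
    · have hu' := (mem_critRoots hk hm).1 hu
      obtain ⟨ψ, h⟩ := exists_root_branch hu' (hx.simple u hu')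
      exact ⟨ψ, fun _ => h⟩
    · exact ⟨0, fun h => absurd h hu⟩
  choose ψ hψ using hex
  refine ⟨ψ, hψ, ?_⟩
  have hroot : ∀ᶠ y in 𝓝 z, ∀ u ∈ critRoots (expCoord z),
      (critPoly (expCoord y)).eval (ψ u y) = 0 :=
    (eventually_all_finset _).2 fun u hu => (hψ u hu).2.2
  have hsimple : ∀ᶠ y in 𝓝 z, ∀ u ∈ critRoots (expCoord z),
      (derivative (critPoly (expCoord y))).eval (ψ u y) ≠ 0 := by
    refine (eventually_all_finset _).2 fun u hu => ?_
    obtain ⟨h1, h2, -⟩ := hψ u hu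
    have hc : ContinuousAt (fun y => (derivative (critPoly (expCoord y))).eval (ψ u y)) z := by
      simp only [← fderiv_eval_critPoly]
      have h3 : Continuous fun y : (Fin (k + m) → ℂ) × ℂ => fderiv ℂ (fun y :
          (Fin (k + m) → ℂ) × ℂ => (critPoly (expCoord y.1)).eval y.2) y (0, 1) :=
        (contDiff_eval_critPoly.continuous_fderiv one_ne_zero).clm_apply continuous_const
      exact ContinuousAt.comp (f := fun y => (y, ψ u y)) h3.continuousAt
        (continuousAt_id.prodMk h2.continuousAt)
    refine hc.eventually_ne ?_
    rw [h1]
    exact hx.simple u ((mem_critRoots hk hm).1 hu)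
  have hinj : ∀ᶠ y in 𝓝 z, ∀ u ∈ critRoots (expCoord z), ∀ v ∈ critRoots (expCoord z),
      u ≠ v → ψ u y - ψ v y ≠ 0 := by
    refine (eventually_all_finset _).2 fun u hu => (eventually_all_finset _).2 fun v hv => ?_
    by_cases huv : u = v
    · exact Eventually.of_forall fun y h => absurd huv h
    · have hc := (hψ u hu).2.1.continuousAt.sub (hψ v hv).2.1.continuousAt
      refine (hc.eventually_ne ?_).mono fun y hy _ => hy
      rw [Pi.sub_apply, (hψ u hu).1, (hψ v hv).1]
      exact sub_ne_zero.2 huv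
  have hnode : ∀ᶠ y in 𝓝 z, ∀ a b, a ≠ b → expCoord y a - expCoord y b ≠ 0 := by
    refine eventually_all.2 fun a => eventually_all.2 fun b => ?_
    by_cases hab : a = b
    · exact Eventually.of_forall fun y h => absurd hab h
    · have hc := (analyticAt_expCoord z a).continuousAt.sub (analyticAt_expCoord z b).continuousAt
      exact (hc.eventually_ne (hx.sub_ne hab)).mono fun y hy _ => hy
  filter_upwards [hroot, hsimple, hinj, hnode] with y h1 h2 h3 h4
  have hio : Set.InjOn (fun u => ψ u y) (critRoots (expCoord z)) := fun u hu v hv huv => by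
    by_contra h
    exact h3 u hu v hv h (sub_eq_zero.2 huv)
  have himg : (critRoots (expCoord z)).image (fun u => ψ u y) = critRoots (expCoord y) := by
    refine Finset.eq_of_subset_of_card_le ?_ ?_
    · intro v hv
      obtain ⟨u, hu, rfl⟩ := Finset.mem_image.1 hv
      exact (mem_critRoots hk hm).2 (h1 u hu)
    · rw [Finset.card_image_of_injOn hio, hx.card_critRoots hk hm]
      exact ((Multiset.toFinset_card_le _).trans (card_roots' _)).trans_eq
        (natDegree_critPoly hk hm _)
  refine ⟨⟨expCoord_ne_zero y, fun a b hab => ?_, fun v hv => ?_⟩, fun f => ?_⟩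
  · by_contra h
    exact h4 a b h (sub_eq_zero.2 hab)
  · rw [← mem_critRoots hk hm, ← himg] at hv
    obtain ⟨u, hu, rfl⟩ := Finset.mem_image.1 hv
    exact h2 u hu
  · rw [← himg, Finset.sum_image hio]

theorem eventually_isRegular (hk : 0 < k) (hm : 0 < m) {z : Fin (k + m) → ℂ}
    (hx : IsRegular (expCoord z)) : ∀ᶠ y in 𝓝 z, IsRegular (expCoord y) :=
  let ⟨_, _, h⟩ := exists_root_branches hk hm hx
  h.mono fun _ hy => hy.1

end Branches

end HurwitzLegendre

namespace HurwitzLegendre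

/-! ### Flatness of `∂_κ` -/

section Flat

open Polynomial HurwitzData

variable {k m : ℕ} {z : Fin (k + m) → ℂ}

theorem hasDerivAt_expCoord_line (z e : Fin (k + m) → ℂ) (a : Fin (k + m)) :
    HasDerivAt (fun t : ℂ => expCoord (z + t • e) a)
      (Complex.I * expCoord (z + (0 : ℂ) • e) a * e a) 0 := by
  have h : HasDerivAt (fun t : ℂ => (z + t • e) a) (e a) 0 := by
    simpa using ((hasDerivAt_id (0 : ℂ)).mul_const (e a)).const_add (z a)
  exact (hasDerivAt_exp_I _).comp (0 : ℂ) h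

theorem hasDerivAt_line (z e : Fin (k + m) → ℂ) {f : (Fin (k + m) → ℂ) → ℂ}
    (hf : DifferentiableAt ℂ f z) :
    HasDerivAt (fun t : ℂ => f (z + t • e)) (fderiv ℂ f z e) 0 :=
  hf.hasFDerivAt.hasLineDerivAt e

theorem tendsto_line (z e : Fin (k + m) → ℂ) :
    Tendsto (fun t : ℂ => z + t • e) (𝓝 0) (𝓝 z) := by
  have h : Continuous fun t : ℂ => z + t • e := by fun_prop
  simpa using h.tendsto 0

theorem differentiableAt_ratio_branch {ψ : (Fin (k + m) → ℂ) → ℂ} (hψ : DifferentiableAt ℂ ψ z)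
    (hne : ∀ a, ψ z ≠ expCoord z a) (a : Fin (k + m)) :
    DifferentiableAt ℂ (fun y => ratio (expCoord y) (ψ y) a) z := by
  have h := (analyticAt_expCoord z a).differentiableAt
  simp only [ratio, div_eq_mul_inv]
  exact h.fun_mul ((hψ.fun_sub h).fun_inv (sub_ne_zero.2 (hne a)))

theorem differentiableAt_hess_branch {ψ : (Fin (k + m) → ℂ) → ℂ} (hψ : DifferentiableAt ℂ ψ z)
    (hne : ∀ a, ψ z ≠ expCoord z a) :
    DifferentiableAt ℂ (fun y => hess (expCoord y) (ψ y)) z :=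
  DifferentiableAt.fun_sum fun a _ => (differentiableAt_ratio_branch hψ hne a).fun_mul
    ((differentiableAt_ratio_branch hψ hne a).const_add 1)

theorem differentiableAt_expLam_branch {ψ : (Fin (k + m) → ℂ) → ℂ} (hψ : DifferentiableAt ℂ ψ z)
    (h0 : ψ z ≠ 0) :
    DifferentiableAt ℂ (fun y => expLam (expCoord y) (ψ y)) z := by
  simp only [expLam, eval_nodePoly, div_eq_mul_inv]
  have h := (HasFDerivAt.finsetProd (u := Finset.univ) fun a _ =>
    (hψ.fun_sub (analyticAt_expCoord z a).differentiableAt).hasFDerivAt).differentiableAt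
  exact h.fun_mul ((hψ.fun_pow m).fun_inv (pow_ne_zero m h0))

theorem trig_eta (hk : 0 < k) (hm : 0 < m) (hx : IsRegular (expCoord z)) (a b : Fin (k + m)) :
    gram ((trigData k m).eta z) a b = ∑ u ∈ critRoots (expCoord z),
      ratio (expCoord z) u a * ratio (expCoord z) u b * expLam (expCoord z) u
        / hess (expCoord z) u := by
  rw [gram, Matrix.of_apply, (trig_frame hk hm hx).eta_eq]
  refine Finset.sum_congr rfl fun u hu => ?_
  have hu' := (mem_critRoots hk hm).1 hu
  have h1 := hx.expLam_ne_zero hm hu'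
  have h2 := hx.hess_root_ne_zero hm hu'
  rw [trig_comp_single hk hm hx a hu, trig_comp_single hk hm hx b hu, trig_hess_pt hk hm hx hu]
  field_simp
  linear_combination (-ratio (expCoord z) u a * ratio (expCoord z) u b) * Complex.I_sq

/-- The one-form `<∂_κ, ·>`. -/
theorem trig_eta_legendreField (hk : 0 < k) (hm : 0 < m) (hx : IsRegular (expCoord z))
    (b : Fin (k + m)) :
    ∑ c, gram ((trigData k m).eta z) b c * legendreField k m z c
      = ∑ u ∈ critRoots (expCoord z), -(u * ratio (expCoord z) u b / hess (expCoord z) u) := by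
  have h := gram_mulVec_of_frame (trig_frame hk hm hx).eta_eq (legendreField k m z) b
  rw [Matrix.mulVec, dotProduct] at h
  rw [h, (trig_frame hk hm hx).eta_eq]
  refine Finset.sum_congr rfl fun u hu => ?_
  have hu' := (mem_critRoots hk hm).1 hu
  have h1 := hx.expLam_ne_zero hm hu'
  have h2 := hx.hess_root_ne_zero hm hu'
  rw [trig_comp_single hk hm hx b hu, comp_legendreField hk hm hx hu, trig_hess_pt hk hm hx hu]
  field_simp
  linear_combination (u * ratio (expCoord z) u b) * Complex.I_sq

theorem differentiableAt_gram_eta (hk : 0 < k) (hm : 0 < m) (hx : IsRegular (expCoord z))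
    (a b : Fin (k + m)) :
    DifferentiableAt ℂ (fun y => gram ((trigData k m).eta y) a b) z := by
  obtain ⟨ψ, h1, h2⟩ := exists_root_branches hk hm hx
  refine DifferentiableAt.congr_of_eventuallyEq (f := fun y => ∑ u ∈ critRoots (expCoord z),
    ratio (expCoord y) (ψ u y) a * ratio (expCoord y) (ψ u y) b * expLam (expCoord y) (ψ u y)
        / hess (expCoord y) (ψ u y)) (DifferentiableAt.fun_sum fun u hu => ?_) ?_
  · obtain ⟨h3, h4, -⟩ := h1 u hu
    have hu' := (mem_critRoots hk hm).1 hu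
    have hne : ∀ a, ψ u z ≠ expCoord z a := by rw [h3]; exact hx.root_ne_node hu'
    have h0 : ψ u z ≠ 0 := by rw [h3]; exact hx.root_ne_zero hm hu'
    simp only [div_eq_mul_inv]
    exact (((differentiableAt_ratio_branch h4 hne a).fun_mul
      (differentiableAt_ratio_branch h4 hne b)).fun_mul
      (differentiableAt_expLam_branch h4 h0)).fun_mul
      ((differentiableAt_hess_branch h4 hne).fun_inv
        (by rw [h3]; exact hx.hess_root_ne_zero hm hu'))
  · filter_upwards [h2] with y hy
    rw [trig_eta hk hm hy.1, hy.2 fun u => ratio (expCoord y) u a * ratio (expCoord y) u b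
      * expLam (expCoord y) u / hess (expCoord y) u]

theorem fderiv_gram_eta (hk : 0 < k) (hm : 0 < m) (hx : IsRegular (expCoord z))
    (a b : Fin (k + m)) (e : Fin (k + m) → ℂ) :
    fderiv ℂ (fun y => gram ((trigData k m).eta y) a b) z e
      = ∑ u ∈ critRoots (expCoord z), etaTermD (expCoord z) u e a b := by
  obtain ⟨ψ, h1, h2⟩ := exists_root_branches hk hm hx
  refine (hasDerivAt_line z e (differentiableAt_gram_eta hk hm hx a b)).unique ?_
  have hz : z + (0 : ℂ) • e = z := by simp
  have h3 := HasDerivAt.fun_sum (u := critRoots (expCoord z)) fun u hu =>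
    hasDerivAt_etaTerm (x := fun t => expCoord (z + t • e)) (w := fun t => ψ u (z + t • e)) hm
    (hasDerivAt_expCoord_line z e) (hasDerivAt_line z e (h1 u hu).2.1).differentiableAt
    (by rw [hz]; exact hx) ((tendsto_line z e).eventually (h1 u hu).2.2) a b
  refine (h3.congr_of_eventuallyEq ?_).congr_deriv ?_
  · filter_upwards [(tendsto_line z e).eventually h2] with t ht
    rw [trig_eta hk hm ht.1, ht.2 fun u => ratio (expCoord (z + t • e)) u a
      * ratio (expCoord (z + t • e)) u b * expLam (expCoord (z + t • e)) u
        / hess (expCoord (z + t • e)) u]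
  · refine Finset.sum_congr rfl fun u hu => ?_
    simp only [hz, (h1 u hu).1]

theorem fderiv_eta_legendreField (hk : 0 < k) (hm : 0 < m) (hx : IsRegular (expCoord z))
    (b : Fin (k + m)) (e : Fin (k + m) → ℂ) :
    ∑ c, (gram ((trigData k m).eta z) b c * fderiv ℂ (fun y => legendreField k m y c) z e
      + fderiv ℂ (fun y => gram ((trigData k m).eta y) b c) z e * legendreField k m z c)
      = ∑ u ∈ critRoots (expCoord z), omegaTermD (expCoord z) u e b := by
  obtain ⟨ψ, h1, h2⟩ := exists_root_branches hk hm hx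
  have hz : z + (0 : ℂ) • e = z := by simp
  have hV : ∀ c, DifferentiableAt ℂ (fun y => legendreField k m y c) z := fun c =>
    (analyticAt_pi_iff.1 (analyticAt_legendreField hx) c).differentiableAt
  have h4 := HasDerivAt.fun_sum (u := Finset.univ) fun c _ =>
    (hasDerivAt_line z e (differentiableAt_gram_eta hk hm hx b c)).fun_mul
      (hasDerivAt_line z e (hV c))
  have h3 := HasDerivAt.fun_sum (u := critRoots (expCoord z)) fun u hu =>
    hasDerivAt_omegaTerm (x := fun t => expCoord (z + t • e)) (w := fun t => ψ u (z + t • e)) hm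
    (hasDerivAt_expCoord_line z e) (hasDerivAt_line z e (h1 u hu).2.1).differentiableAt
    (by rw [hz]; exact hx) ((tendsto_line z e).eventually (h1 u hu).2.2) b
  have h5 := h3.congr_of_eventuallyEq (f₁ := fun t => ∑ c,
      gram ((trigData k m).eta (z + t • e)) b c * legendreField k m (z + t • e) c) (by
    filter_upwards [(tendsto_line z e).eventually h2] with t ht
    rw [trig_eta_legendreField hk hm ht.1, ht.2 fun u => -(u * ratio (expCoord (z + t • e)) u b
        / hess (expCoord (z + t • e)) u)])
  have h6 := h4.unique h5
  rw [hz] at h6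
  rw [Finset.sum_congr rfl fun c _ => add_comm _ _, h6]
  refine Finset.sum_congr rfl fun u hu => ?_
  simp only [(h1 u hu).1]

theorem hasDerivAt_expLam_log (x : Fin (k + m) → ℂ) {u : ℂ} (hu0 : u ≠ 0)
    (hu : ∀ a, u ≠ x a) :
    HasDerivAt (expLam x) (expLam x u * (k + ∑ a, ratio x u a) / u) u := by
  refine (hasDerivAt_expLam x hu0).congr_deriv ?_
  rw [eval_critPoly x hu, expLam, pow_succ]
  field_simp

/-- The first derivative of the identity `∂_κ λ = i u - h λ'`. -/
theorem sum_legendreField_ratioD (hk : 0 < k) (hm : 0 < m) (hx : IsRegular (expCoord z)) {u : ℂ}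
    (hu0 : u ≠ 0) (hu : ∀ a, u ≠ expCoord z a) :
    expLam (expCoord z) u * ∑ a, legendreField k m z a * ratioD (expCoord z) u a
      = u - u * (k + ∑ a, ratio (expCoord z) u a)
        + (if k = 1 then 1 else 0) * expLam (expCoord z) u * hess (expCoord z) u := by
  have h1 := hasDerivAt_expLam_log (expCoord z) hu0 hu
  have h2 := HasDerivAt.fun_sum (u := Finset.univ) fun a _ =>
    (hasDerivAt_ratio (expCoord z) hu0 (hu a)).const_mul (legendreField k m z a)
  have h3 := IsRegular.hasDerivAt_sum_ratio hu0 hu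
  have h4 := ((hasDerivAt_id u).fun_neg).fun_add
    ((h1.const_mul (if k = 1 then 1 else 0 : ℂ)).fun_mul h3)
  have h5 := (h1.fun_mul h2).unique (h4.congr_of_eventuallyEq (by
    filter_upwards [IsRegular.eventually_ne hu0 hu] with v hv
    exact sum_legendreField_ratio hk hm hx hv.1 hv.2))
  have h6 := sum_legendreField_ratio hk hm hx hu0 hu
  simp only [mul_neg, Finset.sum_neg_distrib, mul_div_assoc', ← Finset.sum_div] at h5
  field_simp at h5
  linear_combination (k + ∑ a, ratio (expCoord z) u a) * h6 - h5

/-- The second derivative of the identity `∂_κ λ = i u - h λ'`. -/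
theorem sum_legendreField_third (hk : 0 < k) (hm : 0 < m) (hx : IsRegular (expCoord z)) {u : ℂ}
    (hu : (critPoly (expCoord z)).eval u = 0) :
    expLam (expCoord z) u * ∑ a, legendreField k m z a
        * ((1 + 2 * ratio (expCoord z) u a) * ratioD (expCoord z) u a)
      = -(u * (1 + hess (expCoord z) u))
        + (if k = 1 then 1 else 0) * expLam (expCoord z) u * third (expCoord z) u := by
  have hu0 := hx.root_ne_zero hm hu
  have hun := hx.root_ne_node hu
  have h1 := hasDerivAt_expLam_log (expCoord z) hu0 hun
  have h2 := HasDerivAt.fun_sum (u := Finset.univ) fun a _ =>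
    ((hasDerivAt_ratio (expCoord z) hu0 (hun a)).fun_mul
      ((hasDerivAt_ratio (expCoord z) hu0 (hun a)).const_add 1)).const_mul (legendreField k m z a)
  have h3 := IsRegular.hasDerivAt_sum_ratio hu0 hun
  have h4 := ((hasDerivAt_id u).fun_sub ((hasDerivAt_id u).fun_mul h3)).fun_add
    ((h1.const_mul (if k = 1 then 1 else 0 : ℂ)).fun_mul (IsRegular.hasDerivAt_hess hu0 hun))
  have h5 := (h1.fun_mul h2).unique (h4.congr_of_eventuallyEq (by
    filter_upwards [IsRegular.eventually_ne hu0 hun] with v hv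
    exact sum_legendreField_ratioD hk hm hx hv.1 hv.2))
  have h7 : ∀ a, legendreField k m z a * (-(ratioD (expCoord z) u a / u)
        * (1 + ratio (expCoord z) u a)
      + ratio (expCoord z) u a * -(ratioD (expCoord z) u a / u))
      = -(legendreField k m z a
        * ((1 + 2 * ratio (expCoord z) u a) * ratioD (expCoord z) u a)) / u := fun a => by ring
  rw [Finset.sum_congr rfl fun a _ => h7 a, ← Finset.sum_div, Finset.sum_neg_distrib,
    hx.sum_ratio hu] at h5
  simp only [id, add_neg_cancel, mul_zero, zero_div, zero_mul, zero_add] at h5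
  generalize ∑ a, legendreField k m z a
    * ((1 + 2 * ratio (expCoord z) u a) * ratioD (expCoord z) u a) = T at h5 ⊢
  field_simp at h5
  linear_combination -h5

theorem isFlatFieldAt_legendreField (hk : 0 < k) (hm : 0 < m) (hx : IsRegular (expCoord z)) :
    (trigData k m).IsFlatFieldAt (legendreField k m) z where
  field_diff := (analyticAt_legendreField hx).differentiableAt
  metric_diff := differentiableAt_gram_eta hk hm hx
  parallel a b := by
    have h1 := fderiv_eta_legendreField hk hm hx b (Pi.single a 1)
    have hg : ∀ a c, ∑ u ∈ critRoots (expCoord z), ∑ d, legendreField k m z d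
        * etaTermD (expCoord z) u (Pi.single a 1) c d
        = ∑ d, pd a (fun y => gram ((trigData k m).eta y) c d) z * legendreField k m z d := by
      intro a c
      rw [Finset.sum_comm]
      refine Finset.sum_congr rfl fun d _ => ?_
      rw [pd, fderiv_gram_eta hk hm hx, ← Finset.mul_sum, mul_comm]
    have hV : ∑ u ∈ critRoots (expCoord z), etaTermD (expCoord z) u (legendreField k m z) a b
        = ∑ c, pd c (fun y => gram ((trigData k m).eta y) a b) z * legendreField k m z c := by
      rw [← fderiv_gram_eta hk hm hx]
      have h := map_eq_sum_single (fderiv ℂ (fun y => gram ((trigData k m).eta y) a b)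
        z).toLinearMap (legendreField k m z)
      refine h.trans (Finset.sum_congr rfl fun c _ => ?_)
      rw [smul_eq_mul, mul_comm]
      rfl
    have hres := sum_parallel_residue hk hm hx a b
    have hterm := fun u (hu : u ∈ critRoots (expCoord z)) =>
      have hu' := (mem_critRoots hk hm).1 hu
      parallel_term (expCoord z) u (if k = 1 then 1 else 0) (legendreField k m z) a b
        (hx.hess_root_ne_zero hm hu') (hx.expLam_ne_zero hm hu')
        (by
          have := sum_legendreField_ratio hk hm hx (hx.root_ne_zero hm hu') (hx.root_ne_node hu')
          rw [hx.sum_ratio hu'] at this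
          simp only [mul_comm (ratio _ _ _)]
          linear_combination this)
        (by
          have := sum_legendreField_ratioD hk hm hx (hx.root_ne_zero hm hu') (hx.root_ne_node hu')
          rw [hx.sum_ratio hu'] at this
          simp only [mul_comm (ratioD _ _ _)]
          linear_combination this)
        (by
          have := sum_legendreField_third hk hm hx hu'
          simp only [mul_comm _ (legendreField k m z _)]
          linear_combination this)
    have h2 := Finset.sum_congr rfl hterm
    rw [← Finset.mul_sum, hres, mul_zero, Finset.sum_add_distrib, ← Finset.mul_sum,
      Finset.sum_sub_distrib, Finset.sum_sub_distrib, hV, hg, hg, ← h1] at h2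
    rw [← h2]
    simp only [pd, mul_sub, Finset.mul_sum, ← Finset.sum_sub_distrib, ← Finset.sum_add_distrib]
    exact Finset.sum_congr rfl fun c _ => by ring

end Flat

end HurwitzLegendre

namespace HurwitzLegendre

/-! ### Third partial derivatives -/

section Partial

variable {n : ℕ} {F G : (Fin n → ℂ) → ℂ} {z : Fin n → ℂ}

theorem pd_congr (h : F =ᶠ[𝓝 z] G) (a : Fin n) : pd a F =ᶠ[𝓝 z] pd a G :=
  (h.fderiv (𝕜 := ℂ)).mono fun y hy => by rw [pd, pd, hy]

theorem analyticAt_pd (h : AnalyticAt ℂ F z) (a : Fin n) : AnalyticAt ℂ (pd a F) z :=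
  ((ContinuousLinearMap.apply ℂ ℂ (Pi.single a 1 : Fin n → ℂ)).analyticAt _).comp h.fderiv

theorem pd_zero (a : Fin n) : (pd a fun _ : Fin n → ℂ => (0 : ℂ)) = fun _ => 0 := by
  funext y
  rw [pd, fderiv_fun_const]
  rfl

theorem pd_const_mul (h : AnalyticAt ℂ F z) (a : Fin n) (c : ℂ) :
    pd a (fun y => c * F y) =ᶠ[𝓝 z] fun y => c * pd a F y := by
  filter_upwards [h.eventually_analyticAt] with y hy
  rw [pd, fderiv_const_mul hy.differentiableAt, pd]
  rfl

theorem pd_add (hF : AnalyticAt ℂ F z) (hG : AnalyticAt ℂ G z) (a : Fin n) :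
    pd a (fun y => F y + G y) =ᶠ[𝓝 z] fun y => pd a F y + pd a G y := by
  filter_upwards [hF.eventually_analyticAt, hG.eventually_analyticAt] with y h1 h2
  rw [pd, fderiv_fun_add h1.differentiableAt h2.differentiableAt, pd, pd]
  rfl

theorem pd_sum {ι : Type*} {s : Finset ι} {F : ι → (Fin n → ℂ) → ℂ}
    (h : ∀ i ∈ s, AnalyticAt ℂ (F i) z) (a : Fin n) :
    pd a (fun y => ∑ i ∈ s, F i y) =ᶠ[𝓝 z] fun y => ∑ i ∈ s, pd a (F i) y := by
  filter_upwards [(eventually_all_finset s).2 fun i hi => (h i hi).eventually_analyticAt]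
    with y hy
  rw [pd, fderiv_fun_sum fun i hi => (hy i hi).differentiableAt]
  simp only [_root_.sum_apply, pd]

theorem pd_pd_pd_const_mul (h : AnalyticAt ℂ F z) (a b c : Fin n) (r : ℂ) :
    pd a (pd b (pd c fun y => r * F y)) z = r * pd a (pd b (pd c F)) z :=
  (((pd_congr (pd_congr (pd_const_mul h c r) b) a).trans
    (pd_congr (pd_const_mul (analyticAt_pd h c) b r) a)).trans
    (pd_const_mul (analyticAt_pd (analyticAt_pd h c) b) a r)).self_of_nhds

theorem pd_pd_pd_add (hF : AnalyticAt ℂ F z) (hG : AnalyticAt ℂ G z) (a b c : Fin n) :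
    pd a (pd b (pd c fun y => F y + G y)) z
      = pd a (pd b (pd c F)) z + pd a (pd b (pd c G)) z :=
  (((pd_congr (pd_congr (pd_add hF hG c) b) a).trans
    (pd_congr (pd_add (analyticAt_pd hF c) (analyticAt_pd hG c) b) a)).trans
    (pd_add (analyticAt_pd (analyticAt_pd hF c) b) (analyticAt_pd (analyticAt_pd hG c) b)
      a)).self_of_nhds

theorem pd_pd_pd_sum {ι : Type*} {s : Finset ι} {F : ι → (Fin n → ℂ) → ℂ}
    (h : ∀ i ∈ s, AnalyticAt ℂ (F i) z) (a b c : Fin n) :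
    pd a (pd b (pd c fun y => ∑ i ∈ s, F i y)) z = ∑ i ∈ s, pd a (pd b (pd c (F i))) z :=
  (((pd_congr (pd_congr (pd_sum h c) b) a).trans
    (pd_congr (pd_sum (fun i hi => analyticAt_pd (h i hi) c) b) a)).trans
    (pd_sum (fun i hi => analyticAt_pd (analyticAt_pd (h i hi) c) b) a)).self_of_nhds

/-- The partial derivatives of a function that depends on one linear form. -/
theorem pd_comp_linear {f : ℂ → ℂ} {ℓ : (Fin n → ℂ) →L[ℂ] ℂ} (hf : AnalyticAt ℂ f (ℓ z))
    (a : Fin n) :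
    pd a (fun y => f (ℓ y)) =ᶠ[𝓝 z] fun y => ℓ (Pi.single a 1) * deriv f (ℓ y) := by
  filter_upwards [ℓ.continuous.continuousAt.eventually hf.eventually_analyticAt] with y hy
  have h := hy.differentiableAt.hasDerivAt.comp_hasFDerivAt y ℓ.hasFDerivAt
  rw [pd]
  refine (congrArg (fun φ => φ (Pi.single a 1)) h.fderiv).trans ?_
  rw [_root_.smul_apply, smul_eq_mul, mul_comm]

theorem analyticAt_comp_linear {f : ℂ → ℂ} {ℓ : (Fin n → ℂ) →L[ℂ] ℂ}
    (hf : AnalyticAt ℂ f (ℓ z)) : AnalyticAt ℂ (fun y => f (ℓ y)) z :=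
  hf.comp (ℓ.analyticAt z)

theorem pd_pd_pd_comp_linear {f : ℂ → ℂ} {ℓ : (Fin n → ℂ) →L[ℂ] ℂ} (hf : AnalyticAt ℂ f (ℓ z))
    (a b c : Fin n) :
    pd a (pd b (pd c fun y => f (ℓ y))) z = ℓ (Pi.single a 1) * ℓ (Pi.single b 1)
      * ℓ (Pi.single c 1) * deriv (deriv (deriv f)) (ℓ z) := by
  have h1 := pd_comp_linear hf c
  have h2 := pd_comp_linear hf.deriv b
  have h3 := pd_comp_linear hf.deriv.deriv a
  have h4 := pd_const_mul (analyticAt_comp_linear hf.deriv) b (ℓ (Pi.single c 1))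
  have h5 := pd_const_mul (analyticAt_comp_linear hf.deriv.deriv) a
    (ℓ (Pi.single c 1) * ℓ (Pi.single b 1))
  have h6 : pd b (pd c fun y => f (ℓ y)) =ᶠ[𝓝 z]
      fun y => ℓ (Pi.single c 1) * ℓ (Pi.single b 1) * deriv (deriv f) (ℓ y) := by
    filter_upwards [pd_congr h1 b, h2, h4] with y k1 k2 k3
    rw [k1, k3, k2, mul_assoc]
  rw [(pd_congr h6 a).self_of_nhds]
  refine h5.self_of_nhds.trans ?_
  beta_reduce
  rw [h3.self_of_nhds]
  ring

theorem pd_apply (a p : Fin n) :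
    (pd a fun y : Fin n → ℂ => y p) = fun _ => if p = a then 1 else 0 := by
  funext y
  rw [pd, (hasFDerivAt_apply p y).fderiv, ContinuousLinearMap.proj_apply, Pi.single_apply]

theorem pd_fun_mul (hF : Differentiable ℂ F) (hG : Differentiable ℂ G) (a : Fin n) :
    (pd a fun y => F y * G y) = fun y => pd a F y * G y + F y * pd a G y := by
  funext y
  rw [pd, fderiv_fun_mul (hF y) (hG y), pd, pd]
  simp only [_root_.add_apply, _root_.smul_apply, smul_eq_mul]
  ring

/-- The third derivatives of a cubic monomial. -/
theorem pd_pd_pd_monomial (p q r a b c : Fin n) (z : Fin n → ℂ) :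
    pd a (pd b (pd c fun y => y p * (y q * y r))) z =
      (if p = a then 1 else 0) * ((if q = b then 1 else 0) * (if r = c then 1 else 0))
      + (if p = a then 1 else 0) * ((if q = c then 1 else 0) * (if r = b then 1 else 0))
      + (if p = b then 1 else 0) * ((if q = a then 1 else 0) * (if r = c then 1 else 0))
      + (if p = b then 1 else 0) * ((if q = c then 1 else 0) * (if r = a then 1 else 0))
      + (if p = c then 1 else 0) * ((if q = a then 1 else 0) * (if r = b then 1 else 0))
      + (if p = c then 1 else 0) * ((if q = b then 1 else 0) * (if r = a then 1 else 0)) := by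
  have hd : ∀ i, AnalyticAt ℂ (fun y : Fin n → ℂ => y i) z := fun i =>
    (ContinuousLinearMap.proj (R := ℂ) (φ := fun _ : Fin n => ℂ) i).analyticAt z
  have hD : ∀ i, Differentiable ℂ fun y : Fin n → ℂ => y i := fun i => differentiable_apply i
  have h2 : ∀ i j, ∀ d, (pd d fun y : Fin n → ℂ => y i * y j)
      = fun y => (if i = d then 1 else 0) * y j + (if j = d then 1 else 0) * y i := fun i j d => by
    rw [pd_fun_mul (hD i) (hD j), pd_apply, pd_apply]
    funext y
    ring
  have h1 : ∀ i j : Fin n, ∀ c₁ c₂ : ℂ, ∀ y : Fin n → ℂ, pd a (fun y => c₁ * y i + c₂ * y j) y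
      = c₁ * (if i = a then 1 else 0) + c₂ * (if j = a then 1 else 0) := fun i j c₁ c₂ y => by
    have hi := ((hasFDerivAt_apply (𝕜 := ℂ) i y).const_mul c₁).fun_add
      ((hasFDerivAt_apply (𝕜 := ℂ) j y).const_mul c₂)
    rw [pd, hi.fderiv]
    simp [Pi.single_apply]
  have h3 : (pd c fun y : Fin n → ℂ => y p * (y q * y r)) = fun y =>
      (if p = c then 1 else 0) * (y q * y r) + ((if q = c then 1 else 0) * (y p * y r)
        + (if r = c then 1 else 0) * (y p * y q)) := by
    rw [pd_fun_mul (hD p) ((hD q).fun_mul (hD r)), pd_apply, h2]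
    funext y
    ring
  have h4 : pd b (fun y : Fin n → ℂ => (if p = c then 1 else 0) * (y q * y r)
      + ((if q = c then 1 else 0) * (y p * y r) + (if r = c then 1 else 0) * (y p * y q)))
      =ᶠ[𝓝 z] fun y => (if p = c then 1 else 0) * pd b (fun y => y q * y r) y
        + ((if q = c then 1 else 0) * pd b (fun y => y p * y r) y
        + (if r = c then 1 else 0) * pd b (fun y => y p * y q) y) := by
    have k1 := fun i j (d : ℂ) => pd_const_mul ((hd i).fun_mul (hd j)) b d
    have k2 := pd_add (analyticAt_const.fun_mul ((hd q).fun_mul (hd r)))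
      ((analyticAt_const.fun_mul ((hd p).fun_mul (hd r))).fun_add
        (analyticAt_const.fun_mul ((hd p).fun_mul (hd q)))) b (z := z)
      (F := fun y => (if p = c then 1 else 0) * (y q * y r))
      (G := fun y => (if q = c then 1 else 0) * (y p * y r)
        + (if r = c then 1 else 0) * (y p * y q))
    have k3 := pd_add (analyticAt_const.fun_mul ((hd p).fun_mul (hd r)))
        (analyticAt_const.fun_mul ((hd p).fun_mul (hd q))) b (z := z)
      (F := fun y => (if q = c then 1 else 0) * (y p * y r))
      (G := fun y => (if r = c then 1 else 0) * (y p * y q))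
    filter_upwards [k2, k3, k1 q r (if p = c then 1 else 0), k1 p r (if q = c then 1 else 0),
      k1 p q (if r = c then 1 else 0)] with y e1 e2 e3 e4 e5
    rw [e1, e2, e3, e4, e5]
  rw [h3, (pd_congr h4 a).self_of_nhds, h2, h2, h2]
  have h5 : (fun y : Fin n → ℂ => (if p = c then (1 : ℂ) else 0)
        * ((if q = b then 1 else 0) * y r + (if r = b then 1 else 0) * y q)
      + ((if q = c then 1 else 0) * ((if p = b then 1 else 0) * y r
        + (if r = b then 1 else 0) * y p)
      + (if r = c then 1 else 0) * ((if p = b then 1 else 0) * y q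
        + (if q = b then 1 else 0) * y p)))
      = fun y => ((if p = c then (1 : ℂ) else 0) * (if q = b then 1 else 0) * y r
        + (if p = c then (1 : ℂ) else 0) * (if r = b then 1 else 0) * y q)
      + (((if q = c then (1 : ℂ) else 0) * (if p = b then 1 else 0) * y r
        + (if q = c then (1 : ℂ) else 0) * (if r = b then 1 else 0) * y p)
      + ((if r = c then (1 : ℂ) else 0) * (if p = b then 1 else 0) * y q
        + (if r = c then (1 : ℂ) else 0) * (if q = b then 1 else 0) * y p)) := by
    funext y
    ring
  have hlin : ∀ i j, ∀ c₁ c₂ : ℂ, AnalyticAt ℂ (fun y : Fin n → ℂ => c₁ * y i + c₂ * y j) z :=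
    fun i j c₁ c₂ => (analyticAt_const.fun_mul (hd i)).fun_add (analyticAt_const.fun_mul (hd j))
  rw [h5]
  refine (pd_add (hlin _ _ _ _) ((hlin _ _ _ _).fun_add (hlin _ _ _ _)) a).self_of_nhds.trans ?_
  beta_reduce
  rw [(pd_add (hlin _ _ _ _) (hlin _ _ _ _) a).self_of_nhds]
  beta_reduce
  rw [h1, h1, h1]
  ring

end Partial

end HurwitzLegendre

namespace HurwitzLegendre

/-! ### Branches of the trilogarithm and of the logarithm -/

section Multivalued

/-- The Euler derivative `w f'(w)`. -/
noncomputable def eulerDeriv (f : ℂ → ℂ) : ℂ → ℂ := fun w => w * deriv f w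

theorem eulerDeriv_congr {f g : ℂ → ℂ} {x : ℂ} (h : f =ᶠ[𝓝 x] g) :
    eulerDeriv f =ᶠ[𝓝 x] eulerDeriv g :=
  h.deriv.mono fun w hw => by rw [eulerDeriv, eulerDeriv, hw]

theorem analyticAt_eulerDeriv {f : ℂ → ℂ} {x : ℂ} (h : AnalyticAt ℂ f x) :
    AnalyticAt ℂ (eulerDeriv f) x :=
  analyticAt_id.mul h.deriv

/-- The series `∑ w^{j+1} / (j+1)^r`. -/
noncomputable def polylogSeries (r : ℕ) (w : ℂ) : ℂ := ∑' j : ℕ, w ^ (j + 1) / ((j : ℂ) + 1) ^ r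

theorem hasDerivAt_polylogSeries (r : ℕ) {w : ℂ} (hw : ‖w‖ < 1 / 2) :
    HasDerivAt (polylogSeries (r + 1)) (∑' j : ℕ, w ^ j / ((j : ℂ) + 1) ^ r) w := by
  have hs : Summable fun j : ℕ => (1 / 2 : ℝ) ^ j :=
    summable_geometric_of_lt_one (by norm_num) (by norm_num)
  have hj : ∀ j : ℕ, (1 : ℝ) ≤ ‖((j : ℂ) + 1)‖ := fun j => by
    have : ((j : ℂ) + 1) = ((j + 1 : ℕ) : ℂ) := by push_cast; ring
    rw [this, Complex.norm_natCast]
    exact_mod_cast Nat.succ_pos j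
  have h0 : (0 : ℂ) ∈ Metric.ball (0 : ℂ) (1 / 2) := Metric.mem_ball_self (by norm_num)
  refine hasDerivAt_tsum_of_isPreconnected (𝕜 := ℂ) (F := ℂ) (t := Metric.ball (0 : ℂ) (1 / 2))
    (g := fun (j : ℕ) (w : ℂ) => w ^ (j + 1) / ((j : ℂ) + 1) ^ (r + 1))
    (g' := fun (j : ℕ) (w : ℂ) => w ^ j / ((j : ℂ) + 1) ^ r) hs
    Metric.isOpen_ball (convex_ball _ _).isPreconnected (fun j y _ => ?_) (fun j y hy => ?_) h0 ?_
    (by simpa using hw)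
  · have h1 : ((j : ℂ) + 1) ≠ 0 := norm_ne_zero_iff.1 (by linarith [hj j])
    refine ((hasDerivAt_pow (j + 1) y).div_const _).congr_deriv ?_
    rw [Nat.add_sub_cancel, pow_succ ((j : ℂ) + 1)]
    push_cast
    field_simp
  · rw [norm_div, norm_pow, norm_pow]
    have hy' : ‖y‖ < 1 / 2 := by simpa using hy
    refine (div_le_self (by positivity) (one_le_pow₀ (hj j))).trans ?_
    exact pow_le_pow_left₀ (norm_nonneg _) hy'.le j
  · simp [summable_zero]

theorem eulerDeriv_polylogSeries (r : ℕ) {w : ℂ} (hw : ‖w‖ < 1 / 2) :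
    eulerDeriv (polylogSeries (r + 1)) w = polylogSeries r w := by
  rw [eulerDeriv, (hasDerivAt_polylogSeries r hw).deriv, polylogSeries, ← tsum_mul_left]
  exact tsum_congr fun j => by ring

theorem polylogSeries_zero {w : ℂ} (hw : ‖w‖ < 1) : polylogSeries 0 w * (1 - w) = w := by
  have h : (1 : ℂ) - w ≠ 0 := fun h => by
    rw [← sub_eq_zero.1 h, norm_one] at hw
    exact lt_irrefl _ hw
  have h1 : polylogSeries 0 w = ∑' j : ℕ, w * w ^ j := tsum_congr fun j => by ring
  rw [h1, tsum_mul_left, tsum_geometric_of_norm_lt_one hw, mul_assoc, inv_mul_cancel₀ h, mul_one]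

theorem eventually_norm_lt_half : ∀ᶠ w in 𝓝 (0 : ℂ), ‖w‖ < 1 / 2 := by
  filter_upwards [Metric.ball_mem_nhds (0 : ℂ) (by norm_num : (0 : ℝ) < 1 / 2)] with w hw
  simpa using hw

/-- The differential equation `(w d/dw)³ L = w / (1 - w)` of the trilogarithm, near `x`. -/
def TrilogEq (L : ℂ → ℂ) (x : ℂ) : Prop :=
  ∀ᶠ w in 𝓝 x, eulerDeriv (eulerDeriv (eulerDeriv L)) w * (1 - w) = w

theorem TrilogEq.congr {f g : ℂ → ℂ} {x : ℂ} (h : f =ᶠ[𝓝 x] g) (hf : TrilogEq f x) :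
    TrilogEq g x := by
  filter_upwards [hf, eulerDeriv_congr (eulerDeriv_congr (eulerDeriv_congr h))] with w h1 h2
  rw [← h2, h1]

theorem trilogEq_series : TrilogEq (polylogSeries 3) 0 := by
  have h : ∀ r, eulerDeriv (polylogSeries (r + 1)) =ᶠ[𝓝 0] polylogSeries r := fun r => by
    filter_upwards [eventually_norm_lt_half] with w hw using eulerDeriv_polylogSeries r hw
  have h3 := ((eulerDeriv_congr (eulerDeriv_congr (h 2))).trans (eulerDeriv_congr (h 1))).trans
    (h 0)
  filter_upwards [h3, eventually_norm_lt_half] with w h1 h2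
  rw [h1, polylogSeries_zero (h2.trans (by norm_num))]

/-- By the identity theorem the differential equation holds near `x` if it holds near some point
of a disc around `x` on which `f` is analytic. -/
theorem eventually_trilogEq_iff {f : ℂ → ℂ} {x : ℂ} (hf : AnalyticAt ℂ f x) :
    ∀ᶠ y in 𝓝 x, TrilogEq f y ↔ TrilogEq f x := by
  obtain ⟨r, hr, hball⟩ := Metric.eventually_nhds_iff_ball.1 hf.eventually_analyticAt
  have han : AnalyticOnNhd ℂ (fun w => eulerDeriv (eulerDeriv (eulerDeriv f)) w * (1 - w))
      (Metric.ball x r) := fun y hy => (analyticAt_eulerDeriv (analyticAt_eulerDeriv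
    (analyticAt_eulerDeriv (hball y hy)))).mul (analyticAt_const.sub analyticAt_id)
  have hid : AnalyticOnNhd ℂ (fun w : ℂ => w) (Metric.ball x r) := fun y _ => analyticAt_id
  have key : ∀ y ∈ Metric.ball x r, ∀ y' ∈ Metric.ball x r, TrilogEq f y → TrilogEq f y' := by
    intro y hy y' hy' h
    have := han.eqOn_of_preconnected_of_eventuallyEq hid (convex_ball x r).isPreconnected hy h
    filter_upwards [Metric.isOpen_ball.mem_nhds hy'] with w hw using this hw
  filter_upwards [Metric.ball_mem_nhds x hr] with y hy
  exact ⟨key y hy x (Metric.mem_ball_self hr), key x (Metric.mem_ball_self hr) y hy⟩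

/-- The differential equation is preserved by analytic continuation. -/
theorem IsTrilogBranchAt.trilogEq {L : ℂ → ℂ} {x : ℂ} (h : IsTrilogBranchAt L x) :
    AnalyticAt ℂ L x ∧ TrilogEq L x := by
  obtain ⟨γ, g, hγ, h0, h1, han, hloc, hg0, hg1⟩ := h
  have hl : (0 : ℝ) ∈ Set.Icc (0 : ℝ) 1 := ⟨le_rfl, zero_le_one⟩
  have hr : (1 : ℝ) ∈ Set.Icc (0 : ℝ) 1 := ⟨zero_le_one, le_rfl⟩
  have hiff : TrilogEq (g 0) (γ 0) ↔ TrilogEq (g 1) (γ 1) := by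
    refine isPreconnected_Icc.induction₂ (fun s t => TrilogEq (g s) (γ s) ↔ TrilogEq (g t) (γ t))
      (fun t ht => ?_) (fun _ _ _ _ _ _ h h' => h.trans h') (fun _ _ _ _ h => h.symm) hl hr
    filter_upwards [hloc t ht, (hγ t ht).eventually (eventually_trilogEq_iff (han t ht))]
      with s hs1 hs2
    exact hs2.symm.trans ⟨TrilogEq.congr hs1.symm, TrilogEq.congr hs1⟩
  have hstart : TrilogEq (g 0) (γ 0) := by
    rw [h0]
    exact trilogEq_series.congr hg0.symm
  have hend := hiff.1 hstart
  rw [h1] at hend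
  have hg := han 1 hr
  rw [h1] at hg
  exact ⟨hg.congr hg1, hend.congr hg1⟩

theorem analyticAt_comp_exp_I {L : ℂ → ℂ} {s : ℂ}
    (hL : AnalyticAt ℂ L (Complex.exp (Complex.I * s))) :
    AnalyticAt ℂ (fun s => L (Complex.exp (Complex.I * s))) s :=
  hL.comp_of_eq (analyticAt_const.mul analyticAt_id).cexp rfl

theorem deriv_comp_exp_I {L : ℂ → ℂ} {s : ℂ}
    (hL : AnalyticAt ℂ L (Complex.exp (Complex.I * s))) :
    deriv (fun s => L (Complex.exp (Complex.I * s))) =ᶠ[𝓝 s]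
      fun s => Complex.I * eulerDeriv L (Complex.exp (Complex.I * s)) := by
  have hc := (hasDerivAt_exp_I s).continuousAt
  filter_upwards [hc.eventually hL.eventually_analyticAt] with t ht
  have h := ht.differentiableAt.hasDerivAt.comp t (hasDerivAt_exp_I t)
  refine h.deriv.trans ?_
  rw [eulerDeriv]
  ring

/-- The third derivative of `L(e^{is})` for a branch `L` of the trilogarithm. -/
theorem deriv3_trilog_comp_exp_I {L : ℂ → ℂ} {s : ℂ}
    (hL : AnalyticAt ℂ L (Complex.exp (Complex.I * s)))
    (hE : TrilogEq L (Complex.exp (Complex.I * s))) (hs : Complex.exp (Complex.I * s) ≠ 1) :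
    deriv (deriv (deriv fun s => L (Complex.exp (Complex.I * s)))) s
      = -Complex.I * (Complex.exp (Complex.I * s) / (1 - Complex.exp (Complex.I * s))) := by
  have h1 := deriv_comp_exp_I hL
  have h2 := deriv_comp_exp_I (analyticAt_eulerDeriv hL)
  have h3 := deriv_comp_exp_I (analyticAt_eulerDeriv (analyticAt_eulerDeriv hL))
  have h4 : deriv (deriv fun s => L (Complex.exp (Complex.I * s))) =ᶠ[𝓝 s] fun s =>
      Complex.I * (Complex.I * eulerDeriv (eulerDeriv L) (Complex.exp (Complex.I * s))) := by
    filter_upwards [h1.deriv, h2] with t e1 e2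
    rw [e1, deriv_const_mul_field, e2]
  have h5 : 1 - Complex.exp (Complex.I * s) ≠ 0 := sub_ne_zero.2 hs.symm
  have h6 : eulerDeriv (eulerDeriv (eulerDeriv L)) (Complex.exp (Complex.I * s))
      = Complex.exp (Complex.I * s) / (1 - Complex.exp (Complex.I * s)) := by
    rw [eq_div_iff h5]
    exact hE.self_of_nhds
  rw [h4.deriv_eq, deriv_const_mul_field, deriv_const_mul_field, h3.self_of_nhds]
  beta_reduce
  rw [h6]
  linear_combination (Complex.I * (Complex.exp (Complex.I * s)
    / (1 - Complex.exp (Complex.I * s)))) * Complex.I_sq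

theorem IsLogBranchAt.eventually {ℓ : ℂ → ℂ} {x : ℂ} (h : IsLogBranchAt ℓ x) :
    ∀ᶠ w in 𝓝 x, IsLogBranchAt ℓ w :=
  h.1.eventually_analyticAt.and (eventually_eventually_nhds.2 h.2)

theorem IsLogBranchAt.hasDerivAt {ℓ : ℂ → ℂ} {x : ℂ} (h : IsLogBranchAt ℓ x) :
    HasDerivAt ℓ (1 / x) x := by
  have h0 : Complex.exp (ℓ x) = x := h.2.self_of_nhds
  have hx : x ≠ 0 := by
    rw [← h0]
    exact Complex.exp_ne_zero _
  have h1 := h.1.differentiableAt.hasDerivAt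
  have h2 := h1.cexp.unique ((hasDerivAt_id x).congr_of_eventuallyEq h.2)
  rw [h0] at h2
  rw [eq_div_of_mul_eq hx ((mul_comm _ _).trans h2)] at h1
  exact h1

theorem analyticAt_sq_mul_log {ℓ : ℂ → ℂ} {s : ℂ} (h : IsLogBranchAt ℓ (s ^ 2)) :
    AnalyticAt ℂ (fun s => s ^ 2 * ℓ (s ^ 2)) s :=
  (analyticAt_id.pow 2).mul (h.1.comp_of_eq (analyticAt_id.pow 2) rfl)

/-- The third derivative of `s² log s²`. -/
theorem deriv3_sq_mul_log {ℓ : ℂ → ℂ} {s : ℂ} (hs : s ≠ 0) (h : IsLogBranchAt ℓ (s ^ 2)) :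
    deriv (deriv (deriv fun s => s ^ 2 * ℓ (s ^ 2))) s = 4 / s := by
  have hev : ∀ᶠ t in 𝓝 s, t ≠ 0 ∧ IsLogBranchAt ℓ (t ^ 2) :=
    (eventually_ne_nhds hs).and ((continuous_pow 2).continuousAt.eventually h.eventually)
  have hl : ∀ t : ℂ, t ≠ 0 → IsLogBranchAt ℓ (t ^ 2) →
      HasDerivAt (fun s => ℓ (s ^ 2)) (2 / t) t := fun t ht hb => by
    refine (hb.hasDerivAt.comp t (hasDerivAt_pow 2 t)).congr_deriv ?_
    field_simp
    simp [mul_comm]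
  have h1 : deriv (fun s => s ^ 2 * ℓ (s ^ 2)) =ᶠ[𝓝 s] fun t => 2 * t * ℓ (t ^ 2) + 2 * t := by
    filter_upwards [hev] with t ht
    refine ((hasDerivAt_pow 2 t).fun_mul (hl t ht.1 ht.2)).deriv.trans ?_
    have := ht.1
    field_simp
    norm_num
    ring
  have h2 : deriv (deriv fun s => s ^ 2 * ℓ (s ^ 2)) =ᶠ[𝓝 s] fun t => 2 * ℓ (t ^ 2) + 6 := by
    filter_upwards [h1.deriv, hev] with t e1 ht
    rw [e1]
    have h3 := (hasDerivAt_id t).const_mul 2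
    refine ((h3.fun_mul (hl t ht.1 ht.2)).fun_add h3).deriv.trans ?_
    have := ht.1
    simp only [id]
    field_simp
    ring
  rw [h2.deriv_eq]
  refine (((hl s hs h).const_mul 2).add_const 6).deriv.trans ?_
  ring

end Multivalued

end HurwitzLegendre

namespace HurwitzLegendre

/-! ### The trigonometric prepotential -/

section TrigPrepotential

open HurwitzData

theorem analyticAt_cubic {n : ℕ} (M : Fin n → Fin n → Fin n → ℂ) (z : Fin n → ℂ) :
    AnalyticAt ℂ (fun y : Fin n → ℂ => ∑ p, ∑ q, ∑ r, M p q r * (y p * (y q * y r))) z := by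
  have hd : ∀ i, AnalyticAt ℂ (fun y : Fin n → ℂ => y i) z := fun i =>
    (ContinuousLinearMap.proj (R := ℂ) (φ := fun _ : Fin n => ℂ) i).analyticAt z
  exact Finset.analyticAt_fun_sum _ fun p _ => Finset.analyticAt_fun_sum _ fun q _ =>
    Finset.analyticAt_fun_sum _ fun r _ =>
      analyticAt_const.fun_mul ((hd p).fun_mul ((hd q).fun_mul (hd r)))

theorem pd_pd_pd_cubic {n : ℕ} (M : Fin n → Fin n → Fin n → ℂ) (z : Fin n → ℂ) (a b c : Fin n) :
    pd a (pd b (pd c fun y : Fin n → ℂ => ∑ p, ∑ q, ∑ r, M p q r * (y p * (y q * y r)))) z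
      = M a b c + M a c b + M b a c + M b c a + M c a b + M c b a := by
  have hd : ∀ i, AnalyticAt ℂ (fun y : Fin n → ℂ => y i) z := fun i =>
    (ContinuousLinearMap.proj (R := ℂ) (φ := fun _ : Fin n => ℂ) i).analyticAt z
  have h0 : ∀ p q r, AnalyticAt ℂ (fun y : Fin n → ℂ => y p * (y q * y r)) z := fun p q r =>
    (hd p).fun_mul ((hd q).fun_mul (hd r))
  have h1 : ∀ p q r, AnalyticAt ℂ (fun y : Fin n → ℂ => M p q r * (y p * (y q * y r))) z :=
    fun p q r => analyticAt_const.fun_mul (h0 p q r)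
  have h2 : ∀ p q, AnalyticAt ℂ (fun y : Fin n → ℂ => ∑ r, M p q r * (y p * (y q * y r))) z :=
    fun p q => Finset.analyticAt_fun_sum _ fun r _ => h1 p q r
  have h3 : ∀ p, AnalyticAt ℂ (fun y : Fin n → ℂ => ∑ q, ∑ r, M p q r * (y p * (y q * y r))) z :=
    fun p => Finset.analyticAt_fun_sum _ fun q _ => h2 p q
  rw [pd_pd_pd_sum fun p _ => h3 p]
  simp only [pd_pd_pd_sum fun q _ => h2 _ q, pd_pd_pd_sum fun r _ => h1 _ _ r,
    pd_pd_pd_const_mul (h0 _ _ _), pd_pd_pd_monomial, mul_add, Finset.sum_add_distrib,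
    mul_ite, mul_one, mul_zero]
  simp

/-- The coefficients of the cubic part of the trigonometric prepotential. -/
noncomputable def cubicCoeff (k m : ℕ) (p q r : Fin (k + m)) : ℂ :=
  (if p = q ∧ q = r then -(Complex.I / (12 * m)) * (((m : ℂ) - 2) * ((m : ℂ) - 1) - m * k) else 0)
    + (if p = q ∧ q ≠ r then -(Complex.I / (4 * m) * (2 - (m : ℂ))) else 0)
    + (if p < q ∧ q < r then -(Complex.I / m) else 0)

variable {k m : ℕ}

theorem trigPrepotential_eq (L : Fin (k + m) → Fin (k + m) → ℂ → ℂ) (z : Fin (k + m) → ℂ) :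
    trigPrepotential k m L z = (∑ p, ∑ q, ∑ r, cubicCoeff k m p q r * (z p * (z q * z r)))
      + (1 / 2) * ∑ p, ∑ q,
        (if p ≠ q then L p q (Complex.exp (Complex.I * (z p - z q))) else 0) := by
  have h1 : ∀ A : ℂ, A * ∑ a, z a ^ 3
      = ∑ p, ∑ q, ∑ r, (if p = q ∧ q = r then A else 0) * (z p * (z q * z r)) := fun A => by
    simp only [ite_and, ite_mul, zero_mul, Finset.mul_sum, Finset.sum_ite_eq, Finset.mem_univ,
      if_true, Finset.sum_ite_irrel, Finset.sum_const_zero]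
    exact Finset.sum_congr rfl fun a _ => by ring
  have h2 : ∀ B : ℂ, B * ∑ a, z a ^ 2 * ∑ b, (if a ≠ b then z b else 0)
      = ∑ p, ∑ q, ∑ r, (if p = q ∧ q ≠ r then B else 0) * (z p * (z q * z r)) := fun B => by
    simp only [ite_and, ite_mul, zero_mul, Finset.mul_sum, Finset.sum_ite_eq, Finset.mem_univ,
      if_true, Finset.sum_ite_irrel, Finset.sum_const_zero]
    refine Finset.sum_congr rfl fun a _ => Finset.sum_congr rfl fun b _ => ?_
    split_ifs <;> ring
  have h3 : ∀ C : ℂ, C * ∑ a, ∑ b, ∑ c, (if a < b ∧ b < c then z a * z b * z c else 0)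
      = ∑ p, ∑ q, ∑ r, (if p < q ∧ q < r then C else 0) * (z p * (z q * z r)) := fun C => by
    simp only [Finset.mul_sum]
    refine Finset.sum_congr rfl fun a _ => Finset.sum_congr rfl fun b _ =>
      Finset.sum_congr rfl fun c _ => ?_
    split_ifs <;> ring
  simp only [cubicCoeff, add_mul, Finset.sum_add_distrib]
  rw [← h1, ← h2, ← h3, trigPrepotential]
  ring

/-- The linear form `z_p - z_q`. -/
noncomputable def diffForm (p q : Fin (k + m)) : (Fin (k + m) → ℂ) →L[ℂ] ℂ :=
  ContinuousLinearMap.proj (R := ℂ) (φ := fun _ : Fin (k + m) => ℂ) p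
    - ContinuousLinearMap.proj (R := ℂ) (φ := fun _ : Fin (k + m) => ℂ) q

theorem diffForm_apply (p q : Fin (k + m)) (z : Fin (k + m) → ℂ) :
    diffForm p q z = z p - z q := rfl

theorem diffForm_single (p q a : Fin (k + m)) :
    diffForm p q (Pi.single a 1) = (if p = a then 1 else 0) - (if q = a then 1 else 0) := by
  rw [diffForm_apply, Pi.single_apply, Pi.single_apply]

/-- The third derivatives of the trigonometric prepotential. -/
noncomputable def trigThird (x : Fin (k + m) → ℂ) (a b c : Fin (k + m)) : ℂ :=
  cubicCoeff k m a b c + cubicCoeff k m a c b + cubicCoeff k m b a c + cubicCoeff k m b c a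
    + cubicCoeff k m c a b + cubicCoeff k m c b a
    + (1 / 2) * ∑ p, ∑ q, (if p ≠ q then diffForm p q (Pi.single a 1)
      * diffForm p q (Pi.single b 1) * (diffForm p q (Pi.single c 1)
        * (-Complex.I * (x p / (x q - x p)))) else 0)

theorem trigThird_swap (x : Fin (k + m) → ℂ) (a b c : Fin (k + m)) :
    trigThird x a b c = trigThird x a c b := by
  have h : ∀ p q : Fin (k + m), (if p ≠ q then diffForm p q (Pi.single a 1)
      * diffForm p q (Pi.single b 1) * (diffForm p q (Pi.single c 1)
        * (-Complex.I * (x p / (x q - x p)))) else 0)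
      = (if p ≠ q then diffForm p q (Pi.single a 1)
      * diffForm p q (Pi.single c 1) * (diffForm p q (Pi.single b 1)
        * (-Complex.I * (x p / (x q - x p)))) else 0) := fun p q => by
    split_ifs <;> ring
  simp only [trigThird, h]
  ring

theorem exp_sub_eq (z : Fin (k + m) → ℂ) (p q : Fin (k + m)) :
    Complex.exp (Complex.I * (z p - z q)) = expCoord z p / expCoord z q := by
  rw [mul_sub, Complex.exp_sub]
  rfl

section Branch

variable {L : Fin (k + m) → Fin (k + m) → ℂ → ℂ} {z : Fin (k + m) → ℂ}

theorem analyticAt_trilogTerm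
    (hL : ∀ p q, p ≠ q → AnalyticAt ℂ (L p q) (Complex.exp (Complex.I * (z p - z q))))
    (p q : Fin (k + m)) : AnalyticAt ℂ (fun y : Fin (k + m) → ℂ =>
      if p ≠ q then L p q (Complex.exp (Complex.I * (y p - y q))) else 0) z := by
  by_cases h : p = q
  · simpa [h] using analyticAt_const
  · simp only [if_pos h]
    exact analyticAt_comp_linear (ℓ := diffForm p q) (analyticAt_comp_exp_I (hL p q h))

theorem analyticAt_trigPrepotential
    (hL : ∀ p q, p ≠ q → AnalyticAt ℂ (L p q) (Complex.exp (Complex.I * (z p - z q)))) :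
    AnalyticAt ℂ (trigPrepotential k m L) z := by
  rw [funext (trigPrepotential_eq L)]
  exact (analyticAt_cubic _ z).fun_add (analyticAt_const.fun_mul
    (Finset.analyticAt_fun_sum _ fun p _ => Finset.analyticAt_fun_sum _ fun q _ =>
      analyticAt_trilogTerm hL p q))

theorem pd_pd_pd_trigPrepotential (hx : IsRegular (expCoord z))
    (hL : ∀ p q, p ≠ q → AnalyticAt ℂ (L p q) (Complex.exp (Complex.I * (z p - z q)))
      ∧ TrilogEq (L p q) (Complex.exp (Complex.I * (z p - z q)))) (a b c : Fin (k + m)) :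
    pd a (pd b (pd c (trigPrepotential k m L))) z = trigThird (expCoord z) a b c := by
  have h1 := analyticAt_trilogTerm fun p q h => (hL p q h).1
  have h2 := fun p => Finset.analyticAt_fun_sum Finset.univ fun q _ => h1 p q
  have h3 := Finset.analyticAt_fun_sum Finset.univ fun p _ => h2 p
  rw [funext (trigPrepotential_eq L), pd_pd_pd_add (analyticAt_cubic _ z)
    (analyticAt_const.fun_mul h3), pd_pd_pd_cubic, pd_pd_pd_const_mul h3,
    pd_pd_pd_sum fun p _ => h2 p, trigThird]
  congr 2
  refine Finset.sum_congr rfl fun p _ => ?_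
  rw [pd_pd_pd_sum fun q _ => h1 p q]
  refine Finset.sum_congr rfl fun q _ => ?_
  by_cases h : p = q
  · simp only [h, ne_eq, not_true_eq_false, if_false, pd_zero]
  · have hw : Complex.exp (Complex.I * diffForm p q z) = expCoord z p / expCoord z q :=
      exp_sub_eq z p q
    have hq := expCoord_ne_zero z q
    have hpq := hx.sub_ne h
    have hne : Complex.exp (Complex.I * diffForm p q z) ≠ 1 := by
      rw [hw, Ne, div_eq_one_iff_eq hq]
      exact fun h' => hpq (sub_eq_zero.2 h')
    simp only [if_pos (show p ≠ q from h)]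
    refine (pd_pd_pd_comp_linear (f := fun s => L p q (Complex.exp (Complex.I * s)))
      (ℓ := diffForm p q) (analyticAt_comp_exp_I (hL p q h).1) a b c).trans ?_
    rw [deriv3_trilog_comp_exp_I (s := diffForm p q z) (hL p q h).1 (hL p q h).2 hne, hw]
    have hqp := hx.sub_ne (Ne.symm h)
    have h5 : 1 - expCoord z p / expCoord z q ≠ 0 := by
      rw [← hw]
      exact sub_ne_zero.2 hne.symm
    have h6 : expCoord z p / expCoord z q / (1 - expCoord z p / expCoord z q)
        = expCoord z p / (expCoord z q - expCoord z p) := by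
      field_simp
    rw [h6]
    ring

end Branch

/-- Sums over pairs of distinct indices against `(δ_pa - δ_qa)(δ_pb - δ_qb)`, for `a ≠ b`. -/
theorem sum_diffForm_of_ne {a b : Fin (k + m)} (hab : a ≠ b) (g : Fin (k + m) → Fin (k + m) → ℂ) :
    ∑ p, ∑ q, (if p ≠ q then diffForm p q (Pi.single a 1) * diffForm p q (Pi.single b 1) * g p q
      else 0) = -(g a b + g b a) := by
  have h : ∀ p q : Fin (k + m), (if p ≠ q then diffForm p q (Pi.single a 1)
      * diffForm p q (Pi.single b 1) * g p q else 0)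
      = -((if p = a then (if q = b then g p q else 0) else 0)
        + (if p = b then (if q = a then g p q else 0) else 0)) := by
    intro p q
    rw [diffForm_single, diffForm_single]
    by_cases hpa : p = a
    · subst hpa
      by_cases hqb : q = b
      · subst hqb
        simp [hab, hab.symm]
      · by_cases hqp : q = p
        · subst hqp
          simp [hab]
        · simp [hab, hqb, hqp]
    · by_cases hpb : p = b
      · subst hpb
        by_cases hqa : q = a
        · subst hqa
          simp [hab, hab.symm]
        · simp [hpa, hqa]
      · by_cases hqa : q = a
        · subst hqa
          simp [hpa, hpb, hab]
        · simp [hpa, hpb, hqa]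
  simp only [h, Finset.sum_neg_distrib, Finset.sum_add_distrib, Finset.sum_ite_irrel,
    Finset.sum_const_zero, Finset.sum_ite_eq', Finset.mem_univ, if_true]

theorem sum_diffForm_self (a : Fin (k + m)) (g : Fin (k + m) → Fin (k + m) → ℂ) :
    ∑ p, ∑ q, (if p ≠ q then diffForm p q (Pi.single a 1) * diffForm p q (Pi.single a 1) * g p q
      else 0) = ∑ q ∈ Finset.univ.erase a, (g a q + g q a) := by
  have h : ∀ p q : Fin (k + m), (if p ≠ q then diffForm p q (Pi.single a 1)
      * diffForm p q (Pi.single a 1) * g p q else 0)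
      = (if p = a then (if q = a then 0 else g a q) else 0)
        + (if q = a then (if p = a then 0 else g p a) else 0) := by
    intro p q
    rw [diffForm_single]
    by_cases hpa : p = a
    · subst hpa
      by_cases hqp : q = p
      · subst hqp
        simp
      · simp [hqp, Ne.symm hqp]
    · by_cases hqa : q = a
      · subst hqa
        simp [hpa]
      · simp [hpa, hqa]
  have h2 : ∀ f : Fin (k + m) → ℂ, ∑ q ∈ Finset.univ.erase a, f q
      = ∑ q, if q = a then 0 else f q := fun f => by
    rw [← Finset.add_sum_erase _ _ (Finset.mem_univ a), if_pos rfl, zero_add]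
    exact Finset.sum_congr rfl fun q hq => (if_neg (Finset.ne_of_mem_erase hq)).symm
  rw [Finset.sum_add_distrib]
  simp only [h, Finset.sum_add_distrib, Finset.sum_ite_irrel, Finset.sum_const_zero,
    Finset.sum_ite_eq', Finset.mem_univ, if_true, h2]

theorem sum_cubicCoeff_of_ne {a b : Fin (k + m)} (hm : 0 < m) (hab : a ≠ b) (c : Fin (k + m)) :
    cubicCoeff k m a b c + cubicCoeff k m a c b + cubicCoeff k m b a c + cubicCoeff k m b c a
      + cubicCoeff k m c a b + cubicCoeff k m c b a
      = -(Complex.I / m)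
        + Complex.I / 2 * ((if a = c then 1 else 0) + (if b = c then 1 else 0)) := by
  have hm' : (m : ℂ) ≠ 0 := by exact_mod_cast hm.ne'
  by_cases hac : a = c
  · subst hac
    simp only [cubicCoeff, hab, hab.symm, false_and, and_false, if_true, if_false, ne_eq,
      not_false_eq_true, and_self, not_true_eq_false, lt_irrefl,
      show ¬ (a < b ∧ b < a) from fun h => lt_asymm h.1 h.2]
    field_simp
    ring
  by_cases hbc : b = c
  · subst hbc
    simp only [cubicCoeff, hab, hab.symm, false_and, and_false, if_true, if_false, ne_eq,
      not_false_eq_true, and_self, not_true_eq_false, lt_irrefl,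
      show ¬ (b < a ∧ a < b) from fun h => lt_asymm h.1 h.2]
    field_simp
    ring
  simp only [cubicCoeff, hab, hab.symm, hac, hbc, Ne.symm hac, Ne.symm hbc, false_and, if_false]
  rcases lt_or_gt_of_ne hab with h1 | h1 <;> rcases lt_or_gt_of_ne hac with h2 | h2 <;>
    rcases lt_or_gt_of_ne hbc with h3 | h3 <;>
    simp [h1, h2, h3, h1.not_gt, h2.not_gt, h3.not_gt] <;> order

theorem trigThird_eq (hk : 0 < k) (hm : 0 < m) {x : Fin (k + m) → ℂ} (hx : IsRegular x)
    (a b c : Fin (k + m)) :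
    trigThird x a b c = -Complex.I * ∑ u ∈ critRoots x,
      ratio x u a * ratio x u b * ratio x u c / hess x u := by
  have hm' : (m : ℂ) ≠ 0 := by exact_mod_cast hm.ne'
  have hne : ∀ a b c : Fin (k + m), a ≠ b → trigThird x a b c = -Complex.I * ∑ u ∈ critRoots x,
      ratio x u a * ratio x u b * ratio x u c / hess x u := by
    intro a b c hab
    have h1 := hx.sub_ne hab
    have h2 := hx.sub_ne hab.symm
    rw [trigThird, sum_diffForm_of_ne hab, hx.sum_ratio_mul_mul_div_hess_of_ne hk hm hab,
      sum_cubicCoeff_of_ne hm hab, diffForm_single, diffForm_single,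
      show x b - x a = -(x a - x b) by ring]
    generalize (if a = c then (1 : ℂ) else 0) = s
    generalize (if b = c then (1 : ℂ) else 0) = t
    field_simp
    ring
  by_cases hab : a = b
  · subst hab
    by_cases hac : a = c
    · subst hac
      have hg : ∀ q ∈ Finset.univ.erase a, diffForm a q (Pi.single a 1)
            * (-Complex.I * (x a / (x q - x a)))
          + diffForm q a (Pi.single a 1) * (-Complex.I * (x q / (x a - x q)))
          = 2 * Complex.I * (x q / (x a - x q) + 1 / m) + Complex.I * (1 - 2 / m) := by
        intro q hq
        have hqa := Finset.ne_of_mem_erase hq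
        have h1 := hx.sub_ne hqa.symm
        rw [diffForm_single, diffForm_single, if_pos rfl, if_neg hqa,
          show x q - x a = -(x a - x q) by ring]
        field_simp
        ring
      have hcard : ((k + m - 1 : ℕ) : ℂ) = k + m - 1 := by
        rw [Nat.cast_sub (by omega)]
        push_cast
        ring
      rw [trigThird, sum_diffForm_self, hx.sum_ratio_cube_div_hess hk hm, Finset.sum_congr rfl hg,
        Finset.sum_add_distrib, ← Finset.mul_sum, Finset.sum_const,
        Finset.card_erase_of_mem (Finset.mem_univ a), Finset.card_univ, Fintype.card_fin,
        nsmul_eq_mul, hcard]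
      generalize ∑ q ∈ Finset.univ.erase a, (x q / (x a - x q) + 1 / (m : ℂ)) = T
      simp only [cubicCoeff, and_self, if_true, ne_eq, not_true_eq_false, and_false, if_false,
        lt_irrefl]
      field_simp
      ring
    · rw [trigThird_swap, hne a c a hac]
      congr 1
      exact Finset.sum_congr rfl fun u _ => by ring
  · exact hne a b c hab

end TrigPrepotential

end HurwitzLegendre

namespace HurwitzLegendre

/-! ### The rational prepotential -/

section RatPrepotential

open HurwitzData

variable {k m : ℕ}

/-- The linear forms `zhat^i`, for `0 ≤ i ≤ k + m`. -/
noncomputable def extForm (k m : ℕ) : Fin (k + m + 1) → (Fin (k + m) → ℂ) →L[ℂ] ℂ :=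
  Fin.cons ((m : ℂ)⁻¹ • ∑ a, ContinuousLinearMap.proj (R := ℂ) (φ := fun _ : Fin (k + m) => ℂ) a)
    fun a => ContinuousLinearMap.proj (R := ℂ) (φ := fun _ : Fin (k + m) => ℂ) a

theorem extForm_zero (y : Fin (k + m) → ℂ) : extForm k m 0 y = zhatZero k m y := by
  simp only [extForm, Fin.cons_zero, _root_.smul_apply, _root_.sum_apply,
    ContinuousLinearMap.proj_apply, smul_eq_mul, zhatZero]
  ring

theorem extForm_succ (y : Fin (k + m) → ℂ) (a : Fin (k + m)) : extForm k m a.succ y = y a := by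
  simp [extForm]

theorem extForm_apply (y : Fin (k + m) → ℂ) (i : Fin (k + m + 1)) :
    extForm k m i y = extCoord k m y i := by
  refine Fin.cases ?_ (fun a => ?_) i
  · rw [extForm_zero, extCoord, Fin.cons_zero]
  · rw [extForm_succ, extCoord, Fin.cons_succ]

/-- The derivative of a second partial derivative of the rational prepotential. -/
noncomputable def ratThird (y Y Z : Fin (k + m) → ℂ) : (Fin (k + m) → ℂ) →L[ℂ] ℂ :=
  ∑ i, ∑ j, (if i < j then alpha k m i * alpha k m j * (extForm k m i - extForm k m j) Y
    * (extForm k m i - extForm k m j) Z / (extForm k m i - extForm k m j) y else 0)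
      • (extForm k m i - extForm k m j)

theorem ratThird_apply (y X Y Z : Fin (k + m) → ℂ) :
    ratThird y Y Z X = ∑ i, ∑ j, (if i < j then alpha k m i * alpha k m j
      * (extForm k m i - extForm k m j) Y * (extForm k m i - extForm k m j) Z
        / (extForm k m i - extForm k m j) y * (extForm k m i - extForm k m j) X else 0) := by
  simp only [ratThird, _root_.sum_apply, _root_.smul_apply, smul_eq_mul, ite_mul, zero_mul]

section Branch

variable {ℓ : Fin (k + m + 1) → Fin (k + m + 1) → ℂ → ℂ} {y : Fin (k + m) → ℂ}

theorem analyticAt_logTerm (hℓ : ∀ i j, i < j → IsLogBranchAt (ℓ i j)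
    ((extCoord k m y i - extCoord k m y j) ^ 2)) (i j : Fin (k + m + 1)) :
    AnalyticAt ℂ (fun y => if i < j then alpha k m i * alpha k m j
      * (extCoord k m y i - extCoord k m y j) ^ 2
      * ℓ i j ((extCoord k m y i - extCoord k m y j) ^ 2) else 0) y := by
  by_cases h : i < j
  · simp only [if_pos h, ← extForm_apply, mul_assoc] at hℓ ⊢
    exact analyticAt_const.fun_mul (analyticAt_const.fun_mul
      (analyticAt_comp_linear (f := fun s => s ^ 2 * ℓ i j (s ^ 2))
        (ℓ := extForm k m i - extForm k m j) (analyticAt_sq_mul_log (hℓ i j h))))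
  · simpa only [if_neg h] using analyticAt_const

theorem analyticAt_ratPrepotential (hℓ : ∀ i j, i < j → IsLogBranchAt (ℓ i j)
    ((extCoord k m y i - extCoord k m y j) ^ 2)) : AnalyticAt ℂ (ratPrepotential k m ℓ) y :=
  analyticAt_const.fun_mul (Finset.analyticAt_fun_sum _ fun i _ =>
    Finset.analyticAt_fun_sum _ fun j _ => analyticAt_logTerm hℓ i j)

theorem pd_pd_pd_ratPrepotential (hℓ : ∀ i j, i < j → IsLogBranchAt (ℓ i j)
    ((extCoord k m y i - extCoord k m y j) ^ 2)) (a b c : Fin (k + m)) :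
    pd a (pd b (pd c (ratPrepotential k m ℓ))) y
      = ratThird y (Pi.single b 1) (Pi.single c 1) (Pi.single a 1) := by
  have h1 := analyticAt_logTerm hℓ
  have h2 := fun i => Finset.analyticAt_fun_sum Finset.univ fun j _ => h1 i j
  have h3 := Finset.analyticAt_fun_sum Finset.univ fun i _ => h2 i
  rw [ratThird_apply]
  refine (pd_pd_pd_const_mul h3 a b c _).trans ?_
  rw [pd_pd_pd_sum fun i _ => h2 i, Finset.mul_sum]
  refine Finset.sum_congr rfl fun i _ => ?_
  rw [pd_pd_pd_sum fun j _ => h1 i j, Finset.mul_sum]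
  refine Finset.sum_congr rfl fun j _ => ?_
  by_cases h : i < j
  · have hb := hℓ i j h
    simp only [if_pos h, ← extForm_apply, mul_assoc] at hb ⊢
    have hs : (extForm k m i - extForm k m j) y ≠ 0 := fun h0 => by
      have h4 := hb.2.self_of_nhds
      rw [← _root_.sub_apply, h0, zero_pow two_ne_zero] at h4
      exact Complex.exp_ne_zero _ h4
    have h5 := analyticAt_comp_linear (f := fun s => s ^ 2 * ℓ i j (s ^ 2))
      (ℓ := extForm k m i - extForm k m j) (analyticAt_sq_mul_log hb)
    have h6 := pd_pd_pd_comp_linear (f := fun s => s ^ 2 * ℓ i j (s ^ 2))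
      (ℓ := extForm k m i - extForm k m j) (analyticAt_sq_mul_log hb) a b c
    rw [deriv3_sq_mul_log hs hb] at h6
    have h7 := pd_pd_pd_const_mul h5 a b c (alpha k m i * alpha k m j)
    simp only [mul_assoc] at h7
    refine (congrArg (1 / 4 * ·) (h7.trans (congrArg _ (congrArg _ h6)))).trans ?_
    field_simp
  · simp only [if_neg h, pd_zero, mul_zero]

theorem fderiv_pd_pd_ratPrepotential (hℓ : ∀ i j, i < j → IsLogBranchAt (ℓ i j)
    ((extCoord k m y i - extCoord k m y j) ^ 2)) (b c : Fin (k + m)) :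
    fderiv ℂ (pd b (pd c (ratPrepotential k m ℓ))) y
      = ratThird y (Pi.single b 1) (Pi.single c 1) := by
  refine ContinuousLinearMap.coe_injective ((Pi.basisFun ℂ (Fin (k + m))).ext fun a => ?_)
  rw [Pi.basisFun_apply]
  exact pd_pd_pd_ratPrepotential hℓ a b c

end Branch

theorem sum_lt_eq_half {g : Fin (k + m) → Fin (k + m) → ℂ} (hg : ∀ p q, g p q = g q p) :
    ∑ p, ∑ q, (if p < q then g p q else 0) = (1 / 2) * ∑ p, ∑ q, (if p ≠ q then g p q else 0) := by
  have h1 : ∀ p q : Fin (k + m), (if p ≠ q then g p q else 0)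
      = (if p < q then g p q else 0) + (if q < p then g q p else 0) := fun p q => by
    rcases lt_trichotomy p q with h | h | h
    · simp [h, h.ne, h.not_gt]
    · simp [h]
    · simp [h, h.ne', h.not_gt, hg p q]
  have h2 : ∑ p, ∑ q, (if q < p then g q p else 0) = ∑ p, ∑ q, (if p < q then g p q else 0) :=
    Finset.sum_comm
  simp only [h1, Finset.sum_add_distrib, h2]
  ring

section Coord

variable {z : Fin (k + m) → ℂ}

theorem extForm_zero_fderiv (hk : 0 < k) (hm : 0 < m) (z X : Fin (k + m) → ℂ) :
    extForm k m 0 (fderiv ℂ (coordChange k m) z X)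
      = -(∑ b, Complex.I * expCoord z b * X b) / k := by
  have hk' : (k : ℂ) ≠ 0 := by exact_mod_cast hk.ne'
  have hm' : (m : ℂ) ≠ 0 := by exact_mod_cast hm.ne'
  rw [extForm_zero, zhatZero]
  simp only [fderiv_coordChange, Finset.sum_sub_distrib, Finset.sum_const, Finset.card_univ,
    Fintype.card_fin, nsmul_eq_mul]
  push_cast
  field_simp
  ring

/-- Contracting one index with the Jacobian removes the poles at `x_p = 0`. -/
theorem ratThird_coordChange (hk : 0 < k) (hm : 0 < m) (hx : IsRegular (expCoord z))
    (X : Fin (k + m) → ℂ) (a b : Fin (k + m)) :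
    ratThird (coordChange k m z) (Pi.single a 1) (Pi.single b 1) (fderiv ℂ (coordChange k m) z X)
      = -(Complex.I * m * ∑ p, X p * ((1 / m - if p = a then 1 else 0)
          * (1 / m - if p = b then 1 else 0)))
        + (1 / 2) * ∑ p, ∑ q, (if p ≠ q then diffForm p q (Pi.single a 1)
          * diffForm p q (Pi.single b 1) * (Complex.I * (expCoord z p * X p - expCoord z q * X q)
            / (expCoord z p - expCoord z q)) else 0) := by
  have hm' : (m : ℂ) ≠ 0 := by exact_mod_cast hm.ne'
  have hz : ∀ a : Fin (k + m), extForm k m 0 (Pi.single a 1) = 1 / m := fun a => by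
    rw [extForm_zero, zhatZero, Finset.sum_pi_single']
    simp
  rw [ratThird_apply, Fin.sum_univ_succ, Fin.sum_univ_succ]
  simp only [Fin.sum_univ_succ (n := k + m), lt_self_iff_false, if_false, zero_add, Fin.succ_pos,
    if_true, Fin.not_lt_zero, Fin.succ_lt_succ_iff, _root_.sub_apply, extForm_succ,
    extForm_zero_fderiv hk hm, hz, fderiv_coordChange, alpha, Fin.cons_zero, Fin.cons_succ,
    Pi.single_apply, diffForm_apply]
  rw [sum_lt_eq_half (fun p q => by
    rw [show coordChange k m z p - coordChange k m z q
      = -(coordChange k m z q - coordChange k m z p) by ring, div_neg]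
    ring)]
  congr 1
  · rw [neg_mul_eq_neg_mul, Finset.mul_sum]
    refine Finset.sum_congr rfl fun p _ => ?_
    have hp := hx.ne_zero p
    rw [extForm_zero, ← neg_sub (coordChange k m z p), coordChange_sub_zhatZero hk hm]
    field_simp
    ring
  · congr 1
    refine Finset.sum_congr rfl fun p _ => Finset.sum_congr rfl fun q _ => ?_
    rw [← sub_sub_sub_cancel_right (coordChange k m z p) _ (zhatZero k m (coordChange k m z)),
      coordChange_sub_zhatZero hk hm, coordChange_sub_zhatZero hk hm]
    split_ifs <;> ring

theorem ratThird_coordChange_single (hk : 0 < k) (hm : 0 < m) (hx : IsRegular (expCoord z))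
    (a b c : Fin (k + m)) :
    ratThird (coordChange k m z) (Pi.single a 1) (Pi.single b 1)
        (fderiv ℂ (coordChange k m) z (Pi.single c 1))
      = -Complex.I * ∑ u ∈ critRoots (expCoord z), ratio (expCoord z) u a * ratio (expCoord z) u b
        * ratio (expCoord z) u c / hess (expCoord z) u := by
  have hm' : (m : ℂ) ≠ 0 := by exact_mod_cast hm.ne'
  have hs : ∀ f : Fin (k + m) → ℂ, ∑ p, (Pi.single c 1 : Fin (k + m) → ℂ) p * f p = f c :=
    fun f => by simp [Pi.single_apply]
  rw [ratThird_coordChange hk hm hx, hs]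
  by_cases hab : a = b
  · subst hab
    rw [sum_diffForm_self]
    simp only [Pi.single_apply]
    by_cases hac : a = c
    · subst hac
      have hg : ∀ q ∈ Finset.univ.erase a, Complex.I * (expCoord z a * (if a = a then 1 else 0)
            - expCoord z q * (if q = a then 1 else 0)) / (expCoord z a - expCoord z q)
          + Complex.I * (expCoord z q * (if q = a then 1 else 0)
            - expCoord z a * (if a = a then 1 else 0)) / (expCoord z q - expCoord z a)
          = 2 * Complex.I * (expCoord z q / (expCoord z a - expCoord z q) + 1 / m)
            + 2 * Complex.I * (1 - 1 / m) := by
        intro q hq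
        have hqa := Finset.ne_of_mem_erase hq
        have h1 := hx.sub_ne hqa.symm
        rw [if_pos rfl, if_neg hqa,
          show expCoord z q - expCoord z a = -(expCoord z a - expCoord z q) by ring]
        field_simp
        ring
      have hcard : ((k + m - 1 : ℕ) : ℂ) = k + m - 1 := by
        rw [Nat.cast_sub (by omega)]
        push_cast
        ring
      rw [hx.sum_ratio_cube_div_hess hk hm, Finset.sum_congr rfl hg, if_pos rfl,
        Finset.sum_add_distrib, ← Finset.mul_sum, Finset.sum_const,
        Finset.card_erase_of_mem (Finset.mem_univ a), Finset.card_univ, Fintype.card_fin,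
        nsmul_eq_mul, hcard]
      generalize ∑ q ∈ Finset.univ.erase a,
        (expCoord z q / (expCoord z a - expCoord z q) + 1 / (m : ℂ)) = T
      field_simp
      ring
    · have h1 := hx.sub_ne hac
      have h2 : ∑ u ∈ critRoots (expCoord z), ratio (expCoord z) u a * ratio (expCoord z) u a
          * ratio (expCoord z) u c / hess (expCoord z) u
          = ∑ u ∈ critRoots (expCoord z), ratio (expCoord z) u a * ratio (expCoord z) u c
          * ratio (expCoord z) u a / hess (expCoord z) u :=
        Finset.sum_congr rfl fun u _ => by ring
      rw [h2, hx.sum_ratio_mul_mul_div_hess_of_ne hk hm hac, if_pos rfl, if_neg (Ne.symm hac),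
        if_neg hac, Finset.sum_eq_single c]
      · rw [if_pos rfl, show expCoord z c - expCoord z a = -(expCoord z a - expCoord z c) by ring]
        field_simp
        ring
      · intro q _ hqc
        rw [if_neg hqc]
        simp
      · exact fun h => absurd (Finset.mem_erase.2 ⟨Ne.symm hac, Finset.mem_univ c⟩) h
  · have h1 := hx.sub_ne hab
    rw [sum_diffForm_of_ne hab, hx.sum_ratio_mul_mul_div_hess_of_ne hk hm hab,
      show expCoord z b - expCoord z a = -(expCoord z a - expCoord z b) by ring]
    simp only [Pi.single_apply, eq_comm (a := c)]
    by_cases hac : a = c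
    · have hbc : b ≠ c := fun h => hab (hac.trans h.symm)
      rw [if_pos hac, if_neg hbc]
      field_simp
      ring
    · rw [if_neg hac]
      by_cases hbc : b = c
      · rw [if_pos hbc]
        field_simp
        ring
      · rw [if_neg hbc]
        field_simp
        ring

/-- The third derivatives of the rational prepotential are the components of `(X ⋆ Y, Z)_κ`. -/
theorem ratThird_eq_dualCubic (hk : 0 < k) (hm : 0 < m) (hx : IsRegular (expCoord z))
    (a b : Fin (k + m)) (X : Fin (k + m) → ℂ) :
    ratThird (coordChange k m z) (Pi.single a 1) (Pi.single b 1) X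
      = (ratData k m).dualCubic (coordChange k m z) X (Pi.single a 1) (Pi.single b 1) := by
  obtain ⟨X, rfl⟩ := (bijective_fderiv_coordChange hk hm z).2 X
  rw [rat_dualCubic_mixed hk hm hx]
  have h1 := map_eq_sum_single ((ratThird (coordChange k m z) (Pi.single a 1) (Pi.single b 1)).comp
    (fderiv ℂ (coordChange k m) z)).toLinearMap X
  refine h1.trans ?_
  have h2 : ∀ c, ((ratThird (coordChange k m z) (Pi.single a 1) (Pi.single b 1)).comp
      (fderiv ℂ (coordChange k m) z)).toLinearMap (Pi.single c 1)
      = (trigData k m).dualCubic z (Pi.single c 1) (Pi.single a 1) (Pi.single b 1) := fun c => by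
    refine (ratThird_coordChange_single hk hm hx a b c).trans ?_
    rw [trig_dualCubic hk hm hx]
    congr 1
    exact Finset.sum_congr rfl fun u _ => by ring
  simp only [h2, (trig_frame hk hm hx).dualCubic_eq, smul_eq_mul, Finset.mul_sum]
  rw [Finset.sum_comm]
  refine Finset.sum_congr rfl fun u _ => ?_
  rw [map_eq_sum_single ((trigData k m).comp z trigPt) X]
  simp only [Finset.sum_apply, Pi.smul_apply, smul_eq_mul, Finset.sum_mul, Finset.mul_sum,
    Finset.sum_div]
  exact Finset.sum_congr rfl fun c _ => by ring

end Coord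

end RatPrepotential

end HurwitzLegendre

namespace HurwitzLegendre

/-! ### The dual prepotentials and the twisted Legendre transformation -/

section Dual

open HurwitzData

theorem HurwitzData.IsCanonicalFrame.isDualPrepotentialAt {n : ℕ} {S : HurwitzData n}
    {z : Fin n → ℂ} {U : Finset ℂ} {pt : ℂ → ℂ} (h : S.IsCanonicalFrame z U pt)
    {F : (Fin n → ℂ) → ℂ} (hF : AnalyticAt ℂ F z)
    (hflat : ∀ᶠ y in 𝓝 z, gram (S.dualEta y) = gram (S.dualEta z))
    (hthird : ∀ a b c, pd a (pd b (pd c F)) z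
      = S.dualCubic z (Pi.single a 1) (Pi.single b 1) (Pi.single c 1)) :
    S.IsDualPrepotentialAt F z where
  analytic := hF
  flat := hflat
  third := hthird
  wdvv a b c d := by
    simp only [hthird]
    rw [h.wdvv, h.wdvv]
    exact Finset.sum_congr rfl fun u _ => by ring

variable {k m : ℕ} {z : Fin (k + m) → ℂ} {L : Fin (k + m) → Fin (k + m) → ℂ → ℂ}
  {ℓ : Fin (k + m + 1) → Fin (k + m + 1) → ℂ → ℂ}

theorem trig_isDualPrepotentialAt (hk : 0 < k) (hm : 0 < m) (hx : IsRegular (expCoord z))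
    (hL : ∀ a b, a ≠ b → IsTrilogBranchAt (L a b) (Complex.exp (Complex.I * (z a - z b)))) :
    (trigData k m).IsDualPrepotentialAt (trigPrepotential k m L) z := by
  have hL' := fun a b hab => (hL a b hab).trilogEq
  refine (trig_frame hk hm hx).isDualPrepotentialAt
    (analyticAt_trigPrepotential fun a b hab => (hL' a b hab).1) ?_ fun a b c => ?_
  · filter_upwards [eventually_isRegular hk hm hx] with y hy
    rw [trig_dualEta hk hm hx, trig_dualEta hk hm hy]
  · rw [pd_pd_pd_trigPrepotential hx hL', trigThird_eq hk hm hx, trig_dualCubic hk hm hx]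

theorem map_nhds_coordChange (hk : 0 < k) (hm : 0 < m) (z : Fin (k + m) → ℂ) :
    map (coordChange k m) (𝓝 z) = 𝓝 (coordChange k m z) := by
  refine (hasStrictFDerivAt_coordChange z).map_nhds_eq_of_surj (LinearMap.range_eq_top.2 ?_)
  have h := (bijective_fderiv_coordChange hk hm z).2
  rw [(hasStrictFDerivAt_coordChange z).hasFDerivAt.fderiv] at h
  exact h

theorem rat_isDualPrepotentialAt (hk : 0 < k) (hm : 0 < m) (hx : IsRegular (expCoord z))
    (hℓ : ∀ i j, i < j → IsLogBranchAt (ℓ i j)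
      ((extCoord k m (coordChange k m z) i - extCoord k m (coordChange k m z) j) ^ 2)) :
    (ratData k m).IsDualPrepotentialAt (ratPrepotential k m ℓ) (coordChange k m z) := by
  refine (rat_frame hk hm hx).isDualPrepotentialAt (analyticAt_ratPrepotential hℓ) ?_
    fun a b c => ?_
  · rw [← map_nhds_coordChange hk hm, eventually_map]
    filter_upwards [eventually_isRegular hk hm hx] with y hy
    rw [rat_dualEta hk hm hx, rat_dualEta hk hm hy, trig_dualEta hk hm hx, trig_dualEta hk hm hy]
  · rw [pd_pd_pd_ratPrepotential hℓ, ratThird_eq_dualCubic hk hm hx]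

theorem eventually_trilogEq
    (hL : ∀ a b, a ≠ b → AnalyticAt ℂ (L a b) (Complex.exp (Complex.I * (z a - z b)))
      ∧ TrilogEq (L a b) (Complex.exp (Complex.I * (z a - z b)))) :
    ∀ᶠ y in 𝓝 z, ∀ a b, a ≠ b → AnalyticAt ℂ (L a b) (Complex.exp (Complex.I * (y a - y b)))
      ∧ TrilogEq (L a b) (Complex.exp (Complex.I * (y a - y b))) := by
  refine eventually_all.2 fun a => eventually_all.2 fun b => ?_
  by_cases hab : a = b
  · exact Eventually.of_forall fun y h => absurd hab h
  · have hc : Continuous fun y : Fin (k + m) → ℂ => Complex.exp (Complex.I * (y a - y b)) := by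
      fun_prop
    have h := (hL a b hab).1.eventually_analyticAt.and (eventually_eventually_nhds.2 (hL a b hab).2)
    exact (hc.continuousAt.eventually h).mono fun y hy _ => hy

theorem eventually_isLogBranchAt (hℓ : ∀ i j, i < j → IsLogBranchAt (ℓ i j)
      ((extCoord k m (coordChange k m z) i - extCoord k m (coordChange k m z) j) ^ 2)) :
    ∀ᶠ y in 𝓝 z, ∀ i j, i < j → IsLogBranchAt (ℓ i j)
      ((extCoord k m (coordChange k m y) i - extCoord k m (coordChange k m y) j) ^ 2) := by
  refine eventually_all.2 fun i => eventually_all.2 fun j => ?_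
  by_cases hij : i < j
  · have hc : ContinuousAt (fun y => (extCoord k m (coordChange k m y) i
        - extCoord k m (coordChange k m y) j) ^ 2) z := by
      have h := (hasStrictFDerivAt_coordChange z).hasFDerivAt.continuousAt
      simp only [← extForm_apply]
      exact (((extForm k m i).continuous.continuousAt.comp h).sub
        ((extForm k m j).continuous.continuousAt.comp h)).pow 2
    exact (hc.eventually (hℓ i j hij).eventually).mono fun y hy _ => hy
  · exact Eventually.of_forall fun y h => absurd h hij

/-- Both third derivatives are the mixed components `(∂_{z^c} ⋆ ∂_{zhat^a}, ∂_{zhat^b})_κ`, hence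
the difference of the Hessians has derivative zero. -/
theorem hasFDerivAt_hessian_sub (hk : 0 < k) (hm : 0 < m) (hx : IsRegular (expCoord z))
    (hL : ∀ a b, a ≠ b → AnalyticAt ℂ (L a b) (Complex.exp (Complex.I * (z a - z b)))
      ∧ TrilogEq (L a b) (Complex.exp (Complex.I * (z a - z b))))
    (hℓ : ∀ i j, i < j → IsLogBranchAt (ℓ i j)
      ((extCoord k m (coordChange k m z) i - extCoord k m (coordChange k m z) j) ^ 2))
    (a b : Fin (k + m)) :
    HasFDerivAt (fun y => pd a (pd b (ratPrepotential k m ℓ)) (coordChange k m y)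
      - pd a (pd b (trigPrepotential k m L)) y) (0 : (Fin (k + m) → ℂ) →L[ℂ] ℂ) z := by
  have h1 := (analyticAt_pd (analyticAt_pd (analyticAt_ratPrepotential hℓ) b)
    a).differentiableAt.hasFDerivAt
  have h2 := (analyticAt_pd (analyticAt_pd (analyticAt_trigPrepotential
    fun a b hab => (hL a b hab).1) b) a).differentiableAt.hasFDerivAt
  have h3 := (hasStrictFDerivAt_coordChange z).hasFDerivAt.differentiableAt.hasFDerivAt
  refine ((h1.comp z h3).sub h2).congr_fderiv (sub_eq_zero.2 ?_)
  refine ContinuousLinearMap.coe_injective ((Pi.basisFun ℂ (Fin (k + m))).ext fun c => ?_)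
  rw [Pi.basisFun_apply, fderiv_pd_pd_ratPrepotential hℓ]
  refine (ratThird_coordChange_single hk hm hx a b c).trans ?_
  refine Eq.trans ?_ (pd_pd_pd_trigPrepotential hx hL c a b).symm
  rw [trigThird_eq hk hm hx]
  congr 1
  exact Finset.sum_congr rfl fun u _ => by ring

theorem hessian_eq (hk : 0 < k) (hm : 0 < m) (hx : IsRegular (expCoord z))
    (hL : ∀ a b, a ≠ b → IsTrilogBranchAt (L a b) (Complex.exp (Complex.I * (z a - z b))))
    (hℓ : ∀ i j, i < j → IsLogBranchAt (ℓ i j)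
      ((extCoord k m (coordChange k m z) i - extCoord k m (coordChange k m z) j) ^ 2)) :
    ∃ K : Matrix (Fin (k + m)) (Fin (k + m)) ℂ, ∀ᶠ y in 𝓝 z, ∀ a b,
      pd a (pd b (ratPrepotential k m ℓ)) (coordChange k m y)
        = pd a (pd b (trigPrepotential k m L)) y + K a b := by
  obtain ⟨r, hr, hball⟩ := Metric.eventually_nhds_iff_ball.1 ((eventually_isRegular hk hm hx).and
    ((eventually_trilogEq fun a b hab => (hL a b hab).trilogEq).and (eventually_isLogBranchAt hℓ)))
  have hconst : ∀ a b, ∃ K, ∀ y ∈ Metric.ball z r,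
      pd a (pd b (ratPrepotential k m ℓ)) (coordChange k m y)
        - pd a (pd b (trigPrepotential k m L)) y = K := fun a b => by
    have hd : ∀ y ∈ Metric.ball z r, _ := fun y hy =>
      hasFDerivAt_hessian_sub hk hm (hball y hy).1 (hball y hy).2.1 (hball y hy).2.2 a b
    exact Metric.isOpen_ball.exists_is_const_of_fderiv_eq_zero (convex_ball z r).isPreconnected
      (fun y hy => (hd y hy).differentiableAt.differentiableWithinAt)
      fun y hy => (hd y hy).fderiv
  choose K hK using hconst
  refine ⟨Matrix.of K, ?_⟩
  filter_upwards [Metric.ball_mem_nhds z hr] with y hy a b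
  rw [Matrix.of_apply, ← hK a b y hy]
  ring

end Dual

end HurwitzLegendre
theorem mainTheorem4 (k m : ℕ) (hk : 0 < k) (hm : 0 < m) :
    ∃ V W : (Fin (k + m) → ℂ) → Fin (k + m) → ℂ,
      AnalyticOnNhd ℂ V (regularLocus k m) ∧
      AnalyticOnNhd ℂ W (regularLocus k m) ∧
      ∀ z ∈ regularLocus k m,
        -- both families describe one superpotential, in two systems of coordinates
        (Function.Bijective (fderiv ℂ (coordChange k m) z) ∧
          ∀ p : ℂ, (ratData k m).lam (coordChange k m z)
              (Complex.exp (Complex.I * p)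
                + zhatZero k m (coordChange k m z))
            = (trigData k m).lam z p) ∧
        -- the Euler field
        (trigData k m).IsEulerAt (trigEuler k m) z ∧
        (ratData k m).IsEulerAt (ratEuler k m)
          (coordChange k m z) ∧
        fderiv ℂ (coordChange k m) z (trigEuler k m z)
          = ratEuler k m (coordChange k m z) ∧
        -- the dual structures
        (trigData k m).IsDualAt (trigEuler k m) z ∧
        (ratData k m).IsDualAt (ratEuler k m)
          (coordChange k m z) ∧
        -- the change of primary differential, d phat = ∂_κ (λ dp) on dλ = 0, is a
        -- Legendre transformation
        (∀ v ∈ (trigData k m).crit z,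
          (trigData k m).var z (V z) v
            = Complex.I * Complex.exp (Complex.I * v)) ∧
        IsLegendreAt (trigData k m)
          (ratData k m) (coordChange k m) V z ∧
        -- the two dual prepotentials, and the twisted Legendre transformation between them
        ∀ (L : Fin (k + m) → Fin (k + m) → ℂ → ℂ)
          (ℓ : Fin (k + m + 1) → Fin (k + m + 1) → ℂ → ℂ),
          (∀ a b, a ≠ b → IsTrilogBranchAt (L a b)
            (Complex.exp (Complex.I * (z a - z b)))) →
          (∀ i j, i < j → IsLogBranchAt (ℓ i j)
            ((extCoord k m (coordChange k m z) i
              - extCoord k m (coordChange k m z) j) ^ 2)) →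
          (trigData k m).IsDualPrepotentialAt
            (trigPrepotential k m L) z ∧
          (ratData k m).IsDualPrepotentialAt
            (ratPrepotential k m ℓ) (coordChange k m z) ∧
          IsTwistedLegendreAt (trigData k m)
            (ratData k m) (coordChange k m)
            (trigEuler k m) V W
            (trigPrepotential k m L)
            (ratPrepotential k m ℓ) z := by
  refine ⟨legendreField k m, twistedField k m,
    fun z hz => analyticAt_legendreField ((mem_regularLocus_iff hm).1 hz),
    fun z _ => analyticAt_twistedField z, fun z hz => ?_⟩
  have hx := (mem_regularLocus_iff hm).1 hz
  have hE := trig_isEulerAt hk hm hx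
  have hEhat := rat_isEulerAt hk hm hx
  refine ⟨⟨bijective_fderiv_coordChange hk hm z, fun p => ?_⟩, hE, hEhat,
    fderiv_coordChange_trigEuler hk z, (trig_frame hk hm hx).isDualAt hE,
    (rat_frame hk hm hx).isDualAt hEhat, fun v hv => var_legendreField hk hm hx hv,
    ⟨isFlatFieldAt_legendreField hk hm hx, legendre_mul hk hm hx, legendre_metric hk hm hx⟩,
    fun L ℓ hL hℓ => ⟨trig_isDualPrepotentialAt hk hm hx hL,
      rat_isDualPrepotentialAt hk hm hx hℓ,
      ⟨twisted_generator hk hm hx, twisted_mul hk hm hx, twisted_metric hk hm hx,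
        twisted_frame hk hm hx, twisted_coord hk hm hx, rat_dualEta hk hm hx,
        hessian_eq hk hm hx hL hℓ⟩⟩⟩
  rw [rat_lam_coordChange hk hm, trig_lam]
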